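/- Conventions. A labelled graph $\mathfrak G=(V,\Sigma,\{\xrightarrow{a}\mid a\in\Sigma\})$ consists of a set $V$ of nodes, a finite set $\Sigma$ of actions, and a binary relation $\xrightarrow{a}$ on $V$ for every $a\in\Sigma$. The word graph $\mathfrak G^+=(V^+,\Sigma,\{\xrightarrow{a}\mid a\in\Sigma\})$ has the non-empty words over $V$ as nodes, with $u\xrightarrow{a}v$ if and only if there are $x,y\in V^*$ and $p,q\in V$ such that $p\xrightarrow{a}q$ in $\mathfrak G$, $u=xpy$ and $v=xqy$. First-order (FO) formulas are built from the atoms $x=y$ and $a(x,y)$ (for $a\in\Sigma$, meaning $x\xrightarrow{a}y$) by $\neg,\wedge,\vee,\to,\leftrightarrow,\exists,\forall$. The quantifier rank is the maximal number of nested quantifiers, and $|\varphi|$ is the length of $\varphi$ as a string over a finite alphabet (prefix notation, with the indices of variables and actions in binary). An alternating Turing machine is a nondeterministic Turing machine with finitely many tapes, the states of which are partitioned into universal and existential ones. A configuration with a universal (existential) state is accepting if every (some) successor configuration is accepting; the accepting configurations are the least set obtained in this way. An alternation is a transition from a universal to an existential state or vice versa. The machine has an index tape, which gives random access to the part of its input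 that describes the edges of the graph. A finite graph with nodes $0,\dots,n-1$ and actions $0,\dots,m-1$ and a sentence $\varphi$ are given to the machine as the string $\varphi$ followed by $n$ in unary, written on a tape, together with the adjacency matrices of the graph as a table of bits; in every step the machine sees the bit of the table whose address is written in binary on the index tape (the address of the bit for $p\xrightarrow{a}q$ is $a\cdot 4^b+p\cdot 2^b+q$, where $b$ is the number of binary digits of $n$). Theorem. There are an alternating Turing machine $M$ and a constant $C$ such that for every finite labelled graph $\mathfrak G$ with $n\ge 1$ nodes and every FO-sentence $\varphi$ over the signature of $\mathfrak G$, with quantifier rank $\ell$: 1. $M$ accepts $(\mathfrak G,\varphi)$ if and only if $\mathfrak G^+\models\varphi$; 2. every computation of $M$ on the input $(\mathfrak G,\varphi)$ has at most $C\cdot\max(n,2)^{\ell}\cdot|\varphi|$ steps (so $M$ runs in time $O(n^{\ell}\cdot|\varphi|)$ on graphs with $n\ge 2$ nodes); 3. every computation of $M$ on the input $(\mathfrak G,\varphi)$ has at most $C\cdot\ell$ alternations. -/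

import Mathlib

namespace WordGraph

/-- A labelled graph with node set `V` and set of actions `A`. -/
structure LabelledGraph (V A : Type) where
  edge : A → V → V → Prop

/-- The non-empty words over `V`. -/
abbrev Word (V : Type) : Type := {w : List V // w ≠ []}

/-- The word graph `G⁺`: an `a`-edge replaces one letter `p` of a word, at one position, by a
letter `q` with `p → q` an `a`-edge of `G`. -/
def LabelledGraph.plus {V A : Type} (G : LabelledGraph V A) : LabelledGraph (Word V) A where
  edge a u v := ∃ (x y : List V) (p q : V),
    G.edge a p q ∧ u.1 = x ++ p :: y ∧ v.1 = x ++ q :: y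

/-- First-order formulas with equality over the binary relation symbols `A`; the variables are
`x₀, x₁, x₂, …`, and a variable may be quantified more than once. -/
inductive Formula (A : Type) : Type where
  | eq (x y : ℕ) : Formula A
  | edge (a : A) (x y : ℕ) : Formula A
  | neg (φ : Formula A) : Formula A
  | and (φ ψ : Formula A) : Formula A
  | or (φ ψ : Formula A) : Formula A
  | imp (φ ψ : Formula A) : Formula A
  | iff (φ ψ : Formula A) : Formula A
  | ex (x : ℕ) (φ : Formula A) : Formula A
  | all (x : ℕ) (φ : Formula A) : Formula A

namespace Formula

/-- The set of free variables. -/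
def freeVars {A : Type} : Formula A → Finset ℕ
  | eq x y => {x, y}
  | edge _ x y => {x, y}
  | neg φ => φ.freeVars
  | and φ ψ => φ.freeVars ∪ ψ.freeVars
  | or φ ψ => φ.freeVars ∪ ψ.freeVars
  | imp φ ψ => φ.freeVars ∪ ψ.freeVars
  | iff φ ψ => φ.freeVars ∪ ψ.freeVars
  | ex x φ => φ.freeVars.erase x
  | all x φ => φ.freeVars.erase x

def IsSentence {A : Type} (φ : Formula A) : Prop := φ.freeVars = ∅

/-- The quantifier rank: the maximal number of nested quantifiers. -/
def quantifierRank {A : Type} : Formula A → ℕ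
  | eq _ _ => 0
  | edge _ _ _ => 0
  | neg φ => φ.quantifierRank
  | and φ ψ => max φ.quantifierRank ψ.quantifierRank
  | or φ ψ => max φ.quantifierRank ψ.quantifierRank
  | imp φ ψ => max φ.quantifierRank ψ.quantifierRank
  | iff φ ψ => max φ.quantifierRank ψ.quantifierRank
  | ex _ φ => φ.quantifierRank + 1
  | all _ φ => φ.quantifierRank + 1

/-- Tarski semantics in a labelled graph under an assignment `e` of nodes to the variables. -/
def Sat {W A : Type} (H : LabelledGraph W A) : Formula A → (ℕ → W) → Prop
  | eq x y, e => e x = e y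
  | edge a x y, e => H.edge a (e x) (e y)
  | neg φ, e => ¬ Sat H φ e
  | and φ ψ, e => Sat H φ e ∧ Sat H ψ e
  | or φ ψ, e => Sat H φ e ∨ Sat H ψ e
  | imp φ ψ, e => Sat H φ e → Sat H ψ e
  | iff φ ψ, e => Sat H φ e ↔ Sat H ψ e
  | ex x φ, e => ∃ w : W, Sat H φ (Function.update e x w)
  | all x φ, e => ∀ w : W, Sat H φ (Function.update e x w)

end Formula

/-- `H ⊨ φ` for a sentence `φ` and a graph `H` with at least one node. -/
def LabelledGraph.Models {W A : Type} (H : LabelledGraph W A) (φ : Formula A) : Prop :=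
  ∀ e : ℕ → W, φ.Sat H e

/-- The input symbols of the machines. -/
inductive Sym : Type where
  | eq | edge | neg | and | or | imp | iff | ex | all
  | bit (b : Bool)
  | sep
  | mark

/-- A number in binary, least significant digit first, without leading zeros. -/
def binary (i : ℕ) : List Sym := i.bits.map Sym.bit

/-- A formula as a string over the finite alphabet `Sym`: prefix notation, with the indices of
variables and of actions in binary. -/
def Formula.encode {m : ℕ} : Formula (Fin m) → List Sym
  | .eq x y => Sym.eq :: (binary x ++ Sym.sep :: binary y)
  | .edge a x y => Sym.edge :: (binary a ++ Sym.sep :: (binary x ++ Sym.sep :: binary y))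
  | .neg φ => Sym.neg :: φ.encode
  | .and φ ψ => Sym.and :: (φ.encode ++ ψ.encode)
  | .or φ ψ => Sym.or :: (φ.encode ++ ψ.encode)
  | .imp φ ψ => Sym.imp :: (φ.encode ++ ψ.encode)
  | .iff φ ψ => Sym.iff :: (φ.encode ++ ψ.encode)
  | .ex x φ => Sym.ex :: (binary x ++ φ.encode)
  | .all x φ => Sym.all :: (binary x ++ φ.encode)

/-- The size `|φ|`: the length of the string `φ`. -/
def Formula.size {m : ℕ} (φ : Formula (Fin m)) : ℕ := φ.encode.length

/-- The first part of the input for the pair `(G, φ)`, where `G` has `n` nodes: the string `φ`,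
an end mark, and `n` in unary. -/
def inputWord {m : ℕ} (n : ℕ) (φ : Formula (Fin m)) : List Sym :=
  φ.encode ++ Sym.mark :: List.replicate n (Sym.bit true)

open Classical in
/-- The second part of the input for the pair `(G, φ)`: the adjacency matrices of `G`, one for
each action, as a table of bits. With `b` the number of binary digits of `n`, the bit for an
`a`-edge from `p` to `q` stands at address `a * 4 ^ b + p * 2 ^ b + q`, that is, the binary
expansion of the address consists of those of `a`, `p` and `q`; all unused entries are `0`. -/
noncomputable def adjacencyTable {n m : ℕ} (G : LabelledGraph (Fin n) (Fin m)) : List Bool :=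
  (List.range (m * 4 ^ n.size)).map fun c =>
    decide (∃ (a : Fin m) (p q : Fin n),
      c = (a : ℕ) * 4 ^ n.size + (p : ℕ) * 2 ^ n.size + (q : ℕ) ∧ G.edge a p q)

/-- An alternating Turing machine with `k + 2` two-way infinite tapes. Tape `0` holds the first
part of the input at the start. Tape `1` is the index tape: in each step the machine sees, besides
the scanned symbols, the bit of the second part of the input at the address that is written in
binary on the index tape. A step changes the state, writes a symbol on each tape and
moves each head by at most one cell. The transition relation is nondeterministic, and the states
are partitioned into universal and existential ones. -/
structure ATM : Type 1 where
  State : Type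
  Symbol : Type
  finiteState : Finite State
  finiteSymbol : Finite Symbol
  k : ℕ
  /-- the input symbols and the blank (the image of `none`) as tape symbols -/
  letter : Option Sym ↪ Symbol
  start : State
  /-- the universal states; all others are existential -/
  universal : Set State
  trans : State → (Fin (k + 2) → Symbol) → Bool → Set (State × (Fin (k + 2) → Symbol × SignType))

namespace ATM

/-- A configuration: state, contents of the tapes, positions of the heads. -/
structure Cfg (M : ATM) : Type where
  state : M.State
  tape : Fin (M.k + 2) → ℤ → M.Symbol
  head : Fin (M.k + 2) → ℤ

/-- The symbol of the word `x` that stands on cell `i` if `x` is written on the cells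
`0, 1, 2, …`; all other cells are blank. -/
def cellOf (x : List Sym) (i : ℤ) : Option Sym := if 0 ≤ i then x[i.toNat]? else none

/-- The initial configuration for the input `x`. -/
def initial (M : ATM) (x : List Sym) : M.Cfg where
  state := M.start
  tape := fun j i => if j = 0 then M.letter (cellOf x i) else M.letter none
  head := fun _ => 0

/-- The number `i` is written on the index tape: for all `j`, cell `j` carries the symbol `1` if
and only if the binary digit of `i` of weight `2 ^ j` is `1`. -/
def Cfg.IsAddress {M : ATM} (c : M.Cfg) (i : ℕ) : Prop :=
  ∀ j : ℕ, c.tape 1 (j : ℤ) = M.letter (some (Sym.bit true)) ↔ i.testBit j = true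

open Classical in
/-- The bit of the table `y` at the address on the index tape (`0` beyond the end of `y`). -/
noncomputable def Cfg.lookup {M : ATM} (y : List Bool) (c : M.Cfg) : Bool :=
  decide (∃ i : ℕ, c.IsAddress i ∧ y[i]? = some true)

/-- `c'` is a successor configuration of `c`, where `y` is the second part of the input. -/
def Step (M : ATM) (y : List Bool) (c c' : M.Cfg) : Prop :=
  ∃ (q : M.State) (act : Fin (M.k + 2) → M.Symbol × SignType),
    (q, act) ∈ M.trans c.state (fun j => c.tape j (c.head j)) (c.lookup y) ∧
    c'.state = q ∧
    (∀ j, c'.tape j = Function.update (c.tape j) (c.head j) (act j).1) ∧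
    (∀ j, c'.head j = c.head j + ((act j).2 : ℤ))

/-- The accepting configurations: a universal (existential) configuration is accepting if every
(some) successor configuration is. In particular, a universal configuration without successors is
accepting, and an existential one without successors is not. -/
inductive Accepting (M : ATM) (y : List Bool) : M.Cfg → Prop where
  | all (c : M.Cfg) (h : c.state ∈ M.universal)
      (hs : ∀ c', M.Step y c c' → Accepting M y c') : Accepting M y c
  | ex (c c' : M.Cfg) (h : c.state ∉ M.universal)
      (hs : M.Step y c c') (ha : Accepting M y c') : Accepting M y c

/-- `M` accepts the input `(x, y)`. -/
def Accepts (M : ATM) (x : List Sym) (y : List Bool) : Prop := M.Accepting y (M.initial x)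

/-- `f 0, …, f t` is a computation (with `t` steps) on the input `(x, y)`. -/
def IsComputation (M : ATM) (x : List Sym) (y : List Bool) (t : ℕ) (f : ℕ → M.Cfg) : Prop :=
  f 0 = M.initial x ∧ ∀ i < t, M.Step y (f i) (f (i + 1))

open Classical in
/-- The number of alternations in `f 0, …, f t`: the steps from a universal to an existential
state or vice versa. -/
noncomputable def alternations (M : ATM) (t : ℕ) (f : ℕ → M.Cfg) : ℕ :=
  ((Finset.range t).filter fun i =>
    ¬ ((f i).state ∈ M.universal ↔ (f (i + 1)).state ∈ M.universal)).card

end ATM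

end WordGraph

/-! The proof joins a bound on the words that matter, a compact way to write them, and a game on
formulas with few alternations.

Short words suffice. Atoms relate only words of equal length, and then only the multiset of columns
matters, a column being the tuple of letters at one position: `u = v` says that all columns of the
pair are diagonal, and an edge says that one column is an edge of the graph and the others are
diagonal (`eq_iff_zip`, `changes_iff_zip`). So atoms see multiplicities only up to 2. A new word
splits each column into at most `n` columns, hence agreement of the counts up to `n * t` allows an
answer that preserves agreement up to `t` (`exists_target`, `Similar.zip`, `Sim.respond`). With `k`
quantifiers to go the threshold is `2 * n ^ k`; words of length at most `2 * n ^ ℓ + ℓ` therefore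
suffice, the summand `ℓ` leaving room for a fresh length (`Sim.exists_length`).

Such words can be written with amortised constant effort per letter. As the order of columns is
immaterial, the answer may be taken sorted on each block of positions on which all earlier words are
constant. It is then described by a code: emit the letter, increase it, reset it, halt. Each block
is refined into at most `n` blocks, so with `N = max n 2` there are fewer than `2 * N ^ j`
separations after `j` quantifiers, and a code has length `O(N ^ ℓ)` (`Ref.seps_le`, `budget`).
Resetting a letter costs `O(n)`, but only at a separation of the previous code, so choosing a word
costs `O(N ^ ℓ)` up to terms in the formula length (`run_guess`). By `wSat_iff_bSat` the game played
with codes has the same value as the game played with words.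

Connectives cause no alternations. At each quantifier level the existential player writes a truth
value on every symbol of the remaining formula; the universal player then follows one path through
the connectives, checking labels locally, down to an atom or a quantifier (`run_claimed`, `walks`).
This gives three alternations per quantifier. Its cost is linear in the formula per level, and `ℓ ≤
|φ|` and `ℓ ≤ N ^ ℓ` absorb the number of levels (`run_check`).

An atom is decided by running through two codes at once, with the difference of the current letters
kept in unary (`run_race`). For an edge, one player points at the changed position, and the table is
asked after the two unary letters have been converted to binary by halving (`run_halve`,
`look_address`).

All this is programmed as a stack machine `check`. A derivation of `Run` certifies value, time and
alternations of a position together, and `Run.evaluates` carries the certificate over to a Turing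
machine with one tape per stack. -/

namespace WordGraph

/-! ### Alternating stack machines. -/

/-- The symbols of the codes of words: emit the current letter, go to the next letter, go back to
letter `0`, end of the word. -/
inductive Cd : Type where
  | dot | inc | reset | halt
  deriving DecidableEq

/-- The symbols on the stacks. -/
inductive Glyph : Type where
  | tok (s : Sym) (a : Bool)
  | code (c : Cd)
  | flag (b : Bool)

theorem finite_sym : Finite Sym := by
  let f : Sym → Fin 13 := fun s => match s with
    | .eq => 0 | .edge => 1 | .neg => 2 | .and => 3 | .or => 4 | .imp => 5 | .iff => 6
    | .ex => 7 | .all => 8 | .bit true => 9 | .bit false => 10 | .sep => 11 | .mark => 12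
  refine Finite.of_injective f ?_
  intro a b h
  rcases a with _ | _ | _ | _ | _ | _ | _ | _ | _ | (_ | _) | _ | _ <;>
    rcases b with _ | _ | _ | _ | _ | _ | _ | _ | _ | (_ | _) | _ | _ <;>
    first | rfl | (exfalso; revert h; simp [f])

theorem finite_glyph : Finite Glyph := by
  have := finite_sym
  refine Finite.of_injective (β := (Sym × Bool) ⊕ Fin 4 ⊕ Bool) (fun g => match g with
    | .tok s a => .inl (s, a)
    | .code .dot => .inr (.inl 0)
    | .code .inc => .inr (.inl 1)
    | .code .reset => .inr (.inl 2)
    | .code .halt => .inr (.inl 3)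
    | .flag b => .inr (.inr b)) ?_
  intro a b h
  rcases a with _ | (_ | _) | _ <;> rcases b with _ | (_ | _) | _ <;> simp_all

/-- A record with one entry for each of the stacks of the machine. -/
structure Reg (α : Type) where
  (F X Fl P Pl Q Ql Df C S S2 W Wl A B U V : α)

namespace Reg
variable {α β γ : Type}

def get (r : Reg α) : Fin (15 + 2) → α :=
  ![r.F, r.X, r.Fl, r.P, r.Pl, r.Q, r.Ql, r.Df, r.C, r.S, r.S2, r.W, r.Wl, r.A, r.B, r.U, r.V]

def ofFn (f : Fin (15 + 2) → α) : Reg α :=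
  ⟨f 0, f 1, f 2, f 3, f 4, f 5, f 6, f 7, f 8, f 9, f 10, f 11, f 12, f 13, f 14, f 15, f 16⟩

def map (h : α → β) (r : Reg α) : Reg β :=
  ⟨h r.F, h r.X, h r.Fl, h r.P, h r.Pl, h r.Q, h r.Ql, h r.Df, h r.C, h r.S, h r.S2, h r.W,
    h r.Wl, h r.A, h r.B, h r.U, h r.V⟩

def map₂ (h : α → β → γ) (r : Reg α) (s : Reg β) : Reg γ :=
  ⟨h r.F s.F, h r.X s.X, h r.Fl s.Fl, h r.P s.P, h r.Pl s.Pl, h r.Q s.Q, h r.Ql s.Ql,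
    h r.Df s.Df, h r.C s.C, h r.S s.S, h r.S2 s.S2, h r.W s.W, h r.Wl s.Wl, h r.A s.A,
    h r.B s.B, h r.U s.U, h r.V s.V⟩

theorem get_map (h : α → β) (r : Reg α) (i : Fin (15 + 2)) : (r.map h).get i = h (r.get i) := by
  fin_cases i <;> rfl

theorem get_map₂ (h : α → β → γ) (r : Reg α) (s : Reg β) (i : Fin (15 + 2)) :
    (r.map₂ h s).get i = h (r.get i) (s.get i) := by
  fin_cases i <;> rfl

theorem ofFn_get (r : Reg α) : ofFn r.get = r := rfl

theorem get_injective : Function.Injective (get : Reg α → _) := fun r s h => by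
  rw [← ofFn_get r, h, ofFn_get]

end Reg

/-- An operation on a stack. -/
inductive Op : Type where
  | nop | pop | push (g : Glyph)

theorem finite_op : Finite Op := by
  have := finite_glyph
  refine Finite.of_injective (β := Bool ⊕ Glyph) (fun g => match g with
    | .nop => .inl false
    | .pop => .inl true
    | .push g => .inr g) ?_
  intro a b h
  cases a <;> cases b <;> simp_all

def Op.apply : Op → List Glyph → List Glyph
  | nop, l => l
  | pop, l => l.tail
  | push g, l => g :: l

def nops : Reg Op :=
  ⟨.nop, .nop, .nop, .nop, .nop, .nop, .nop, .nop, .nop, .nop, .nop, .nop, .nop, .nop, .nop, .nop,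
    .nop⟩

/-- The contents of the stacks. -/
abbrev Mem : Type := Reg (List Glyph)

/-- The transition function of an alternating stack machine: mode (`true` for universal), control
state, tops of the stacks and the bit of the table at the address on the stack `X` are mapped to
the list of possible moves. -/
abbrev Transition (Ctl : Type) : Type :=
  Bool → Ctl → Reg (Option Glyph) → Bool → List (Bool × Ctl × Reg Op)

/-- A configuration of a stack machine. -/
structure Cf (Ctl : Type) where
  mode : Bool
  ctl : Ctl
  mem : Mem

open Classical in
/-- The bit of the table `y` at the address on the stack `X`. -/
noncomputable def look (y : List Bool) (X : List Glyph) : Bool :=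
  decide (∃ i : ℕ, (∀ j : ℕ, X.reverse[j]? = some (.tok (.bit true) false) ↔ i.testBit j = true) ∧
    y[i]? = some true)

section
variable {Ctl : Type} (tr : Transition Ctl) (y : List Bool)

noncomputable def succs (c : Cf Ctl) : List (Cf Ctl) :=
  (tr c.mode c.ctl (c.mem.map List.head?) (look y c.mem.X)).map fun z =>
    ⟨z.1, z.2.1, z.2.2.map₂ Op.apply c.mem⟩

/-- `Run c T A b`: from `c`, every computation has at most `T` steps and at most `A` alternations,
and `c` is accepting if and only if `b`. -/
inductive Run : Cf Ctl → ℕ → ℕ → Prop → Prop where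
  | node (c : Cf Ctl) (T A : ℕ) (b : Prop) (A' : Cf Ctl → ℕ) (val : Cf Ctl → Prop)
      (h : ∀ c' ∈ succs tr y c, Run c' T (A' c') (val c'))
      (hA : ∀ c' ∈ succs tr y c, A' c' + (if c.mode = c'.mode then 0 else 1) ≤ A)
      (hb : b ↔ if c.mode then ∀ c' ∈ succs tr y c, val c' else ∃ c' ∈ succs tr y c, val c') :
      Run c (T + 1) A b

variable {tr y}

theorem Run.mono {c : Cf Ctl} {T A : ℕ} {b : Prop} (r : Run tr y c T A b) :
    ∀ {T' A' : ℕ} {b' : Prop}, T ≤ T' → A ≤ A' → (b' ↔ b) → Run tr y c T' A' b' := by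
  induction r with
  | node c T A b A₁ val h hA hb ih =>
    intro T' A' b' hT hA' hb'
    obtain ⟨k, rfl⟩ : ∃ k, T' = k + 1 := ⟨T' - 1, by omega⟩
    exact .node c k A' b' A₁ val (fun c' hc => ih c' hc (by omega) le_rfl Iff.rfl)
      (fun c' hc => (hA c' hc).trans hA') (hb'.trans hb)

theorem Run.det {c c' : Cf Ctl} {T A : ℕ} {b : Prop} (r : Run tr y c' T A b)
    (h : succs tr y c = [c']) (hm : c.mode = c'.mode) : Run tr y c (T + 1) A b :=
  .node c T A b (fun _ => A) (fun _ => b) (by simpa [h] using r) (by simp [h, hm]) (by simp [h])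

theorem Run.det' {c c' : Cf Ctl} {T T' A : ℕ} {b : Prop} (r : Run tr y c' T A b)
    (h : succs tr y c = [c']) (hm : c.mode = c'.mode) (hT : T + 1 ≤ T') : Run tr y c T' A b :=
  (r.det h hm).mono hT le_rfl Iff.rfl

theorem Run.congr_mem {q : Ctl} {μ : Bool} {m m' : Mem} {T A : ℕ} {b : Prop}
    (r : Run tr y ⟨μ, q, m⟩ T A b) (h : m' = m) : Run tr y ⟨μ, q, m'⟩ T A b := h ▸ r

/-- The configuration is a zipper with processed part `d` and rest `t`; each step transfers one
element. Every linear sweep over a stack below is an instance. -/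
theorem Run.loop {α : Type} (cfg : List α → List α → Cf Ctl) (p : α → Prop)
    (hs : ∀ a d t, p a → succs tr y (cfg d (a :: t)) = [cfg (a :: d) t])
    (hm : ∀ a d t, (cfg d (a :: t)).mode = (cfg (a :: d) t).mode) {T A : ℕ} {b : Prop}
    (t : List α) (ht : ∀ a ∈ t, p a) : ∀ d : List α, Run tr y (cfg (t.reverse ++ d) []) T A b →
      Run tr y (cfg d t) (T + t.length) A b := by
  induction t with
  | nil => exact fun d r => r
  | cons a t ih =>
    intro d r
    refine (ih (fun x hx => ht x (List.mem_cons_of_mem _ hx)) (a :: d) ?_).det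
      (hs a d t (ht a List.mem_cons_self)) (hm a d t)
    simpa using r

/-- One alternation is charged whether or not the mode changes, so no case distinction on the mode
is needed. -/
theorem Run.switch {c c' : Cf Ctl} {T A : ℕ} {b : Prop} (r : Run tr y c' T A b)
    (h : succs tr y c = [c']) : Run tr y c (T + 1) (A + 1) b :=
  .node c T (A + 1) b (fun _ => A) (fun _ => b) (by simpa [h] using r)
    (by simp only [h, List.mem_singleton, forall_eq]; split <;> omega) (by simp [h])

/-- Both values obey the same recursion on a well-founded computation tree. Hence `Wins` can name
the value of a position for which only some `b` is known to exist. -/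
theorem Run.unique {c : Cf Ctl} {T A : ℕ} {b : Prop} (r : Run tr y c T A b) :
    ∀ {T' A' : ℕ} {b' : Prop}, Run tr y c T' A' b' → (b ↔ b') := by
  induction r with
  | node c T A b A₁ val h hA hb ih =>
    rintro T' A' b' (⟨_, T', _, _, A₂, val', h', hA', hb'⟩)
    rw [hb, hb']
    split
    · exact forall₂_congr fun c' hc => ih c' hc (h' c' hc)
    · exact exists_congr fun c' => and_congr_right fun hc => ih c' hc (h' c' hc)

variable (tr y) in
/-- The accepting configurations without infinite computations. -/
def Wins (c : Cf Ctl) : Prop := ∃ T A b, Run tr y c T A b ∧ b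

theorem Run.wins_iff {c : Cf Ctl} {T A : ℕ} {b : Prop} (r : Run tr y c T A b) :
    Wins tr y c ↔ b :=
  ⟨fun ⟨_, _, _, r', h⟩ => (r.unique r').2 h, fun h => ⟨T, A, b, r, h⟩⟩

theorem Run.choose {c : Cf Ctl} {T A : ℕ} {l : List (Cf Ctl)} (h : succs tr y c = l)
    (hm : ∀ c' ∈ l, c.mode = c'.mode) (r : ∀ c' ∈ l, ∃ b, Run tr y c' T A b) :
    Run tr y c (T + 1) A
      (if c.mode then ∀ c' ∈ l, Wins tr y c' else ∃ c' ∈ l, Wins tr y c') := by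
  subst h
  refine .node c T A _ (fun _ => A) (Wins tr y) (fun c' hc => ?_) (fun c' hc => by simp [hm c' hc])
    Iff.rfl
  obtain ⟨b, rb⟩ := r c' hc
  exact rb.mono le_rfl le_rfl rb.wins_iff

theorem Run.choose₂ {c c₁ c₂ : Cf Ctl} {T A : ℕ} {b₁ b₂ : Prop}
    (r₁ : Run tr y c₁ T A b₁) (r₂ : Run tr y c₂ T A b₂) (h : succs tr y c = [c₁, c₂])
    (h₁ : c.mode = c₁.mode) (h₂ : c.mode = c₂.mode) :
    Run tr y c (T + 1) A (if c.mode then b₁ ∧ b₂ else b₁ ∨ b₂) := by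
  refine (Run.choose h ?_ ?_).mono le_rfl le_rfl ?_
  · simpa using ⟨h₁, h₂⟩
  · simpa using ⟨⟨b₁, r₁⟩, ⟨b₂, r₂⟩⟩
  · simp [r₁.wins_iff, r₂.wins_iff]

theorem Run.leaf {c : Cf Ctl} (h : succs tr y c = []) : Run tr y c 1 0 (c.mode = true) :=
  .node c 0 0 _ (fun _ => 0) (fun _ => True) (by simp [h]) (by simp [h]) (by simp [h])

end

end WordGraph

/-! ### Simulation of a stack machine by a Turing machine. -/

namespace WordGraph

namespace ATM
variable {M : ATM} {y : List Bool}

/-- From `c`, every computation has at most `T` steps and at most `A` alternations,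
and `c` is accepting if and only if `b`. -/
def Evaluates (M : ATM) (y : List Bool) (c : M.Cfg) (T A : ℕ) (b : Prop) : Prop :=
  (M.Accepting y c ↔ b) ∧ ∀ (t : ℕ) (f : ℕ → M.Cfg), f 0 = c →
    (∀ i < t, M.Step y (f i) (f (i + 1))) → t ≤ T ∧ M.alternations t f ≤ A

open Classical in
theorem accepting_iff (c : M.Cfg) : M.Accepting y c ↔
    if c.state ∈ M.universal then ∀ c', M.Step y c c' → M.Accepting y c'
    else ∃ c', M.Step y c c' ∧ M.Accepting y c' := by
  split <;> rename_i h
  · refine ⟨fun hc => ?_, .all c h⟩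
    cases hc with
    | all _ _ hs => exact hs
    | ex _ c' h' => exact absurd h h'
  · refine ⟨fun hc => ?_, fun ⟨c', hs, ha⟩ => .ex c c' h hs ha⟩
    cases hc with
    | all _ h' _ => exact absurd h' h
    | ex _ c' _ hs ha => exact ⟨c', hs, ha⟩

open Classical in
theorem alternations_succ (t : ℕ) (f : ℕ → M.Cfg) :
    M.alternations (t + 1) f = M.alternations t (fun i => f (i + 1)) +
      if ((f 0).state ∈ M.universal ↔ (f 1).state ∈ M.universal) then 0 else 1 := by
  unfold alternations
  rw [Finset.card_filter, Finset.card_filter, Finset.sum_range_succ']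
  congr 1
  simp only [zero_add]
  split <;> simp_all

open Classical in
theorem Evaluates.node {c : M.Cfg} {T A : ℕ}
    (h : ∀ c', M.Step y c c' → ∃ A' b, Evaluates M y c' T A' b ∧
      A' + (if (c.state ∈ M.universal ↔ c'.state ∈ M.universal) then 0 else 1) ≤ A) :
    Evaluates M y c (T + 1) A (M.Accepting y c) := by
  refine ⟨Iff.rfl, ?_⟩
  intro t f h0 hf
  cases t with
  | zero => simp [alternations]
  | succ t =>
    have h1 : M.Step y c (f 1) := h0 ▸ hf 0 (Nat.succ_pos t)
    obtain ⟨A', b, he, hA⟩ := h _ h1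
    obtain ⟨ht, ha⟩ := he.2 t (fun i => f (i + 1)) rfl
      (fun i hi => hf (i + 1) (Nat.succ_lt_succ hi))
    rw [alternations_succ, h0]
    omega

theorem Evaluates.det {c d : M.Cfg} {T A : ℕ} {b : Prop} (h : Evaluates M y d T A b)
    (hs : ∀ c', M.Step y c c' ↔ c' = d) (hu : c.state ∈ M.universal ↔ d.state ∈ M.universal) :
    Evaluates M y c (T + 1) A b := by
  have := Evaluates.node (A := A) fun c' hc' => ⟨A, b, ((hs c').1 hc') ▸ h, by
    obtain rfl := (hs c').1 hc'
    simp [hu]⟩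
  refine ⟨?_, this.2⟩
  rw [accepting_iff, ← h.1]
  simp [hs]

end ATM

/-- The symbol at depth `k` in a stack; blank outside of the stack. -/
def cell (l : List Glyph) (k : ℤ) : Option Glyph := if 0 ≤ k then l[k.toNat]? else none

theorem cell_cons (g : Glyph) (l : List Glyph) (k : ℤ) (hk : k ≠ 0) :
    cell (g :: l) k = cell l (k - 1) := by
  unfold cell
  by_cases h : 0 ≤ k
  · obtain ⟨i, rfl⟩ : ∃ i : ℕ, k = i + 1 := ⟨(k - 1).toNat, by omega⟩
    simp [h]
  · rw [if_neg h, if_neg (by omega)]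

/-- The direction in which the stack on a tape grows. -/
def dirOf (j : Fin (15 + 2)) : SignType := if j = 0 then -1 else 1

/-- The action on a tape that begins the operation on its stack. -/
def Op.first (o : Op) (d : SignType) (s : Option Glyph) : Option Glyph × SignType :=
  match o with
  | .nop => (s, 0)
  | .pop => (none, if s.isSome then -d else 0)
  | .push _ => (s, d)

/-- The action on a tape that completes the operation on its stack. -/
def Op.second (o : Op) (s : Option Glyph) : Option Glyph × SignType :=
  match o with
  | .push g => (some g, 0)
  | _ => (s, 0)

/-- The invariant puts depth `k` of the stack `k` cells away from the head, against the direction of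
growth. A push needs two steps, because the head must reach the new cell before it writes; a pop
erases before it retreats, so everything outside the stack stays blank. -/
theorem cell_apply (o : Op) (d : SignType) (hd : d = 1 ∨ d = -1) (l : List Glyph)
    (t t₁ t₂ : ℤ → Option Glyph) (h h₁ : ℤ) (ht : ∀ z, t z = cell l ((d : ℤ) * (h - z)))
    (e₁ : t₁ = Function.update t h (o.first d (t h)).1) (e₂ : h₁ = h + (o.first d (t h)).2)
    (e₃ : t₂ = Function.update t₁ h₁ (o.second (t₁ h₁)).1) :
    (∀ z, t₂ z = cell (o.apply l) ((d : ℤ) * (h₁ - z))) ∧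
      (d : ℤ) * (h₁ - h) = (o.apply l).length - l.length := by
  have hth : t h = l.head? := by rw [ht]; cases l <;> simp [cell]
  have dd : (d : ℤ) * d = 1 := by rcases hd with rfl | rfl <;> simp
  have dz : ∀ z, z ≠ h → (d : ℤ) * (h - z) ≠ 0 := by
    intro z hz
    have : h - z ≠ 0 := by omega
    exact mul_ne_zero (by rintro h0; simp [h0] at dd) this
  cases o with
  | nop =>
    simp only [Op.first, SignType.coe_zero, add_zero, Function.update_eq_self] at e₁ e₂
    subst e₁ e₂
    simp only [Op.second, Function.update_eq_self] at e₃
    subst e₃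
    simpa [Op.apply] using ht
  | pop =>
    cases l with
    | nil =>
      simp only [List.head?_nil] at hth
      simp only [Op.first, hth, Option.isSome_none, Bool.false_eq_true, if_false,
        SignType.coe_zero, add_zero] at e₁ e₂
      rw [← hth, Function.update_eq_self] at e₁
      subst e₁ e₂
      simp only [Op.second, Function.update_eq_self] at e₃
      subst e₃
      simpa [Op.apply] using ht
    | cons g l =>
      simp only [List.head?_cons] at hth
      simp only [Op.first, hth, Option.isSome_some, if_true] at e₁ e₂
      simp only [Op.second, Function.update_eq_self] at e₃
      subst e₁ e₃
      have hh : (d : ℤ) * (h₁ - h) = -1 := by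
        rw [e₂]; rcases hd with rfl | rfl <;> simp
      refine ⟨fun z => ?_, by simp [Op.apply, hh]⟩
      have e : (d : ℤ) * (h₁ - z) = (d : ℤ) * (h - z) - 1 := by linear_combination hh
      rw [e]
      by_cases hz : z = h
      · subst hz; simp [cell]
      · rw [Function.update_of_ne hz, ht, cell_cons _ _ _ (dz z hz)]; rfl
  | push g =>
    simp only [Op.first, Function.update_eq_self] at e₁ e₂
    simp only [Op.second] at e₃
    subst e₁ e₃
    have hh : (d : ℤ) * (h₁ - h) = 1 := by rw [e₂]; linear_combination dd
    refine ⟨fun z => ?_, by simp [Op.apply, hh]⟩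
    have e : (d : ℤ) * (h₁ - z) = (d : ℤ) * (h - z) + 1 := by linear_combination hh
    by_cases hz : z = h₁
    · subst hz; simp [cell, Op.apply]
    · have hz' : (d : ℤ) * (h - z) + 1 ≠ 0 := by
        rw [← e]
        have : h₁ - z ≠ 0 := by omega
        exact mul_ne_zero (by rintro h0; simp [h0] at dd) this
      rw [Function.update_of_ne hz, ht, e, Op.apply, cell_cons _ _ _ hz', add_sub_cancel_right]

/-- The universal states of the simulating machine. -/
def universalStates (Ctl : Type) : Set (Option (Bool × Ctl × Option (Reg Op))) := {q | ∃ z, q = some (true, z)}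

theorem mem_universal {Ctl : Type} (μ : Bool) (z) : some (μ, z) ∈ universalStates Ctl ↔ μ = true := by
  rcases z with ⟨a, b⟩
  cases μ <;> simp [universalStates]

section
variable {Ctl : Type} [Finite Ctl] (tr : Transition Ctl) (q₀ : Ctl)

/-- The alternating Turing machine that simulates a stack machine, two steps for one. -/
abbrev toATM : ATM where
  State := Option (Bool × Ctl × Option (Reg Op))
  Symbol := Option Glyph
  finiteState := by
    have := finite_op
    have : Finite (Reg Op) := Finite.of_injective _ Reg.get_injective
    infer_instance
  finiteSymbol := by
    have := finite_glyph
    infer_instance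
  k := 15
  letter := Function.Embedding.optionMap ⟨fun s => .tok s false, fun _ _ h => by cases h; rfl⟩
  start := none
  universal := universalStates Ctl
  trans := fun q s b => match q with
    -- A push moves before it writes. With the head of the index tape at cell `-1`, the bottom of
    -- the stack `X` comes to lie on cell `0`, the place of the lowest binary digit.
    | none => {(some (false, q₀, none), fun j => (s j, if j = 1 then -1 else 0))}
    | some (μ, q, none) => {x | ∃ z ∈ tr μ q (Reg.ofFn s) b,
        x = (some (z.1, z.2.1, some z.2.2), fun j => (z.2.2.get j).first (dirOf j) (s j))}
    | some (μ, q, some o) => {(some (μ, q, none), fun j => (o.get j).second (s j))}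

/-- The configuration `c` of the Turing machine represents the stacks `m`. -/
structure Represents (m : Mem) (c : (toATM tr q₀).Cfg) : Prop where
  tape : ∀ (j : Fin (15 + 2)) (z : ℤ), c.tape j z = cell (m.get j) ((dirOf j : ℤ) * (c.head j - z))
  head : c.head (1 : Fin (15 + 2)) = m.X.length - 1

variable {tr q₀}

theorem dirOf_eq (j : Fin (15 + 2)) : dirOf j = 1 ∨ dirOf j = -1 := by
  unfold dirOf; split <;> simp

theorem Represents.tops {m : Mem} {c : (toATM tr q₀).Cfg} (h : Represents tr q₀ m c) :
    Reg.ofFn (fun j => c.tape j (c.head j)) = m.map List.head? := by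
  apply Reg.get_injective
  funext j
  rw [Reg.get_map]
  have : (Reg.ofFn (fun j : Fin (15 + 2) => c.tape j (c.head j))).get j = c.tape j (c.head j) := by
    fin_cases j <;> rfl
  rw [this, h.tape]
  cases m.get j <;> simp [cell]

/-- The field `head` anchors the bottom of `X` at cell `0`, so cell `j` carries the entry number `j`
from the bottom. -/
theorem Represents.lookup {m : Mem} {c : (toATM tr q₀).Cfg} (h : Represents tr q₀ m c)
    (y : List Bool) : c.lookup y = look y m.X := by
  unfold ATM.Cfg.lookup look
  congr 1
  refine propext (exists_congr fun i => and_congr_left fun _ => forall_congr' fun j => ?_)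
  have : c.tape (1 : Fin (15 + 2)) (j : ℤ) = m.X.reverse[j]? := by
    rw [h.tape, h.head]
    simp only [dirOf, one_ne_zero, if_false, SignType.coe_one, one_mul]
    change cell m.X _ = _
    unfold cell
    split
    · rw [List.getElem?_reverse (by omega)]
      congr 1; omega
    · rw [eq_comm, List.getElem?_eq_none_iff, List.length_reverse]; omega
  change (c.tape (1 : Fin (15 + 2)) (j : ℤ) = some (.tok (.bit true) false) ↔ _) ↔ _
  rw [this]

theorem Represents.apply {m : Mem} {c c₁ c₂ : (toATM tr q₀).Cfg} (h : Represents tr q₀ m c)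
    (o : Reg Op)
    (t₁ : ∀ j : Fin (15 + 2), c₁.tape j = Function.update (c.tape j) (c.head j)
      ((o.get j).first (dirOf j) (c.tape j (c.head j))).1)
    (h₁ : ∀ j : Fin (15 + 2), c₁.head j = c.head j +
      (((o.get j).first (dirOf j) (c.tape j (c.head j))).2 : ℤ))
    (t₂ : ∀ j : Fin (15 + 2), c₂.tape j = Function.update (c₁.tape j) (c₁.head j)
      ((o.get j).second (c₁.tape j (c₁.head j))).1)
    (h₂ : ∀ j : Fin (15 + 2), c₂.head j = c₁.head j) :
    Represents tr q₀ (o.map₂ Op.apply m) c₂ := by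
  have key := fun j : Fin (15 + 2) => cell_apply (o.get j) (dirOf j) (dirOf_eq j) (m.get j) (c.tape j)
    (c₁.tape j) (c₂.tape j) (c.head j) (c₁.head j) (h.tape j) (t₁ j) (h₁ j) (t₂ j)
  refine ⟨fun j z => ?_, ?_⟩
  · rw [Reg.get_map₂, h₂, (key j).1]
  · have := (key 1).2
    rw [h₂]
    simp only [dirOf, one_ne_zero, if_false, SignType.coe_one, one_mul] at this
    change c₁.head (1 : Fin (15 + 2)) - c.head (1 : Fin (15 + 2)) =
      (o.X.apply m.X).length - m.X.length at this
    have := h.head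
    change c₁.head (1 : Fin (15 + 2)) = (o.X.apply m.X).length - 1
    omega

/-- The configuration in the middle of the simulation of a step. -/
def midCfg (c : (toATM tr q₀).Cfg) (z : Bool × Ctl × Reg Op) : (toATM tr q₀).Cfg :=
  ⟨some (z.1, z.2.1, some z.2.2),
    fun (j : Fin (15 + 2)) => Function.update (c.tape j) (c.head j)
      ((z.2.2.get j).first (dirOf j) (c.tape j (c.head j))).1,
    fun (j : Fin (15 + 2)) => c.head j +
      (((z.2.2.get j).first (dirOf j) (c.tape j (c.head j))).2 : ℤ)⟩

/-- The configuration at the end of the simulation of a step. -/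
def endCfg (c : (toATM tr q₀).Cfg) (μ : Bool) (q : Ctl) (o : Reg Op) : (toATM tr q₀).Cfg :=
  ⟨some (μ, q, none),
    fun (j : Fin (15 + 2)) => Function.update (c.tape j) (c.head j)
      ((o.get j).second (c.tape j (c.head j))).1, c.head⟩

theorem step_mid {y : List Bool} {c c' : (toATM tr q₀).Cfg} {μ : Bool} {q : Ctl} {o : Reg Op}
    (hs : c.state = some (μ, q, some o)) : (toATM tr q₀).Step y c c' ↔
      c' = endCfg c μ q o := by
  have e : ∀ (o : Op) s, (o.second s).2 = 0 := fun o s => by cases o <;> rfl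
  unfold ATM.Step
  rw [hs]
  constructor
  · rintro ⟨q', act, h, h₁, h₂, h₃⟩
    cases h
    obtain ⟨s, t, hd⟩ := c'
    simp only at h₁ h₂ h₃
    subst h₁
    unfold endCfg
    congr 1
    · funext j; exact h₂ j
    · funext j; rw [h₃, e]; simp
  · rintro rfl
    exact ⟨_, _, rfl, rfl, fun j => rfl, fun j => by rw [e]; simp [endCfg]⟩

theorem step_run {y : List Bool} {c c' : (toATM tr q₀).Cfg} {μ : Bool} {q : Ctl}
    (hs : c.state = some (μ, q, none)) : (toATM tr q₀).Step y c c' ↔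
      ∃ z ∈ tr μ q (Reg.ofFn fun j => c.tape j (c.head j)) (c.lookup y),
      c' = midCfg c z := by
  unfold ATM.Step
  rw [hs]
  constructor
  · rintro ⟨q', act, ⟨z, hz, h⟩, h₁, h₂, h₃⟩
    cases h
    refine ⟨z, hz, ?_⟩
    obtain ⟨s, t, hd⟩ := c'
    simp only at h₁ h₂ h₃
    subst h₁
    unfold midCfg
    congr 1
    · funext j; exact h₂ j
    · funext j; exact h₃ j
  · rintro ⟨z, hz, rfl⟩
    exact ⟨_, _, ⟨z, hz, rfl⟩, rfl, fun j => rfl, fun j => rfl⟩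

/-- Each stack step becomes two steps. The configuration in the middle already has the new mode, so
the second half adds no alternation. -/
theorem Run.evaluates {y : List Bool} {d : Cf Ctl} {T A : ℕ} {b : Prop} (r : Run tr y d T A b) :
    ∀ c : (toATM tr q₀).Cfg, c.state = some (d.mode, d.ctl, none) → Represents tr q₀ d.mem c →
      (toATM tr q₀).Evaluates y c (2 * T) A b := by
  classical
  induction r with
  | node d T A b A' val h hA hb ih =>
    intro c hs hc
    have key : ∀ z ∈ tr d.mode d.ctl (d.mem.map List.head?) (look y d.mem.X),
        (toATM tr q₀).Evaluates y (midCfg c z) (2 * T + 1)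
          (A' ⟨z.1, z.2.1, z.2.2.map₂ Op.apply d.mem⟩)
          (val ⟨z.1, z.2.1, z.2.2.map₂ Op.apply d.mem⟩) := fun z hz =>
      ATM.Evaluates.det
        (ih ⟨z.1, z.2.1, z.2.2.map₂ Op.apply d.mem⟩ (List.mem_map.2 ⟨z, hz, rfl⟩)
          (endCfg (midCfg c z) z.1 z.2.1 z.2.2) rfl
          (hc.apply z.2.2 (fun _ => rfl) (fun _ => rfl) (fun _ => rfl) (fun _ => rfl)))
        (fun _ => step_mid rfl)
        (by simp only [endCfg, midCfg, mem_universal])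
    have step : ∀ c', (toATM tr q₀).Step y c c' ↔
        ∃ z ∈ tr d.mode d.ctl (d.mem.map List.head?) (look y d.mem.X), c' = midCfg c z :=
      fun c' => by rw [step_run hs, hc.tops, hc.lookup]
    have := ATM.Evaluates.node (M := toATM tr q₀) (y := y) (T := 2 * T + 1) (A := A) (c := c)
      (fun c' hc' => by
        obtain ⟨z, hz, rfl⟩ := (step c').1 hc'
        refine ⟨_, _, key z hz, ?_⟩
        have := hA ⟨z.1, z.2.1, z.2.2.map₂ Op.apply d.mem⟩ (List.mem_map.2 ⟨z, hz, rfl⟩)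
        rw [hs]
        simp only [midCfg, mem_universal, ← Bool.eq_iff_iff]
        exact this)
    refine ⟨?_, this.2⟩
    rw [ATM.accepting_iff, hb, hs]
    simp only [mem_universal]
    split
    · constructor
      · intro H c' hc'
        obtain ⟨z, hz, rfl⟩ := List.mem_map.1 hc'
        exact (key z hz).1.1 (H _ ((step _).2 ⟨z, hz, rfl⟩))
      · intro H c' hc'
        obtain ⟨z, hz, rfl⟩ := (step _).1 hc'
        exact (key z hz).1.2 (H _ (List.mem_map.2 ⟨z, hz, rfl⟩))
    · constructor
      · rintro ⟨c', hc', H⟩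
        obtain ⟨z, hz, rfl⟩ := (step _).1 hc'
        exact ⟨_, List.mem_map.2 ⟨z, hz, rfl⟩, (key z hz).1.1 H⟩
      · rintro ⟨c', hc', H⟩
        obtain ⟨z, hz, rfl⟩ := List.mem_map.1 hc'
        exact ⟨_, (step _).2 ⟨z, hz, rfl⟩, (key z hz).1.2 H⟩

/-- The initial stacks for the input `x`. -/
def inputMem (x : List Sym) : Mem :=
  ⟨x.map (.tok · false), [], [], [], [], [], [], [], [], [], [], [], [], [], [], [], []⟩

theorem Run.evaluates_initial {y : List Bool} {x : List Sym} {T A : ℕ} {b : Prop}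
    (r : Run tr y ⟨false, q₀, inputMem x⟩ T A b) :
    (toATM tr q₀).Evaluates y ((toATM tr q₀).initial x) (2 * T + 1) A b := by
  classical
  have step : ∀ c', (toATM tr q₀).Step y ((toATM tr q₀).initial x) c' ↔
      c' = ⟨some (false, q₀, none), ((toATM tr q₀).initial x).tape,
        fun j : Fin (15 + 2) => if j = 1 then -1 else 0⟩ := by
    intro c'
    unfold ATM.Step
    constructor
    · rintro ⟨q', act, h, h₁, h₂, h₃⟩
      cases h
      obtain ⟨s, t, hd⟩ := c'
      simp only at h₁ h₂ h₃
      subst h₁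
      congr 1
      · funext j; rw [h₂]; exact Function.update_eq_self _ _
      · funext j; rw [h₃]
        change (0 : ℤ) + ((if j = (1 : Fin (15 + 2)) then (-1 : SignType) else 0 : SignType) : ℤ) = _
        split <;> simp_all
    · rintro rfl
      refine ⟨_, _, rfl, rfl, fun j => (Function.update_eq_self _ _).symm, fun j => ?_⟩
      change _ = (0 : ℤ) + ((if j = (1 : Fin (15 + 2)) then (-1 : SignType) else 0 : SignType) : ℤ)
      change (if j = (1 : Fin (15 + 2)) then _ else _) = _
      split <;> simp
  refine ATM.Evaluates.det (r.evaluates _ rfl ⟨fun j z => ?_, rfl⟩) step ?_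
  · have e : ∀ z : ℤ, Option.map (fun s => Glyph.tok s false) (ATM.cellOf x z) =
        cell (x.map (.tok · false)) z := by
      intro z; unfold cell ATM.cellOf; split <;> simp
    have e' : ∀ z : ℤ, cell [] z = none := by intro z; unfold cell; simp
    -- The stack on tape `0` grows to the left, so the input with the head on its first letter is
    -- already a stack with that letter on top.
    by_cases hj : j = 0
    · subst hj
      change Option.map (fun s => Glyph.tok s false) (ATM.cellOf x z) = _
      rw [e]
      change _ = cell _ (-1 * ((if (0 : Fin (15 + 2)) = 1 then -1 else 0) - z))
      simp [inputMem, Reg.get]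
    · have : (inputMem x).get j = [] := by fin_cases j <;> first | rfl | exact absurd rfl hj
      rw [this, e']
      change (if j = (0 : Fin (15 + 2)) then _ else _) = _
      rw [if_neg hj]; rfl
  · simp [ATM.initial, universalStates]

end

end WordGraph

/-! ### The program of the model checking machine. -/

namespace WordGraph

set_option synthInstance.maxHeartbeats 400000 in
set_option synthInstance.maxSize 2000 in
/-- The control states of the model checking machine. -/
inductive Ctl : Type where
  | scan | leave | table | unary | unread | init | mul | mulNext | mulRow | mulBack | mulEnd
  | toEnd (v : Bool) | label (v : Bool)
  | walk | right (k : Bool → Bool → Bool) | skip (k : Bool → Bool)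
  | guess (v h : Bool) | rewind (v : Bool) | copy (v : Bool) | back (v : Bool) | name (v : Bool)
  | action (v : Bool) | lookUp (v e i : Bool) | agree (v e i : Bool) | toHash (v e i : Bool)
  | passWord (v e i : Bool) | fetch (v e i : Bool) | restore (v e : Bool) | advance (v e : Bool)
  | run (v u : Bool) | claim (v : Bool)
  | zeros (v i : Bool) | ones (v i : Bool) | halve (v i : Bool) | pair (v i b : Bool)
  | pair' (v i b x : Bool) | collect (v i : Bool) | toEdge (v : Bool) | address (v : Bool)
  | ask (v : Bool) | halt
  deriving Fintype

open Ctl Glyph in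
/-- The transition function of the model checking machine. -/
def check : Transition Ctl := fun μ q t y => match q with
  | scan => match t.F with
    | some (tok s a) => match s with
      | .bit _ | .sep | .neg => [(μ, scan, { nops with F := .pop, Fl := .push (tok s a) })]
      | .eq | .edge => [(μ, leave, { nops with F := .pop, Fl := .push (tok s a) })]
      | .and | .or | .imp | .iff =>
        [(μ, scan, { nops with F := .pop, Fl := .push (tok s a), C := .push (flag false) })]
      -- `V` holds the current quantifier depth and `U` the maximal depth so far minus the current
      -- one. `C` records open quantifiers (`true`) and pending second operands (`false`). Popping
      -- an empty `U` does nothing, which is the case of a new maximum.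
      | .ex | .all => [(μ, scan, { nops with
          F := .pop, Fl := .push (tok s a), C := .push (flag true), V := .push (flag true),
          U := .pop })]
      | .mark => [(μ, table, { nops with F := .pop, Fl := .push (tok s a) })]
    | _ => []
  | leave => match t.C with
    | some (flag true) =>
      [(μ, leave, { nops with C := .pop, V := .pop, U := .push (flag true) })]
    | some _ => [(μ, scan, { nops with C := .pop })]
    | none => [(μ, scan, nops)]
  -- One of the `n` marks is dropped: `P` and `Q` hold the `n - 1` increments possible above letter
  -- `0`.
  | table => [(μ, unary, { nops with F := .pop })]
  | unary => match t.F with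
    | some _ => [(μ, unary, { nops with
        F := .pop, P := .push (flag true), Q := .push (flag true) })]
    | none => [(μ, unread, nops)]
  | unread => match t.Fl with
    | some g => [(μ, unread, { nops with Fl := .pop, F := .push g })]
    | none => [(μ, init, { nops with S := .push (code .dot) })]
  | init => [(μ, mul, { nops with S := .push (code .dot) })]
  | mul => match t.U with
    | some _ => [(μ, mulNext, { nops with U := .pop })]
    | none => [(μ, toEnd true, nops)]
  | mulNext => match t.S with
    | some _ => [(μ, mulRow, { nops with S := .pop, S2 := .push (code .dot) })]
    | none => [(μ, mulEnd, { nops with S2 := .push (code .dot) })]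
  | mulRow => match t.P with
    | some g => [(μ, mulRow, { nops with P := .pop, Pl := .push g, S2 := .push (code .dot) })]
    | none => [(μ, mulBack, nops)]
  | mulBack => match t.Pl with
    | some g => [(μ, mulBack, { nops with Pl := .pop, P := .push g })]
    | none => [(μ, mulNext, nops)]
  | mulEnd => match t.S2 with
    | some g => [(μ, mulEnd, { nops with S2 := .pop, S := .push g })]
    | none => [(μ, mul, nops)]
  | toEnd v => match t.F with
    | some (tok .mark _) => [(μ, label v, nops)]
    | some g => [(μ, toEnd v, { nops with F := .pop, Fl := .push g, C := .push (flag true) })]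
    | none => []
  | label v => match t.C with
    | some _ => match t.Fl with
      | some (tok s _) =>
        [(μ, label v, { nops with Fl := .pop, F := .push (tok s true), C := .pop }),
          (μ, label v, { nops with Fl := .pop, F := .push (tok s false), C := .pop })]
      | _ => []
    | none => [(true, skip (· == v), nops)]
  | walk => match t.F with
    | some (tok s a) => match s with
      | .neg => [(μ, skip fun v => !(v == a), { nops with F := .pop, Fl := .push (tok s a) })]
      -- One branch verifies the left operand. The other one skips it, remembers its label, compares
      -- the three labels on reaching the right operand, and goes on there.
      | .and => [(μ, walk, { nops with F := .pop, Fl := .push (tok s a) }),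
          (μ, right fun v w => (v && w) == a, { nops with F := .pop, Fl := .push (tok s a) })]
      | .or => [(μ, walk, { nops with F := .pop, Fl := .push (tok s a) }),
          (μ, right fun v w => (v || w) == a, { nops with F := .pop, Fl := .push (tok s a) })]
      | .imp => [(μ, walk, { nops with F := .pop, Fl := .push (tok s a) }),
          (μ, right fun v w => (!v || w) == a, { nops with F := .pop, Fl := .push (tok s a) })]
      | .iff => [(μ, walk, { nops with F := .pop, Fl := .push (tok s a) }),
          (μ, right fun v w => (v == w) == a, { nops with F := .pop, Fl := .push (tok s a) })]
      -- The label decides who chooses the word: for a false label every word has to be covered, so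
      -- the choice is universal.
      | .ex => [(!a, guess a false, nops)]
      | .all => [(a, guess a false, nops)]
      | .eq => [(!a, lookUp a false false, { nops with F := .pop, Fl := .push (tok s a) })]
      | .edge => [(!a, action a, { nops with F := .pop, Fl := .push (tok s a) })]
      | _ => []
    | _ => []
  | right k => match t.F with
    | some (tok _ a) => [(μ, skip (k a), { nops with C := .push (flag true) })]
    | _ => []
  | skip k => match t.F with
    | some (tok s a) => match s with
      | .bit _ | .sep => [(μ, skip k, { nops with F := .pop, Fl := .push (tok s a) })]
      | .eq | .edge => match t.C with
        | none => [(if k a then (μ, walk, nops) else (false, halt, nops))]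
        | some _ => [(μ, skip k, { nops with F := .pop, Fl := .push (tok s a), C := .pop })]
      | .and | .or | .imp | .iff => match t.C with
        | none => [(if k a then (μ, walk, nops) else (false, halt, nops))]
        | some _ =>
          [(μ, skip k, { nops with F := .pop, Fl := .push (tok s a), C := .push (flag true) })]
      | .neg | .ex | .all => match t.C with
        | none => [(if k a then (μ, walk, nops) else (false, halt, nops))]
        | some _ => [(μ, skip k, { nops with F := .pop, Fl := .push (tok s a) })]
      | .mark => []
    | _ => []
  | guess v h => match t.S with
    | some (code .dot) =>
      (μ, guess v true,
        { nops with S := .pop, W := .push (code .dot), S2 := .push (code .dot) }) ::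
      ((match t.P with
        | some g => [(μ, guess v h, { nops with
            P := .pop, Pl := .push g, W := .push (code .inc), S2 := .push (code .inc) })]
        | none => []) ++
      if h then
        [(μ, rewind v, { nops with W := .push (code .halt), S2 := .push (code .halt) })]
      else [])
    | some _ => match t.Pl with
      | some g => [(μ, guess v h, { nops with Pl := .pop, P := .push g })]
      | none => [(μ, guess v h, { nops with
          S := .pop, W := .push (code .reset), S2 := .push (code .reset) })]
    | none => [(μ, rewind v, { nops with W := .push (code .halt), S2 := .push (code .halt) })]
  | rewind v => match t.Pl with
    | some g => [(μ, rewind v, { nops with Pl := .pop, P := .push g })]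
    | none => [(μ, copy v, nops)]
  | copy v => match t.S with
    | some g => [(μ, copy v, { nops with S := .pop, W := .push g, S2 := .push g })]
    | none => [(μ, back v, nops)]
  | back v => match t.S2 with
    | some g => [(μ, back v, { nops with S2 := .pop, S := .push g })]
    | none => match t.F with
      | some g => [(μ, name v, { nops with F := .pop, Fl := .push g, W := .push (flag false) })]
      | none => []
  | name v => match t.F with
    | some (tok (.bit b) a) => [(μ, name v, { nops with
        F := .pop, Fl := .push (tok (.bit b) a), W := .push (tok (.bit b) false) })]
    | _ => [(false, toEnd v, nops)]
  | action v => match t.F with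
    | some (tok .sep a) =>
      [(μ, lookUp v true false, { nops with F := .pop, Fl := .push (tok .sep a) })]
    | some g => [(μ, action v, { nops with F := .pop, Fl := .push g })]
    | none => []
  | lookUp v e i => match t.F with
    | some (tok (.bit b) a) =>
      [(μ, lookUp v e i, { nops with F := .pop, Fl := .push (tok (.bit b) a) })]
    | _ => [(μ, agree v e i, nops)]
  | agree v e i => match t.W, t.Fl with
    | some (tok (.bit b) a), some (tok (.bit b') a') =>
      if b = b' then [(μ, agree v e i, { nops with
        W := .pop, Wl := .push (tok (.bit b) a), Fl := .pop, F := .push (tok (.bit b') a') })]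
      else [(μ, toHash v e i, nops)]
    | some (tok _ _), _ => [(μ, toHash v e i, nops)]
    | some _, some (tok (.bit _) _) => [(μ, toHash v e i, nops)]
    | some g, _ => [(μ, fetch v e i, { nops with W := .pop, Wl := .push g })]
    | none, _ => []
  | toHash v e i => match t.W with
    | some (flag b) => [(μ, passWord v e i, { nops with W := .pop, Wl := .push (flag b) })]
    | some g => [(μ, toHash v e i, { nops with W := .pop, Wl := .push g })]
    | none => []
  | passWord v e i => match t.W with
    | some (code c) => [(μ, passWord v e i, { nops with W := .pop, Wl := .push (code c) })]
    | _ => [(μ, lookUp v e i, nops)]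
  | fetch v e i => match t.W with
    | some (code c) =>
      if i then [(μ, fetch v e i, { nops with
        W := .pop, Wl := .push (code c), B := .push (code c) })]
      else [(μ, fetch v e i, { nops with
        W := .pop, Wl := .push (code c), A := .push (code c) })]
    | _ => if i then [(μ, run v !e, nops)] else [(μ, restore v e, nops)]
  | restore v e => match t.Wl with
    | some g => [(μ, restore v e, { nops with Wl := .pop, W := .push g })]
    | none => [(μ, advance v e, nops)]
  | advance v e => match t.F with
    | some (tok .sep a) =>
      [(μ, lookUp v e true, { nops with F := .pop, Fl := .push (tok .sep a) })]
    | some g => [(μ, advance v e, { nops with F := .pop, Fl := .push g })]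
    | none => []
  -- The flag `u` says that the remaining letters must all agree. It is set from the start for an
  -- equality, and for an edge once the changed letter has been passed.
  | run v u => match t.A with
    | some (code .inc) => [(μ, run v u, { nops with
        A := .pop, P := .pop, Pl := .push (flag true),
        Df := if t.Df matches some (flag false) then .pop else .push (flag true) })]
    | some (code .reset) => match t.Pl with
      | some _ => [(μ, run v u, { nops with
          Pl := .pop, P := .push (flag true),
          Df := if t.Df matches some (flag true) then .pop else .push (flag false) })]
      | none => [(μ, run v u, { nops with A := .pop })]
    | some (code x) => match t.B with
      | some (code .inc) => [(μ, run v u, { nops with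
          B := .pop, Q := .pop, Ql := .push (flag true),
          Df := if t.Df matches some (flag true) then .pop else .push (flag false) })]
      | some (code .reset) => match t.Ql with
        | some _ => [(μ, run v u, { nops with
            Ql := .pop, Q := .push (flag true),
            Df := if t.Df matches some (flag false) then .pop else .push (flag true) })]
        | none => [(μ, run v u, { nops with B := .pop })]
      | some (code x') => match x, x' with
        | .halt, .halt => [(u == v, halt, nops)]
        | .dot, .dot => match t.Df with
          | none => if u then [(μ, run v true, { nops with A := .pop, B := .pop })]
            else [(μ, run v false, { nops with A := .pop, B := .pop }), (v, claim v, nops)]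
          | some _ => if u then [(!v, halt, nops)] else [(v, claim v, nops)]
        | _, _ => [(!v, halt, nops)]
      | _ => []
    | _ => []
  | claim v => [(μ, zeros v false, nops), (μ, run v true, { nops with A := .pop, B := .pop })]
  | zeros v i => match (if i then t.P else t.Q) with
    | some _ =>
      if i then [(μ, zeros v i, { nops with P := .pop, U := .push (flag false) })]
      else [(μ, zeros v i, { nops with Q := .pop, U := .push (flag false) })]
    | none => [(μ, ones v i, { nops with U := .push (flag false) })]
  | ones v i => match (if i then t.Pl else t.Ql) with
    | some _ =>
      if i then [(μ, ones v i, { nops with Pl := .pop, U := .push (flag true) })]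
      else [(μ, ones v i, { nops with Ql := .pop, U := .push (flag true) })]
    | none => [(μ, halve v i, nops)]
  | halve v i => match t.U with
    | some _ => [(μ, pair v i false, nops)]
    | none => if i then [(μ, toEdge v, nops)] else [(μ, zeros v true, nops)]
  | pair v i b => match t.U with
    | some (flag x) => [(μ, pair' v i b x, { nops with U := .pop })]
    | some _ => []
    | none => [(μ, collect v i, { nops with X := .push (tok (.bit b) false) })]
  | pair' v i b x => match t.U with
    | some (flag x') =>
      [(μ, pair v i (b || (x && !x')), { nops with U := .pop, V := .push (flag (x && x')) })]
    | some _ => []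
    | none => [(μ, collect v i, { nops with X := .push (tok (.bit (b || x)) false) })]
  | collect v i => match t.V with
    | some g => [(μ, collect v i, { nops with V := .pop, U := .push g })]
    | none => [(μ, halve v i, nops)]
  | toEdge v => match t.Fl with
    | some (tok .edge _) => [(μ, address v, nops)]
    | some g => [(μ, toEdge v, { nops with Fl := .pop, F := .push g })]
    | none => []
  | address v => match t.F with
    | some (tok (.bit b) a) => [(μ, address v, { nops with
        F := .pop, Fl := .push (tok (.bit b) a), X := .push (tok (.bit b) false) })]
    | _ => [(μ, ask v, nops)]
  | ask v => [(y == v, halt, nops)]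
  | halt => []

end WordGraph

/-! ### Labelling a formula and skipping subformulas. -/

namespace WordGraph

abbrev tk (x : Sym × Bool) : Glyph := .tok x.1 x.2

abbrev one : Glyph := .flag true

abbrev unary (k : ℕ) : List Glyph := List.replicate k one

/-- The frame between the phases of the computation. -/
abbrev frame (n : ℕ) (F Fl S W : List Glyph) : Mem :=
  ⟨F, [], Fl, unary (n - 1), [], unary (n - 1), [], [], [], S, [], W, [], [], [], [], []⟩

section
variable {y : List Bool} {μ : Bool} {T A : ℕ} {b : Prop}

theorem map_const_unary {α : Type} (l : List α) : l.map (fun _ => one) = unary l.length :=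
  List.map_const' ..

theorem run_toEnd (v : Bool) (w : List (Sym × Bool)) (hw : ∀ x ∈ w, x.1 ≠ .mark) (a : Bool)
    (f : List Glyph) (m : Mem) (hF : m.F = w.map tk ++ .tok .mark a :: f) (hC : m.C = [])
    (h : Run check y ⟨μ, .label v, { m with
      F := .tok .mark a :: f, Fl := w.reverse.map tk ++ m.Fl, C := unary w.length }⟩ T A b) :
    Run check y ⟨μ, .toEnd v, m⟩ (T + 1 + w.length) A b := by
  have := Run.loop (tr := check) (y := y) (T := T + 1) (A := A) (b := b)
    (fun (d t : List (Sym × Bool)) => ⟨μ, .toEnd v, { m with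
      F := t.map tk ++ .tok .mark a :: f, Fl := d.map tk ++ m.Fl, C := d.map fun _ => one }⟩)
    (fun x => x.1 ≠ .mark) (fun x d t hx => by
      obtain ⟨s, a⟩ := x
      cases s <;> first | rfl | exact absurd rfl hx) (fun _ _ _ => rfl) w hw []
    (Run.det (c' := ⟨μ, .label v, { m with
      F := .tok .mark a :: f, Fl := w.reverse.map tk ++ m.Fl, C := unary w.length }⟩) h
      (by rw [map_const_unary]; simp; rfl) rfl)
  convert this using 2
  cases m
  simp_all

/-- The counter on `C` stops the backward sweep at the start of the current subformula, so the
symbols read before it keep their labels. The additional alternation hands the labelled formula to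
the universal player. -/
theorem run_label (v : Bool) (Fm : List Glyph) (m : Mem) (val : List (Sym × Bool) → Prop)
    (r : List (Sym × Bool)) : ∀ t : List (Sym × Bool),
    (∀ r' : List (Sym × Bool), r'.map Prod.fst = r.map Prod.fst →
      Run check y ⟨true, .skip (· == v), { m with F := (r'.reverse ++ t).map tk ++ Fm, C := [] }⟩ T A
        (val (r'.reverse ++ t))) →
    Run check y ⟨false, .label v, { m with
      F := t.map tk ++ Fm, Fl := r.map tk ++ m.Fl, C := unary r.length }⟩ (T + 1 + r.length) (A + 1)
      (∃ r' : List (Sym × Bool), r'.map Prod.fst = r.map Prod.fst ∧ val (r'.reverse ++ t)) := by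
  induction r with
  | nil =>
    intro t h
    exact ((h [] rfl).switch rfl).mono le_rfl le_rfl (by simp)
  | cons x r ih =>
    intro t h
    have key := fun b : Bool => ih ((x.1, b) :: t) (fun r' hr' => by
      have := h ((x.1, b) :: r') (by simp [hr'])
      simpa using this)
    refine (Run.choose₂ (key true) (key false) ?_ ?_ ?_).mono le_rfl le_rfl ?_
    · obtain ⟨s, a⟩ := x; rfl
    · rfl
    · rfl
    · simp only [Bool.false_eq_true, if_false]
      constructor
      · rintro ⟨r', hr', hv⟩
        cases r' with
        | nil => simp at hr'
        | cons z r' =>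
          obtain ⟨s, b⟩ := z
          simp only [List.map_cons, List.cons.injEq] at hr'
          obtain ⟨rfl, hr'⟩ := hr'
          cases b
          · exact .inr ⟨r', hr', by simpa using hv⟩
          · exact .inl ⟨r', hr', by simpa using hv⟩
      · rintro (⟨r', hr', hv⟩ | ⟨r', hr', hv⟩)
        · exact ⟨(x.1, true) :: r', by simp [hr'], by simpa using hv⟩
        · exact ⟨(x.1, false) :: r', by simp [hr'], by simpa using hv⟩

/-- The existential player labels the rest of the formula. -/
theorem run_labelling (v a : Bool) (n : ℕ) (w : List (Sym × Bool)) (hw : ∀ x ∈ w, x.1 ≠ .mark)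
    (f Fl S W : List Glyph) (val : List (Sym × Bool) → Prop)
    (h : ∀ w' : List (Sym × Bool), w'.map Prod.fst = w.map Prod.fst →
      Run check y ⟨true, .skip (· == v), frame n (w'.map tk ++ .tok .mark a :: f) Fl S W⟩ T A
        (val w')) :
    Run check y ⟨false, .toEnd v, frame n (w.map tk ++ .tok .mark a :: f) Fl S W⟩
      (T + 2 * w.length + 2) (A + 1)
      (∃ w' : List (Sym × Bool), w'.map Prod.fst = w.map Prod.fst ∧ val w') := by
  have h₁ := run_label (T := T) (A := A) (y := y) v (.tok .mark a :: f) (frame n [] Fl S W) val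
    w.reverse [] (fun r' hr' => by
      have := h r'.reverse (by rw [List.map_reverse, hr', List.map_reverse, List.reverse_reverse])
      simpa using this)
  have h₂ := run_toEnd v w hw a f (frame n (w.map tk ++ .tok .mark a :: f) Fl S W) rfl rfl
    (by simpa using h₁)
  refine h₂.mono (by omega) le_rfl ?_
  constructor
  · rintro ⟨w', hw', hv⟩
    exact ⟨w'.reverse, by simp [List.map_reverse, hw'], by simpa using hv⟩
  · rintro ⟨r', hr', hv⟩
    exact ⟨r'.reverse, by simp [List.map_reverse, hr'], by simpa using hv⟩

/-! ### Digits -/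

def Sym.IsBit : Sym → Prop
  | .bit _ => True
  | _ => False

def Sym.IsDigit : Sym → Prop
  | .bit _ | .sep => True
  | _ => False

theorem isBit_of_mem_binary {i : ℕ} {s : Sym} (h : s ∈ binary i) : s.IsBit := by
  obtain ⟨b, _, rfl⟩ := List.mem_map.1 h
  trivial

theorem isDigit_of_mem_binary {i : ℕ} {s : Sym} (h : s ∈ binary i) : s.IsDigit := by
  obtain ⟨b, _, rfl⟩ := List.mem_map.1 h
  trivial

theorem run_skip_digits (k : Bool → Bool) (u : List (Sym × Bool)) (hu : ∀ x ∈ u, x.1.IsDigit)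
    (f Fl C : List Glyph) (m : Mem)
    (h : Run check y ⟨μ, .skip k, { m with F := f, Fl := (u.map tk).reverse ++ Fl, C := C }⟩ T A b) :
    Run check y ⟨μ, .skip k, { m with F := u.map tk ++ f, Fl := Fl, C := C }⟩ (T + u.length) A b := by
  refine Run.loop (tr := check) (y := y)
    (fun (d t : List (Sym × Bool)) => ⟨μ, .skip k, { m with
      F := t.map tk ++ f, Fl := d.map tk ++ Fl, C := C }⟩)
    (fun x => x.1.IsDigit) (fun x d t hx => ?_) (fun _ _ _ => rfl) u hu [] ?_
  · obtain ⟨s, a⟩ := x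
    cases s <;> first | rfl | exact hx.elim
  · simpa [List.map_reverse] using h

/-- The stack `C` counts the subformulas still to be passed: a binary connective adds one and an
atom removes one, which is enough to parse prefix notation. -/
theorem run_skip {j : ℕ} (k : Bool → Bool) (φ : Formula (Fin j)) :
    ∀ (u : List (Sym × Bool)) (_ : u.map Prod.fst = φ.encode) (f Fl C : List Glyph) (m : Mem) (T : ℕ),
    Run check y ⟨μ, .skip k, { m with F := f, Fl := (u.map tk).reverse ++ Fl, C := C }⟩ T A b →
    Run check y ⟨μ, .skip k, { m with F := u.map tk ++ f, Fl := Fl, C := one :: C }⟩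
      (T + u.length) A b := by
  have digits : ∀ (l : List Sym) (u : List (Sym × Bool)), u.map Prod.fst = l →
      (∀ s ∈ l, s.IsDigit) → ∀ x ∈ u, x.1.IsDigit := by
    rintro l u rfl h x hx
    exact h _ (List.mem_map_of_mem hx)
  induction φ with
  | eq x z =>
    intro u hu f Fl C m T h
    obtain ⟨⟨s, a⟩, u, rfl, rfl, hu'⟩ := List.map_eq_cons_iff.1 hu
    refine (run_skip_digits k u (digits _ u hu' ?_) f (.tok .eq a :: Fl) C m ?_).det rfl rfl
    · intro s hs
      simp only [List.mem_append, List.mem_cons] at hs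
      rcases hs with hs | rfl | hs
      · exact isDigit_of_mem_binary hs
      · trivial
      · exact isDigit_of_mem_binary hs
    · simpa using h
  | edge c x z =>
    intro u hu f Fl C m T h
    obtain ⟨⟨s, a⟩, u, rfl, rfl, hu'⟩ := List.map_eq_cons_iff.1 hu
    refine (run_skip_digits k u (digits _ u hu' ?_) f (.tok .edge a :: Fl) C m ?_).det rfl rfl
    · intro s hs
      simp only [List.mem_append, List.mem_cons] at hs
      rcases hs with hs | rfl | hs | rfl | hs
      · exact isDigit_of_mem_binary hs
      · trivial
      · exact isDigit_of_mem_binary hs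
      · trivial
      · exact isDigit_of_mem_binary hs
    · simpa using h
  | neg φ ih =>
    intro u hu f Fl C m T h
    obtain ⟨⟨s, a⟩, u, rfl, rfl, hu'⟩ := List.map_eq_cons_iff.1 hu
    refine (ih u hu' f (.tok .neg a :: Fl) C m T ?_).det rfl rfl
    simpa using h
  | and φ ψ ih₁ ih₂ | or φ ψ ih₁ ih₂ | imp φ ψ ih₁ ih₂ | iff φ ψ ih₁ ih₂ =>
    intro u hu f Fl C m T h
    obtain ⟨⟨s, a⟩, u, rfl, rfl, hu'⟩ := List.map_eq_cons_iff.1 hu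
    obtain ⟨u₁, u₂, rfl, hu₁, hu₂⟩ := List.map_eq_append_iff.1 hu'
    have h₂ := ih₂ u₂ hu₂ f ((u₁.map tk).reverse ++ .tok _ a :: Fl) C m T (by simpa using h)
    have h₁ := ih₁ u₁ hu₁ (u₂.map tk ++ f) (.tok _ a :: Fl) (one :: C) m _ h₂
    have e : ∀ x : Sym × Bool, T + (x :: (u₁ ++ u₂)).length = T + u₂.length + u₁.length + 1 := by
      intro x; simp; omega
    rw [e]
    refine h₁.det ?_ rfl
    rw [List.map_cons, List.map_append, List.cons_append, List.append_assoc]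
    rfl
  | ex x φ ih | all x φ ih =>
    intro u hu f Fl C m T h
    obtain ⟨⟨s, a⟩, u, rfl, rfl, hu'⟩ := List.map_eq_cons_iff.1 hu
    obtain ⟨u₁, u₂, rfl, hu₁, hu₂⟩ := List.map_eq_append_iff.1 hu'
    have h₂ := ih u₂ hu₂ f ((u₁.map tk).reverse ++ .tok _ a :: Fl) C m T (by simpa using h)
    have h₁ := run_skip_digits k u₁ (digits _ u₁ hu₁ fun s => isDigit_of_mem_binary)
      (u₂.map tk ++ f) (.tok _ a :: Fl) (one :: C) m h₂
    have e : ∀ x : Sym × Bool, T + (x :: (u₁ ++ u₂)).length = T + u₂.length + u₁.length + 1 := by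
      intro x; simp; omega
    rw [e]
    refine h₁.det ?_ rfl
    rw [List.map_cons, List.map_append, List.cons_append, List.append_assoc]
    rfl

end

end WordGraph

/-! ### Choosing a word by refining a code. -/

namespace WordGraph

/-- The number of separations between blocks of positions. -/
def seps : List Cd → ℕ
  | [] => 0
  | .dot :: s => seps s
  | _ :: s => seps s + 1

/-- `Ref n s p h c`: the code `c` of a word over `0, …, n - 1`, begun with the letter `p`, refines
the code `s`; `h` says whether the word has a letter already. -/
inductive Ref (n : ℕ) : List Cd → ℕ → Bool → List Cd → Prop where
  | dot {s c p h} (r : Ref n s p true c) : Ref n (.dot :: s) p h (.dot :: c)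
  | inc {s c p h} (hp : p + 1 < n) (r : Ref n (.dot :: s) (p + 1) h c) :
      Ref n (.dot :: s) p h (.inc :: c)
  | halt {s p} : Ref n (.dot :: s) p true (.halt :: .dot :: s)
  | reset {x s c p h} (hx : x ≠ Cd.dot) (r : Ref n s 0 h c) : Ref n (x :: s) p h (.reset :: c)
  | last {p h} : Ref n [] p h [.halt]

theorem ref_dot_iff {n p : ℕ} {s c : List Cd} {h : Bool} : Ref n (.dot :: s) p h c ↔
    (∃ c', c = .dot :: c' ∧ Ref n s p true c') ∨
    (∃ c', c = .inc :: c' ∧ p + 1 < n ∧ Ref n (.dot :: s) (p + 1) h c') ∨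
    (h = true ∧ c = .halt :: .dot :: s) := by
  constructor
  · intro r
    cases r with
    | dot r => exact .inl ⟨_, rfl, r⟩
    | inc hp r => exact .inr (.inl ⟨_, rfl, hp, r⟩)
    | halt => exact .inr (.inr ⟨rfl, rfl⟩)
    | reset hx r => exact absurd rfl hx
  · rintro (⟨c', rfl, r⟩ | ⟨c', rfl, hp, r⟩ | ⟨rfl, rfl⟩)
    · exact .dot r
    · exact .inc hp r
    · exact .halt

theorem ref_sep_iff {n p : ℕ} {x : Cd} (hx : x ≠ .dot) {s c : List Cd} {h : Bool} :
    Ref n (x :: s) p h c ↔ ∃ c', c = .reset :: c' ∧ Ref n s 0 h c' := by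
  constructor
  · intro r
    cases r with
    | reset _ r => exact ⟨_, rfl, r⟩
    | _ => exact absurd rfl hx
  · rintro ⟨c', rfl, r⟩
    exact .reset hx r

theorem ref_nil_iff {n p : ℕ} {c : List Cd} {h : Bool} : Ref n [] p h c ↔ c = [.halt] := by
  constructor
  · intro r; cases r; rfl
  · rintro rfl; exact .last

/-- `∀` or `∃` according to the mode. -/
def Quant {α : Type} (μ : Bool) (p q : α → Prop) : Prop :=
  if μ then ∀ c, p c → q c else ∃ c, p c ∧ q c

abbrev codes (c : List Cd) : List Glyph := c.map Glyph.code

/-- The stacks while a word is chosen: `acc` is the code chosen so far and `s` the rest of the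
code to be refined. -/
abbrev choosing (F Fl W : List Glyph) (p r : ℕ) (s acc : List Cd) : Mem :=
  ⟨F, [], Fl, unary r, unary p, unary (p + r), [], [], [], codes s, (codes acc).reverse,
    (codes acc).reverse ++ W, [], [], [], [], []⟩

theorem choosing_snoc (F Fl W : List Glyph) (p r : ℕ) (s acc : List Cd) (x : Cd) :
    choosing F Fl W p r s (acc ++ [x]) = ⟨F, [], Fl, unary r, unary p, unary (p + r), [], [], [],
      codes s, .code x :: (codes acc).reverse, .code x :: ((codes acc).reverse ++ W), [], [], [], [],
      []⟩ := by
  simp [choosing]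

section
variable {y : List Bool} {μ : Bool} {T A : ℕ} {b : Prop}

/-- After a choice the letter counter is unwound and the unread rest `s` of the old code is
appended: positions behind the end of the new word still matter for other words. -/
theorem run_rewind (v : Bool) (g : Glyph) (F Fl W : List Glyph) (p r : ℕ) (s acc : List Cd)
    (h : Run check y ⟨μ, .name v, frame (p + r + 1) F (g :: Fl) (codes (acc ++ s))
      (.flag false :: (codes (acc ++ s)).reverse ++ W)⟩ T A b) :
    Run check y ⟨μ, .rewind v, choosing (g :: F) Fl W p r s acc⟩
      (T + (p + 2 * s.length + acc.length + 3)) A b := by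
  have h₁ : Run check y ⟨μ, .back v, ⟨g :: F, [], Fl, unary (p + r), [], unary (p + r), [], [], [],
      codes (acc ++ s), [], (codes (acc ++ s)).reverse ++ W, [], [], [], [], []⟩⟩ (T + 1) A b :=
    h.det rfl rfl
  have h₂ := Run.loop (tr := check) (y := y) (T := T + 1) (A := A) (b := b)
    (fun (d t : List Glyph) => ⟨μ, .back v, ⟨g :: F, [], Fl, unary (p + r), [], unary (p + r), [], [],
      [], d, t, (codes (acc ++ s)).reverse ++ W, [], [], [], [], []⟩⟩)
    (fun _ => True) (fun _ _ _ _ => rfl) (fun _ _ _ => rfl) (codes (acc ++ s)).reverse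
    (fun _ _ => trivial) [] (by simpa using h₁)
  have h₃ := Run.loop (tr := check) (y := y) (A := A) (b := b)
    (fun (d t : List Glyph) => ⟨μ, .copy v, ⟨g :: F, [], Fl, unary (p + r), [], unary (p + r), [], [],
      [], t, d ++ (codes acc).reverse, d ++ ((codes acc).reverse ++ W), [], [], [], [], []⟩⟩)
    (fun _ => True) (fun _ _ _ _ => rfl) (fun _ _ _ => rfl) (codes s)
    (fun _ _ => trivial) [] (Run.det h₂ (by simp; rfl) rfl)
  have h₄ := Run.loop (tr := check) (y := y) (A := A) (b := b)
    (fun (d t : List Glyph) => ⟨μ, .rewind v, ⟨g :: F, [], Fl, d ++ unary r, t, unary (p + r), [], [],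
      [], codes s, (codes acc).reverse, (codes acc).reverse ++ W, [], [], [], [], []⟩⟩)
    (fun _ => True) (fun _ _ _ _ => rfl) (fun _ _ _ => rfl) (unary p)
    (fun _ _ => trivial) [] (Run.det h₃ (by
      simp only [List.reverse_replicate, List.append_nil, unary, List.replicate_append_replicate,
        List.nil_append]
      rfl) rfl)
  refine Run.mono h₄ ?_ le_rfl Iff.rfl
  simp
  omega

/-- At an old separation a new block begins, where the letters may start from `0` again; winding the
counter back takes `p` steps. -/
theorem run_guess_reset (v h : Bool) (F Fl W : List Glyph) (x : Cd) (hx : x ≠ .dot) (p r : ℕ)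
    (s acc : List Cd)
    (k : Run check y ⟨μ, .guess v h, choosing F Fl W 0 (p + r) s (acc ++ [.reset])⟩ T A b) :
    Run check y ⟨μ, .guess v h, choosing F Fl W p r (x :: s) acc⟩ (T + 1 + p) A b := by
  have := Run.loop (tr := check) (y := y) (T := T + 1) (A := A) (b := b)
    (fun (d t : List Glyph) => ⟨μ, .guess v h, ⟨F, [], Fl, d ++ unary r, t, unary (p + r), [], [],
      [], codes (x :: s), (codes acc).reverse, (codes acc).reverse ++ W, [], [], [], [], []⟩⟩)
    (fun _ => True) (fun _ _ _ _ => by cases x <;> first | rfl | exact absurd rfl hx)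
    (fun _ _ _ => rfl) (unary p)
    (fun _ _ => trivial) [] (Run.det (c' := ⟨μ, .guess v h, _⟩) k (by
      rw [choosing_snoc]
      simp only [List.reverse_replicate, List.append_nil, unary, List.replicate_append_replicate,
        Nat.zero_add]
      cases x <;> first | rfl | exact absurd rfl hx) rfl)
  rwa [List.length_replicate] at this

/-- Induction on the old code, and within a block on the number `r` of increments still possible,
since an increment consumes nothing of `s`. Only separations cost more than constant time, whence
the term `4 * n * seps s`. -/
theorem run_guess (v : Bool) (g : Glyph) (F Fl W : List Glyph) (val : List Cd → Prop) (n : ℕ)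
    (s : List Cd) : ∀ (r p : ℕ) (h : Bool) (acc : List Cd), p + r + 1 = n →
    (∀ c, Ref n s p h c → Run check y ⟨μ, .name v, frame n F (g :: Fl) (codes (acc ++ c))
      (.flag false :: (codes (acc ++ c)).reverse ++ W)⟩ T A (val (acc ++ c))) →
    Run check y ⟨μ, .guess v h, choosing (g :: F) Fl W p r s acc⟩
      (T + (acc.length + 4 * s.length + 3 * r + p + 4 * n * seps s + 6)) A
      (Quant μ (Ref n s p h) fun c => val (acc ++ c)) := by
  induction s with
  | nil =>
    intro r p h acc hn k
    subst hn
    have h₁ := run_rewind v g F Fl W p r [] (acc ++ [.halt]) (by simpa using k _ .last)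
    rw [choosing_snoc] at h₁
    have h₂ : Run check y ⟨μ, .guess v h, choosing (g :: F) Fl W p r [] acc⟩ _ A _ :=
      h₁.det rfl rfl
    refine h₂.mono (by simp; omega) le_rfl ?_
    simp only [Quant, ref_nil_iff]
    split <;> simp
  | cons x s ih =>
    by_cases hx : x = .dot
    swap
    · intro r p h acc hn k
      have h₁ := ih (p + r) 0 h (acc ++ [.reset]) (by omega) (fun c hc => by
        simpa using k _ (.reset hx hc))
      refine (run_guess_reset v h _ _ _ x hx p r s acc h₁).mono ?_ le_rfl ?_
      · have : seps (x :: s) = seps s + 1 := by cases x <;> first | rfl | exact absurd rfl hx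
        rw [this]
        simp
        have : 4 * n * (seps s + 1) = 4 * n * seps s + 4 * n := by ring
        omega
      · simp only [Quant, ref_sep_iff hx]
        split
        · constructor
          · intro H c hc; simpa using H _ ⟨c, rfl, hc⟩
          · rintro H _ ⟨c, rfl, hc⟩; simpa using H c hc
        · constructor
          · rintro ⟨_, ⟨c, rfl, hc⟩, H⟩; exact ⟨c, hc, by simpa using H⟩
          · rintro ⟨c, hc, H⟩; exact ⟨_, ⟨c, rfl, hc⟩, by simpa using H⟩
    · subst hx
      intro r
      have e : seps (.dot :: s) = seps s := rfl
      have hlast : ∀ (r p : ℕ) (acc : List Cd), p + r + 1 = n →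
          (∀ c, Ref n (.dot :: s) p true c →
            Run check y ⟨μ, .name v, frame n F (g :: Fl) (codes (acc ++ c))
              (.flag false :: (codes (acc ++ c)).reverse ++ W)⟩ T A (val (acc ++ c))) →
          Run check y ⟨μ, .rewind v, choosing (g :: F) Fl W p r (.dot :: s) (acc ++ [.halt])⟩
            (T + (acc.length + 4 * s.length + 3 * r + p + 4 * n * seps s + 9)) A
            (val (acc ++ .halt :: .dot :: s)) := by
        intro r p acc hn k
        subst hn
        have h₁ := run_rewind v g F Fl W p r (.dot :: s) (acc ++ [.halt])
          (by simpa using k _ .halt)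
        exact h₁.mono (by simp; omega) le_rfl Iff.rfl
      have value : ∀ (p : ℕ) (h : Bool) (acc : List Cd),
          (Quant μ (Ref n (.dot :: s) p h) fun c => val (acc ++ c)) ↔
          if μ then (Quant μ (Ref n s p true) fun c => val (acc ++ [.dot] ++ c)) ∧
            (p + 1 < n → Quant μ (Ref n (.dot :: s) (p + 1) h) fun c => val (acc ++ [.inc] ++ c)) ∧
            (h = true → val (acc ++ .halt :: .dot :: s))
          else (Quant μ (Ref n s p true) fun c => val (acc ++ [.dot] ++ c)) ∨
            (p + 1 < n ∧ Quant μ (Ref n (.dot :: s) (p + 1) h) fun c => val (acc ++ [.inc] ++ c)) ∨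
            (h = true ∧ val (acc ++ .halt :: .dot :: s)) := by
        intro p h acc
        simp only [List.append_assoc, List.singleton_append]
        cases μ
        · simp only [Quant, Bool.false_eq_true, if_false, ref_dot_iff (p := p)]
          constructor
          · rintro ⟨_, ⟨c, rfl, hc⟩ | ⟨c, rfl, hp, hc⟩ | ⟨hh, rfl⟩, hv⟩
            · exact .inl ⟨c, hc, hv⟩
            · exact .inr (.inl ⟨hp, c, hc, hv⟩)
            · exact .inr (.inr ⟨hh, hv⟩)
          · rintro (⟨c, hc, hv⟩ | ⟨hp, c, hc, hv⟩ | ⟨hh, hv⟩)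
            · exact ⟨_, .inl ⟨c, rfl, hc⟩, hv⟩
            · exact ⟨_, .inr (.inl ⟨c, rfl, hp, hc⟩), hv⟩
            · exact ⟨_, .inr (.inr ⟨hh, rfl⟩), hv⟩
        · simp only [Quant, if_true, ref_dot_iff (p := p)]
          constructor
          · intro H
            exact ⟨fun c hc => H _ (.inl ⟨c, rfl, hc⟩), fun hp c hc => H _ (.inr (.inl ⟨c, rfl, hp, hc⟩)),
              fun hh => H _ (.inr (.inr ⟨hh, rfl⟩))⟩
          · rintro ⟨H₁, H₂, H₃⟩ _ (⟨c, rfl, hc⟩ | ⟨c, rfl, hp, hc⟩ | ⟨hh, rfl⟩)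
            · exact H₁ c hc
            · exact H₂ hp c hc
            · exact H₃ hh
      induction r with
      | zero =>
        intro p h acc hn k
        have h₁ := ih 0 p true (acc ++ [.dot]) hn (fun c hc => by simpa using k _ (.dot hc))
        have hp : ¬ p + 1 < n := by omega
        rw [choosing_snoc] at h₁
        cases h with
        | false =>
          have h₂ : Run check y ⟨μ, .guess v false, choosing (g :: F) Fl W p 0 (.dot :: s) acc⟩ _ A _ :=
            h₁.det rfl rfl
          refine h₂.mono (by simp [e]; omega) le_rfl ?_
          rw [value]
          simp [hp, -List.append_assoc]
        | true =>
          have h₃ := hlast 0 p acc hn k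
          rw [choosing_snoc] at h₃
          have h₂ : Run check y ⟨μ, .guess v true, choosing (g :: F) Fl W p 0 (.dot :: s) acc⟩ _ A _ :=
            Run.choose₂ (T := T + (acc.length + 4 * s.length + p + 4 * n * seps s + 9))
              (h₁.mono (by simp; omega) le_rfl Iff.rfl) (h₃.mono (by omega) le_rfl Iff.rfl) rfl rfl rfl
          refine h₂.mono (by simp [e]; omega) le_rfl ?_
          rw [value]
          simp [hp, -List.append_assoc]
      | succ r ihr =>
        intro p h acc hn k
        have h₁ := ih (r + 1) p true (acc ++ [.dot]) hn (fun c hc => by simpa using k _ (.dot hc))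
        have hp : p + 1 < n := by omega
        have h₃ := ihr (p + 1) h (acc ++ [.inc]) (by omega) (fun c hc => by
          simpa using k _ (.inc hp hc))
        rw [choosing_snoc] at h₁ h₃
        rw [show p + 1 + r = p + (r + 1) by omega] at h₃
        set T' := T + (acc.length + 4 * s.length + 3 * r + p + 4 * n * seps s + 12) with hT'
        have h₁' := h₁.mono (T' := T') (by simp; omega) le_rfl Iff.rfl
        have h₃' := h₃.mono (T' := T') (by simp [e]; omega) le_rfl Iff.rfl
        cases h with
        | false =>
          have h₂ : Run check y
              ⟨μ, .guess v false, choosing (g :: F) Fl W p (r + 1) (.dot :: s) acc⟩ _ A _ :=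
            Run.choose₂ h₁' h₃' rfl rfl rfl
          refine h₂.mono (by simp [e]; omega) le_rfl ?_
          rw [value]
          simp [hp, -List.append_assoc]
        | true =>
          have h₄ := hlast (r + 1) p acc hn k
          rw [choosing_snoc] at h₄
          have h₄' := h₄.mono (T' := T') (by omega) le_rfl Iff.rfl
          have h₂ : Run check y
              ⟨μ, .guess v true, choosing (g :: F) Fl W p (r + 1) (.dot :: s) acc⟩ _ A _ :=
            Run.choose (l := [_, _, _]) rfl (by simp) (by
              simp only [List.mem_cons, List.not_mem_nil, or_false, forall_eq_or_imp, forall_eq]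
              exact ⟨⟨_, h₁'⟩, ⟨_, h₃'⟩, ⟨_, h₄'⟩⟩)
          refine h₂.mono (by simp [e]; omega) le_rfl ?_
          rw [value, ← h₁'.wins_iff, ← h₃'.wins_iff, ← h₄'.wins_iff]
          simp only [hp, List.mem_cons, List.not_mem_nil, or_false, forall_eq_or_imp, forall_eq,
            exists_eq_or_imp, exists_eq_left, forall_const, true_and]
          rfl

end

end WordGraph

/-! ### Finding the code of a variable. -/

namespace WordGraph

/-- The glyph is not a binary digit. -/
def Glyph.NonBit : Glyph → Prop
  | .tok (.bit _) _ => False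
  | _ => True

/-- The first glyph is not a binary digit. -/
def StartsNonBit : List Glyph → Prop
  | [] => True
  | g :: _ => g.NonBit

/-- The first glyph does not belong to a code. -/
def StartsNonCode : List Glyph → Prop
  | .code _ :: _ => False
  | _ => True

/-- A binary number on the stack `W`. -/
abbrev plain (w : List Sym) : List Glyph := w.map (.tok · false)

/-- The entry on the stack `W` for the variable `e.1` with the code `e.2`. -/
abbrev record (e : ℕ × List Cd) : List Glyph :=
  plain (binary e.1).reverse ++ .flag false :: (codes e.2).reverse

abbrev records (es : List (ℕ × List Cd)) : List Glyph := (es.map record).flatten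

theorem startsNonCode_records (es : List (ℕ × List Cd)) : StartsNonCode (records es) := by
  cases es with
  | nil => trivial
  | cons e es =>
    simp only [records, List.map_cons, List.flatten_cons, record]
    cases (binary e.1).reverse <;> trivial

section
variable {y : List Bool} {μ : Bool} {T A : ℕ} {b : Prop}

theorem run_agree (v e i : Bool) (m : Mem) (l₀ : Glyph) (hl : l₀.NonBit) (Fl W : List Glyph)
    (r₂ : List (Sym × Bool)) : ∀ (r₁ : List Sym) (_ : ∀ s ∈ r₁, s.IsBit) (_ : r₂.map Prod.fst = r₁)
    (F Wl : List Glyph),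
    Run check y ⟨μ, .fetch v e i, { m with
      F := r₂.reverse.map tk ++ F, Fl := l₀ :: Fl, W := W,
      Wl := .flag false :: (plain r₁).reverse ++ Wl }⟩ T A b →
    Run check y ⟨μ, .agree v e i, { m with
      F := F, Fl := r₂.map tk ++ l₀ :: Fl, W := plain r₁ ++ .flag false :: W, Wl := Wl }⟩
      (T + 1 + r₁.length) A b := by
  induction r₂ with
  | nil =>
    rintro _ _ rfl F Wl h
    refine h.det ?_ rfl
    rcases l₀ with ⟨_ | _, _⟩ | _ | _ <;> first | rfl | exact hl.elim
  | cons x r₂ ih =>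
    rintro _ hb rfl F Wl h
    obtain ⟨s, a⟩ := x
    obtain ⟨c, rfl⟩ : ∃ c, s = .bit c := by
      have := hb s (by simp)
      cases s <;> first | exact this.elim | exact ⟨_, rfl⟩
    refine (ih _ (fun s hs => hb s (by simp only [List.map_cons, List.mem_cons]; exact .inr hs)) rfl
      (.tok (.bit c) a :: F) (.tok (.bit c) false :: Wl) ?_).det ?_ rfl
    · simpa using h
    · change List.map _ (if c = c then _ else _) = _
      rw [if_pos rfl]; rfl

/-- The comparison has consumed equally many digits of both names when it fails. Recording
`p'.length = p.length` allows the re-reading of these digits to be charged to the record. -/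
theorem run_disagree (v e i : Bool) (m : Mem) (l₀ : Glyph) (hl : l₀.NonBit) (Fl W : List Glyph)
    (r₂ : List (Sym × Bool)) : ∀ (r₁ : List Sym) (_ : ∀ s ∈ r₁, s.IsBit)
    (_ : ∀ x ∈ r₂, x.1.IsBit) (_ : r₂.map Prod.fst ≠ r₁) (F Wl : List Glyph),
    (∀ p q p' q', r₁ = p ++ q → r₂ = p' ++ q' → p'.length = p.length →
      Run check y ⟨μ, .toHash v e i, { m with
        F := p'.reverse.map tk ++ F, Fl := q'.map tk ++ l₀ :: Fl,
        W := plain q ++ .flag false :: W, Wl := (plain p).reverse ++ Wl }⟩ (T + q.length) A b) →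
    Run check y ⟨μ, .agree v e i, { m with
      F := F, Fl := r₂.map tk ++ l₀ :: Fl, W := plain r₁ ++ .flag false :: W, Wl := Wl }⟩
      (T + 1 + r₁.length) A b := by
  induction r₂ with
  | nil =>
    intro r₁ hb₁ _ hne F Wl h
    cases r₁ with
    | nil => exact absurd rfl hne
    | cons s r₁ =>
      refine Run.det' (h [] (s :: r₁) [] [] rfl rfl rfl) ?_ rfl ?_
      · obtain ⟨c, rfl⟩ : ∃ c, s = .bit c := by
          have := hb₁ s (by simp)
          cases s <;> first | exact this.elim | exact ⟨_, rfl⟩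
        rcases l₀ with ⟨_ | _, _⟩ | _ | _ <;> first | rfl | exact hl.elim
      · omega
  | cons x r₂ ih =>
    intro r₁ hb₁ hb₂ hne F Wl h
    obtain ⟨s, a⟩ := x
    obtain ⟨c, rfl⟩ : ∃ c, s = .bit c := by
      have := hb₂ _ List.mem_cons_self
      cases s <;> first | exact this.elim | exact ⟨_, rfl⟩
    cases r₁ with
    | nil =>
      refine Run.det' (h [] [] [] (_ :: r₂) rfl rfl rfl) rfl rfl ?_
      omega
    | cons s r₁ =>
      obtain ⟨c', rfl⟩ : ∃ c, s = .bit c := by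
        have := hb₁ _ List.mem_cons_self
        cases s <;> first | exact this.elim | exact ⟨_, rfl⟩
      by_cases hc : c' = c
      · subst hc
        refine (ih r₁ (fun s hs => hb₁ s (List.mem_cons_of_mem _ hs))
          (fun s hs => hb₂ s (List.mem_cons_of_mem _ hs)) (by simpa using hne)
          (.tok (.bit c') a :: F) (.tok (.bit c') false :: Wl) ?_).det ?_ rfl
        · intro p q p' q' hp hq hl
          have := h (.bit c' :: p) q ((.bit c', a) :: p') q' (by simp [hp]) (by simp [hq])
            (by simp [hl])
          simpa using this
        · change List.map _ (if c' = c' then _ else _) = _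
          rw [if_pos rfl]; rfl
      · refine Run.det' (h [] (_ :: r₁) [] (_ :: r₂) rfl rfl rfl) ?_ rfl ?_
        · change List.map _ (if c' = c then _ else _) = _
          rw [if_neg hc]; rfl
        · omega

theorem run_lookUp (v e i : Bool) (m : Mem) (u : List (Sym × Bool)) (hu : ∀ x ∈ u, x.1.IsBit)
    (F Fl : List Glyph) (hF : StartsNonBit F)
    (h : Run check y ⟨μ, .agree v e i, { m with F := F, Fl := u.reverse.map tk ++ Fl }⟩ T A b) :
    Run check y ⟨μ, .lookUp v e i, { m with F := u.map tk ++ F, Fl := Fl }⟩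
      (T + 1 + u.length) A b := by
  refine Run.loop (tr := check) (y := y)
    (fun (d t : List (Sym × Bool)) => ⟨μ, .lookUp v e i, { m with
      F := t.map tk ++ F, Fl := d.map tk ++ Fl }⟩)
    (fun x => x.1.IsBit) (fun x d t hx => ?_) (fun _ _ _ => rfl) u hu [] (h.det ?_ rfl)
  · obtain ⟨s, a⟩ := x
    cases s <;> first | rfl | exact hx.elim
  · rw [List.append_nil]
    rcases F with _ | ⟨⟨_ | _, _⟩ | _ | _, F⟩ <;> first | rfl | exact hF.elim

theorem run_toHash (v e i : Bool) (m : Mem) (q : List Sym) (W Wl : List Glyph)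
    (h : Run check y ⟨μ, .passWord v e i, { m with
      W := W, Wl := .flag false :: (plain q).reverse ++ Wl }⟩ T A b) :
    Run check y ⟨μ, .toHash v e i, { m with W := plain q ++ .flag false :: W, Wl := Wl }⟩
      (T + 1 + q.length) A b := by
  refine Run.loop (tr := check) (y := y)
    (fun (d t : List Sym) => ⟨μ, .toHash v e i, { m with
      W := plain t ++ .flag false :: W, Wl := plain d ++ Wl }⟩)
    (fun x => True) (fun x d t hx => ?_) (fun _ _ _ => rfl) q (fun _ _ => trivial) [] (h.det ?_ rfl)
  · rfl
  · rw [List.append_nil, ← List.map_reverse]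
    rfl

theorem run_passWord (v e i : Bool) (m : Mem) (c : List Cd) (W Wl : List Glyph)
    (hW : StartsNonCode W)
    (h : Run check y ⟨μ, .lookUp v e i, { m with W := W, Wl := codes c ++ Wl }⟩ T A b) :
    Run check y ⟨μ, .passWord v e i, { m with W := (codes c).reverse ++ W, Wl := Wl }⟩
      (T + 1 + c.length) A b := by
  have := Run.loop (tr := check) (y := y) (T := T + 1) (A := A) (b := b)
    (fun (d t : List Cd) => ⟨μ, .passWord v e i, { m with
      W := codes t ++ W, Wl := codes d ++ Wl }⟩)
    (fun x => True) (fun x d t hx => rfl) (fun _ _ _ => rfl) c.reverse (fun _ _ => trivial) []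
    (h.det ?_ rfl)
  · simpa using this
  · rw [List.append_nil, List.reverse_reverse]
    rcases W with _ | ⟨_ | _ | _, W⟩ <;> first | rfl | exact hW.elim

/-- A failed comparison rolls back only the digits that matched, so the cost is linear in the total
length of the records, not a product with the length of the name. Stopping at the first matching
record gives the innermost binding. -/
theorem run_find (v e i : Bool) (m : Mem) (l₀ : Glyph) (hl : l₀.NonBit) (F Fl : List Glyph)
    (hF : StartsNonBit F) (x : ℕ) (c : List Cd) (post : List (ℕ × List Cd))
    (u : List (Sym × Bool)) (hu : u.map Prod.fst = binary x) (pre : List (ℕ × List Cd)) :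
    (∀ z ∈ pre, z.1 ≠ x) → ∀ (Wl : List Glyph) (T : ℕ),
    Run check y ⟨μ, .fetch v e i, { m with
      F := u.map tk ++ F, Fl := l₀ :: Fl, W := (codes c).reverse ++ records post,
      Wl := .flag false :: (plain (binary x).reverse).reverse ++ ((records pre).reverse ++ Wl) }⟩
      T A b →
    Run check y ⟨μ, .agree v e i, { m with
      F := F, Fl := u.reverse.map tk ++ l₀ :: Fl, W := records (pre ++ (x, c) :: post), Wl := Wl }⟩
      (T + 1 + u.length + 4 * (records pre).length) A b := by
  have hbits : ∀ z, ∀ s ∈ (binary z).reverse, s.IsBit := fun z s hs =>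
    isBit_of_mem_binary (List.mem_reverse.1 hs)
  have hu' : ∀ z ∈ u.reverse, z.1.IsBit := fun z hz => by
    apply isBit_of_mem_binary (i := x)
    rw [← hu]
    exact List.mem_map_of_mem (List.mem_reverse.1 hz)
  induction pre with
  | nil =>
    intro _ Wl T h
    have := run_agree (T := T) (A := A) (b := b) (μ := μ) (y := y) v e i m l₀ hl Fl
      ((codes c).reverse ++ records post) u.reverse (binary x).reverse (hbits x)
      (by rw [List.map_reverse, hu]) F Wl (h.congr_mem (by simp [records]))
    have hlen : (binary x).reverse.length = u.length := by
      rw [List.length_reverse, ← hu, List.length_map]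
    rw [hlen] at this
    refine (this.congr_mem (by simp [records, record])).mono (by omega) le_rfl Iff.rfl
  | cons z pre ih =>
    intro hpre Wl T h
    have h₁ := ih (fun z hz => hpre z (List.mem_cons_of_mem _ hz)) ((record z).reverse ++ Wl) T
      (h.congr_mem (by simp [records]))
    have hne : u.reverse.map Prod.fst ≠ (binary z.1).reverse := by
      rw [List.map_reverse, hu]
      intro heq
      apply hpre z List.mem_cons_self
      have h₃ : (Nat.bits x) = Nat.bits z.1 := by
        have := List.reverse_injective heq
        exact List.map_injective_iff.2 (fun _ _ h => by cases h; rfl) this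
      exact Nat.eq_of_testBit_eq fun i => by rw [Nat.testBit_eq_inth, Nat.testBit_eq_inth, h₃]
    have h₂ := run_disagree (A := A) (b := b) (μ := μ) (y := y)
      (T := T + 1 + u.length + 4 * (records pre).length + 1 + z.2.length + 1 + 1 +
        (binary z.1).reverse.length) v e i m l₀ hl Fl
      ((codes z.2).reverse ++ records (pre ++ (x, c) :: post)) u.reverse (binary z.1).reverse
      (hbits _) hu' hne F Wl (fun p q p' q' hp hp' hlen => by
        have := run_toHash (A := A) (b := b) (μ := μ) (y := y) v e i
          { m with F := p'.reverse.map tk ++ F, Fl := q'.map tk ++ l₀ :: Fl } q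
          ((codes z.2).reverse ++ records (pre ++ (x, c) :: post)) ((plain p).reverse ++ Wl)
          (run_passWord v e i { m with F := p'.reverse.map tk ++ F, Fl := q'.map tk ++ l₀ :: Fl }
            z.2 (records (pre ++ (x, c) :: post)) _ (startsNonCode_records _)
            (run_lookUp v e i { m with
                W := records (pre ++ (x, c) :: post),
                Wl := codes z.2 ++ (.flag false :: (plain q).reverse ++ ((plain p).reverse ++ Wl)) }
              p'.reverse (fun s hs => hu' s (by rw [hp']; simp at hs; simp [hs]))
              F (q'.map tk ++ l₀ :: Fl) hF
              (h₁.congr_mem (by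
                have e : u = q'.reverse ++ p'.reverse := by
                  rw [← List.reverse_append, ← hp', List.reverse_reverse]
                have e' : binary z.1 = q.reverse ++ p.reverse := by
                  rw [← List.reverse_append, ← hp, List.reverse_reverse]
                simp [record, e, e']))))
        refine this.mono ?_ le_rfl Iff.rfl
        have : (binary z.1).reverse.length = p.length + q.length := by rw [hp]; simp
        rw [this, List.length_reverse]
        omega)
    refine (h₂.congr_mem (by simp [records, record])).mono ?_ le_rfl Iff.rfl
    simp [records, record]
    omega

end

end WordGraph

namespace WordGraph

section
variable {y : List Bool} {μ : Bool} {T A : ℕ} {b : Prop}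

/-- Codes stand reversed on `W`, so popping them onto `A` yields the reading order. -/
theorem run_fetch_left (v e : Bool) (m : Mem) (c : List Cd) (W Wl : List Glyph)
    (hW : StartsNonCode W)
    (h : Run check y ⟨μ, .restore v e, { m with W := W, Wl := codes c ++ Wl, A := codes c }⟩ T A b) :
    Run check y ⟨μ, .fetch v e false, { m with W := (codes c).reverse ++ W, Wl := Wl, A := [] }⟩
      (T + 1 + c.length) A b := by
  have := Run.loop (tr := check) (y := y) (T := T + 1) (A := A) (b := b)
    (fun (d t : List Cd) => ⟨μ, .fetch v e false, { m with
      W := codes t ++ W, Wl := codes d ++ Wl, A := codes d }⟩)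
    (fun x => True) (fun x d t hx => rfl) (fun _ _ _ => rfl) c.reverse (fun _ _ => trivial) []
    (h.det ?_ rfl)
  · simpa using this
  · rw [List.append_nil, List.reverse_reverse]
    rcases W with _ | ⟨_ | _ | _, W⟩ <;> first | rfl | exact hW.elim

theorem run_fetch_right (v e : Bool) (m : Mem) (c : List Cd) (W Wl : List Glyph)
    (hW : StartsNonCode W)
    (h : Run check y ⟨μ, .run v !e, { m with W := W, Wl := codes c ++ Wl, B := codes c }⟩ T A b) :
    Run check y ⟨μ, .fetch v e true, { m with W := (codes c).reverse ++ W, Wl := Wl, B := [] }⟩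
      (T + 1 + c.length) A b := by
  have := Run.loop (tr := check) (y := y) (T := T + 1) (A := A) (b := b)
    (fun (d t : List Cd) => ⟨μ, .fetch v e true, { m with
      W := codes t ++ W, Wl := codes d ++ Wl, B := codes d }⟩)
    (fun x => True) (fun x d t hx => rfl) (fun _ _ _ => rfl) c.reverse (fun _ _ => trivial) []
    (h.det ?_ rfl)
  · simpa using this
  · rw [List.append_nil, List.reverse_reverse]
    rcases W with _ | ⟨_ | _ | _, W⟩ <;> first | rfl | exact hW.elim

/-- The records must be complete again for the search of the second variable; after that one nothing
is restored. -/
theorem run_restore (v e : Bool) (m : Mem) (W Wl : List Glyph)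
    (h : Run check y ⟨μ, .advance v e, { m with W := Wl.reverse ++ W, Wl := [] }⟩ T A b) :
    Run check y ⟨μ, .restore v e, { m with W := W, Wl := Wl }⟩ (T + 1 + Wl.length) A b :=
  Run.loop (tr := check) (y := y)
    (fun (d t : List Glyph) => ⟨μ, .restore v e, { m with W := d, Wl := t }⟩)
    (fun _ => True) (fun _ _ _ _ => rfl) (fun _ _ _ => rfl) Wl (fun _ _ => trivial) W (h.det rfl rfl)

theorem run_advance (v e : Bool) (m : Mem) (u : List (Sym × Bool)) (hu : ∀ x ∈ u, x.1.IsBit)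
    (a : Bool) (F Fl : List Glyph)
    (h : Run check y ⟨μ, .lookUp v e true, { m with
      F := F, Fl := .tok .sep a :: (u.reverse.map tk ++ Fl) }⟩ T A b) :
    Run check y ⟨μ, .advance v e, { m with F := u.map tk ++ .tok .sep a :: F, Fl := Fl }⟩
      (T + 1 + u.length) A b := by
  refine Run.loop (tr := check) (y := y)
    (fun (d t : List (Sym × Bool)) => ⟨μ, .advance v e, { m with
      F := t.map tk ++ .tok .sep a :: F, Fl := d.map tk ++ Fl }⟩)
    (fun x => x.1.IsBit) (fun x d t hx => ?_) (fun _ _ _ => rfl) u hu [] (h.det ?_ rfl)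
  · obtain ⟨s, a⟩ := x
    cases s <;> first | rfl | exact hx.elim
  · rw [List.append_nil]; rfl

theorem isBit_of_map_fst {u : List (Sym × Bool)} {x : ℕ} (hu : u.map Prod.fst = binary x) :
    ∀ z ∈ u, z.1.IsBit := fun z hz => by
  apply isBit_of_mem_binary (i := x)
  rw [← hu]
  exact List.mem_map_of_mem hz

/-- The code of the first variable of an atom is found. -/
theorem run_left (v e : Bool) (m : Mem) (l₀ : Glyph) (hl : l₀.NonBit) (a : Bool) (F Fl : List Glyph)
    (x : ℕ) (c : List Cd) (pre post : List (ℕ × List Cd)) (hpre : ∀ z ∈ pre, z.1 ≠ x)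
    (u : List (Sym × Bool)) (hu : u.map Prod.fst = binary x)
    (h : Run check y ⟨μ, .lookUp v e true, { m with
      F := F, Fl := .tok .sep a :: (u.reverse.map tk ++ l₀ :: Fl), A := codes c, Wl := [],
      W := records (pre ++ (x, c) :: post) }⟩ T A b) :
    Run check y ⟨μ, .lookUp v e false, { m with
      F := u.map tk ++ .tok .sep a :: F, Fl := l₀ :: Fl, A := [], Wl := [],
      W := records (pre ++ (x, c) :: post) }⟩
      (T + 3 * u.length + 6 * (records (pre ++ (x, c) :: post)).length + 5) A b := by
  have h₁ := run_advance v e { m with A := codes c, Wl := [], W := records (pre ++ (x, c) :: post) }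
    u (isBit_of_map_fst hu) a F (l₀ :: Fl) h
  have h₂ := run_restore v e { m with
    A := codes c, F := u.map tk ++ .tok .sep a :: F, Fl := l₀ :: Fl } (records post)
    (codes c ++ (.flag false :: (plain (binary x).reverse).reverse ++ ((records pre).reverse ++ [])))
    (h₁.congr_mem (by simp [records, record]))
  have h₃ := run_fetch_left v e { m with F := u.map tk ++ .tok .sep a :: F, Fl := l₀ :: Fl } c
    (records post) _ (startsNonCode_records post) h₂
  have h₄ := run_find v e false { m with A := [] } l₀ hl (.tok .sep a :: F) Fl trivial x c post u hu
    pre hpre [] _ h₃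
  have h₅ := run_lookUp v e false { m with A := [], Wl := [], W := records (pre ++ (x, c) :: post) } u
    (isBit_of_map_fst hu) (.tok .sep a :: F) (l₀ :: Fl) trivial h₄
  refine h₅.mono ?_ le_rfl Iff.rfl
  simp [records, record]
  omega

/-- The code of the second variable of an atom is found. -/
theorem run_right (v e : Bool) (m : Mem) (l₀ : Glyph) (hl : l₀.NonBit) (F Fl : List Glyph)
    (hF : StartsNonBit F)
    (x : ℕ) (c : List Cd) (pre post : List (ℕ × List Cd)) (hpre : ∀ z ∈ pre, z.1 ≠ x)
    (u : List (Sym × Bool)) (hu : u.map Prod.fst = binary x)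
    (h : ∀ W Wl, Run check y ⟨μ, .run v !e, { m with
      F := u.map tk ++ F, Fl := l₀ :: Fl, B := codes c, Wl := Wl, W := W }⟩ T A b) :
    Run check y ⟨μ, .lookUp v e true, { m with
      F := u.map tk ++ F, Fl := l₀ :: Fl, B := [], Wl := [],
      W := records (pre ++ (x, c) :: post) }⟩
      (T + 2 * u.length + 4 * (records (pre ++ (x, c) :: post)).length + 3) A b := by
  have h₃ := run_fetch_right v e { m with F := u.map tk ++ F, Fl := l₀ :: Fl } c
    (records post) (.flag false :: (plain (binary x).reverse).reverse ++ ((records pre).reverse ++ []))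
    (startsNonCode_records post) (h _ _)
  have h₄ := run_find v e true { m with B := [] } l₀ hl F Fl hF x c post u hu
    pre hpre [] _ h₃
  have h₅ := run_lookUp v e true { m with B := [], Wl := [], W := records (pre ++ (x, c) :: post) } u
    (isBit_of_map_fst hu) F (l₀ :: Fl) hF h₄
  refine h₅.mono ?_ le_rfl Iff.rfl
  simp [records, record]
  omega

end

end WordGraph

/-! ### From unary letters to the address of an edge. -/

namespace WordGraph

/-- The bits of `⌊k / 2⌋` in unary, from those of `k`. -/
def pairs : List Bool → List Bool
  | x :: x' :: l => (x && x') :: pairs l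
  | _ => []

/-- The parity of a number in unary. -/
def parity : Bool → List Bool → Bool
  | b, x :: x' :: l => parity (b || (x && !x')) l
  | b, [x] => b || x
  | b, [] => b

theorem pairs_false (j : ℕ) : pairs (List.replicate j false) = List.replicate (j / 2) false := by
  induction j using Nat.strong_induction_on with
  | _ j ih =>
    match j with
    | 0 => rfl
    | 1 => rfl
    | j + 2 =>
      rw [show (j + 2) / 2 = j / 2 + 1 by omega]
      simpa [List.replicate_succ, pairs] using ih j (by omega)

/-- The flags come with all `true` first, so at most one pair is mixed and joining pairs halves both
the number and its padded width. -/
theorem pairs_unary (k j : ℕ) : pairs (List.replicate k true ++ List.replicate j false) =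
    List.replicate (k / 2) true ++ List.replicate ((k + j) / 2 - k / 2) false := by
  induction k using Nat.strong_induction_on with
  | _ k ih =>
    match k with
    | 0 => simpa using pairs_false j
    | 1 =>
      cases j with
      | zero => rfl
      | succ j =>
        simp only [List.replicate_succ, List.replicate_zero, List.nil_append, List.cons_append, pairs,
          pairs_false]
        rw [show (1 + (j + 1)) / 2 - 1 / 2 = j / 2 + 1 by omega]
        simp [List.replicate_succ]
    | k + 2 =>
      have := ih k (by omega)
      rw [show (k + 2) / 2 = k / 2 + 1 by omega,
        show (k + 2 + j) / 2 - (k / 2 + 1) = (k + j) / 2 - k / 2 by omega]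
      simpa [List.replicate_succ, pairs] using this

theorem parity_false (b : Bool) (j : ℕ) : parity b (List.replicate j false) = b := by
  induction j using Nat.strong_induction_on with
  | _ j ih =>
    match j with
    | 0 => rfl
    | 1 => simp [parity]
    | j + 2 => simpa [List.replicate_succ, parity] using ih j (by omega)

/-- Exactly for odd `k` there is a pair `true, false` or a single `true` at the end. -/
theorem parity_unary (b : Bool) (k j : ℕ) :
    parity b (List.replicate k true ++ List.replicate j false) = (b || k.testBit 0) := by
  induction k using Nat.strong_induction_on with
  | _ k ih =>
    match k with
    | 0 => simpa using parity_false b j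
    | 1 =>
      cases j with
      | zero => simp [parity]
      | succ j => simp [List.replicate_succ, parity, parity_false]
    | k + 2 =>
      have := ih k (by omega)
      simpa [List.replicate_succ, parity] using this

/-- The lowest digits of `k`, as many as `N` has. -/
def digits (N k : ℕ) : List Bool :=
  if h : N = 0 then [] else k.testBit 0 :: digits (N / 2) (k / 2)
termination_by N
decreasing_by omega

theorem getElem?_digits (N : ℕ) : ∀ k i : ℕ,
    (digits N k)[i]? = if i < N.size then some (k.testBit i) else none := by
  induction N using Nat.strong_induction_on with
  | _ N ih =>
    intro k i
    rw [digits]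
    split
    · next h => simp [h]
    · next h =>
      have hs : N.size = (N / 2).size + 1 := by
        conv_lhs => rw [← Nat.bit_bodd_div2 N]
        rw [Nat.size_bit (by rwa [Nat.bit_bodd_div2]), Nat.div2_val]
      cases i with
      | zero => simp [hs]
      | succ i => simp [ih (N / 2) (by omega), hs, Nat.testBit_succ]

section
variable {y : List Bool} {μ : Bool} {T A : ℕ} {b : Prop}

theorem run_pair (v i : Bool) (m : Mem) : ∀ (l : List Bool) (c : Bool) (V : List Glyph),
    Run check y ⟨μ, .collect v i, { m with
      U := [], V := (pairs l).reverse.map .flag ++ V,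
      X := .tok (.bit (parity c l)) false :: m.X }⟩ T A b →
    Run check y ⟨μ, .pair v i c, { m with U := l.map .flag, V := V }⟩ (T + 1 + l.length) A b
  | [], c, V, h => h.det rfl rfl
  | [x], c, V, h => by
    have h₁ : Run check y ⟨μ, .pair' v i c x, { m with U := [], V := V }⟩ _ A b := h.det rfl rfl
    exact h₁.det rfl rfl
  | x :: x' :: l, c, V, h => by
    have h₁ := run_pair v i m l (c || (x && !x')) (.flag (x && x') :: V)
      (h.congr_mem (by simp [pairs, parity]))
    have h₂ : Run check y ⟨μ, .pair' v i c x, { m with U := (x' :: l).map .flag, V := V }⟩ _ A b :=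
      h₁.det rfl rfl
    exact h₂.det rfl rfl

theorem run_collect (v i : Bool) (m : Mem) (l : List Glyph) (U : List Glyph)
    (h : Run check y ⟨μ, .halve v i, { m with U := l.reverse ++ U, V := [] }⟩ T A b) :
    Run check y ⟨μ, .collect v i, { m with U := U, V := l }⟩ (T + 1 + l.length) A b :=
  Run.loop (tr := check) (y := y)
    (fun (d t : List Glyph) => ⟨μ, .collect v i, { m with U := d, V := t }⟩)
    (fun _ => True) (fun _ _ _ _ => rfl) (fun _ _ _ => rfl) l (fun _ _ => trivial) U (h.det rfl rfl)

abbrev bits (l : List Bool) : List Glyph := l.map fun c => .tok (.bit c) false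

/-- Each round costs `O(N)`, yields one digit and halves `N`; the geometric series sums to at most
`10 * N`. The width `N`, not the number `k`, decides when to stop, so leading zeros are produced. -/
theorem run_halve (v i : Bool) (m : Mem) (N : ℕ) : ∀ (k j : ℕ) (X : List Glyph), k + j = N →
    Run check y ⟨μ, .halve v i, { m with U := [], V := [], X := (bits (digits N k)).reverse ++ X }⟩
      T A b →
    Run check y ⟨μ, .halve v i, { m with
      U := (List.replicate k true ++ List.replicate j false).map .flag, V := [], X := X }⟩
      (T + 10 * N) A b := by
  induction N using Nat.strong_induction_on with
  | _ N ih =>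
    intro k j X hN h
    by_cases h0 : N = 0
    · subst h0
      obtain ⟨rfl, rfl⟩ : k = 0 ∧ j = 0 := by omega
      rw [digits] at h
      simpa using h
    · have h₁ := ih (N / 2) (by omega) (k / 2) (N / 2 - k / 2)
        (.tok (.bit (k.testBit 0)) false :: X) (by omega)
        (h.congr_mem (by conv_rhs => rw [digits, dif_neg h0]
                         simp))
      set l := List.replicate k true ++ List.replicate j false with hl
      have h₂ := run_collect v i { m with X := .tok (.bit (k.testBit 0)) false :: X }
        ((pairs l).reverse.map .flag) [] (h₁.congr_mem (by
          rw [hl, pairs_unary, hN]; simp))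
      have h₃ := run_pair v i { m with X := X } l false [] (h₂.congr_mem (by
        simp only [hl, parity_unary, Bool.false_or, List.append_nil]))
      have hlen : l.length = N := by simp [hl, hN]
      have hlen' : (pairs l).length = N / 2 := by
        rw [hl, pairs_unary]; simp; omega
      have h₄ : Run check y ⟨μ, .halve v i, { m with U := l.map .flag, V := [], X := X }⟩ _ A b :=
        h₃.det (by
          cases hl' : l with
          | nil => rw [hl'] at hlen; exact absurd hlen.symm h0
          | cons x l => rfl) rfl
      refine h₄.mono ?_ le_rfl Iff.rfl
      rw [hlen, List.length_map, List.length_reverse, hlen']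
      omega

/-- The one additional `false` makes the width exactly `n`, hence the number of digits is `n.size`
as the layout of the table requires. -/
theorem run_convert_right (v : Bool) (m : Mem) (n q r : ℕ) (hn : q + r + 1 = n) (X : List Glyph)
    (h : Run check y ⟨μ, .zeros v true, { m with
      Q := [], Ql := [], U := [], V := [], X := (bits (digits n q)).reverse ++ X }⟩ T A b) :
    Run check y ⟨μ, .zeros v false, { m with
      Q := unary r, Ql := unary q, U := [], V := [], X := X }⟩ (T + 11 * n + 3) A b := by
  have h₁ := run_halve v false { m with Q := [], Ql := [] } n q (r + 1) X (by omega)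
    (h.det rfl rfl)
  have h₂ := Run.loop (tr := check) (y := y) (A := A) (b := b)
    (fun (d t : List Glyph) => ⟨μ, .ones v false, { m with
      Q := [], Ql := t, U := d.map (fun _ => one) ++ List.replicate (r + 1) (.flag false),
      V := [], X := X }⟩)
    (fun _ => True) (fun _ _ _ _ => rfl) (fun _ _ _ => rfl) (unary q) (fun _ _ => trivial) []
    (h₁.det (by simp; rfl) rfl)
  have h₃ := Run.loop (tr := check) (y := y) (A := A) (b := b)
    (fun (d t : List Glyph) => ⟨μ, .zeros v false, { m with
      Q := t, Ql := unary q, U := d.map fun _ => .flag false, V := [], X := X }⟩)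
    (fun _ => True) (fun _ _ _ _ => rfl) (fun _ _ _ => rfl) (unary r) (fun _ _ => trivial) []
    (h₂.det (by simp [List.replicate_succ]; rfl) rfl)
  refine Run.mono h₃ ?_ le_rfl Iff.rfl
  simp
  omega

theorem run_convert_left (v : Bool) (m : Mem) (n p r : ℕ) (hn : p + r + 1 = n) (X : List Glyph)
    (h : Run check y ⟨μ, .toEdge v, { m with
      P := [], Pl := [], U := [], V := [], X := (bits (digits n p)).reverse ++ X }⟩ T A b) :
    Run check y ⟨μ, .zeros v true, { m with
      P := unary r, Pl := unary p, U := [], V := [], X := X }⟩ (T + 11 * n + 3) A b := by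
  have h₁ := run_halve v true { m with P := [], Pl := [] } n p (r + 1) X (by omega)
    (h.det rfl rfl)
  have h₂ := Run.loop (tr := check) (y := y) (A := A) (b := b)
    (fun (d t : List Glyph) => ⟨μ, .ones v true, { m with
      P := [], Pl := t, U := d.map (fun _ => one) ++ List.replicate (r + 1) (.flag false),
      V := [], X := X }⟩)
    (fun _ => True) (fun _ _ _ _ => rfl) (fun _ _ _ => rfl) (unary p) (fun _ _ => trivial) []
    (h₁.det (by simp; rfl) rfl)
  have h₃ := Run.loop (tr := check) (y := y) (A := A) (b := b)
    (fun (d t : List Glyph) => ⟨μ, .zeros v true, { m with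
      P := t, Pl := unary p, U := d.map fun _ => .flag false, V := [], X := X }⟩)
    (fun _ => True) (fun _ _ _ _ => rfl) (fun _ _ _ => rfl) (unary r) (fun _ _ => trivial) []
    (h₂.det (by simp [List.replicate_succ]; rfl) rfl)
  refine Run.mono h₃ ?_ le_rfl Iff.rfl
  simp
  omega

theorem run_halt (μ : Bool) (m : Mem) : Run check y ⟨μ, .halt, m⟩ 1 0 (μ = true) := Run.leaf rfl

theorem run_ask (v : Bool) (m : Mem) :
    Run check y ⟨μ, .ask v, m⟩ 2 1 (look y m.X = v) :=
  ((run_halt (look y m.X == v) m).switch rfl).mono le_rfl le_rfl (by simp)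

/-- The action stands in binary in the formula, lowest digit first, and is copied from there as the
highest part of the address. -/
theorem run_address (v : Bool) (m : Mem) (u : List (Sym × Bool)) (a : ℕ)
    (hu : u.map Prod.fst = binary a) (F Fl X : List Glyph) (hF : StartsNonBit F) :
    Run check y ⟨μ, .address v, { m with F := u.map tk ++ F, Fl := Fl, X := X }⟩
      (u.length + 3) 1 (look y ((bits a.bits).reverse ++ X) = v) := by
  have key : ∀ (l : List Bool) (u : List (Sym × Bool)) (_ : u.map Prod.fst = l.map .bit)
      (Fl X : List Glyph),
      Run check y ⟨μ, .address v, { m with F := u.map tk ++ F, Fl := Fl, X := X }⟩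
      (u.length + 3) 1 (look y ((bits l).reverse ++ X) = v) := by
    intro l
    induction l with
    | nil =>
      intro u hu Fl X
      obtain rfl : u = [] := by simpa using hu
      refine Run.det' (run_ask v { m with F := F, Fl := Fl, X := X }) ?_ rfl le_rfl
      rcases F with _ | ⟨⟨_ | _, _⟩ | _ | _, F⟩ <;> first | rfl | exact hF.elim
    | cons c l ih =>
      intro u hu Fl X
      obtain ⟨⟨s, a⟩, u, rfl, rfl, hu'⟩ := List.map_eq_cons_iff.1 hu
      have h₁ := ih u hu' (.tok (.bit c) a :: Fl) (.tok (.bit c) false :: X)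
      have h₂ : Run check y ⟨μ, .address v, { m with
        F := .tok (.bit c) a :: (u.map tk ++ F), Fl := Fl, X := X }⟩ _ 1 _ := h₁.det rfl rfl
      exact h₂.mono (by simp) le_rfl (by simp)
  exact key _ u hu Fl X

theorem run_toEdge (v : Bool) (m : Mem) (u w : List (Sym × Bool)) (a : ℕ) (a₀ a₁ : Bool)
    (hu : u.map Prod.fst = binary a) (hw : ∀ x ∈ w, x.1.IsDigit) (F Fl : List Glyph) :
    Run check y ⟨μ, .toEdge v, { m with
      F := F, Fl := (u ++ (.sep, a₁) :: w).reverse.map tk ++ .tok .edge a₀ :: Fl }⟩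
      (2 * u.length + w.length + 5) 1 (look y ((bits a.bits).reverse ++ m.X) = v) := by
  have h₁ := run_address (y := y) (μ := μ) v m u a hu (.tok .sep a₁ :: (w.map tk ++ F))
    (.tok .edge a₀ :: Fl) m.X trivial
  refine Run.mono (Run.loop (tr := check) (y := y)
    (fun (d t : List (Sym × Bool)) => ⟨μ, .toEdge v, { m with
      F := d.map tk ++ F, Fl := t.map tk ++ .tok .edge a₀ :: Fl }⟩)
    (fun x => x.1.IsDigit) (fun x d t hx => ?_) (fun _ _ _ => rfl) (u ++ (.sep, a₁) :: w).reverse ?_ []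
    (h₁.det (by simp; rfl) rfl)) ?_ le_rfl Iff.rfl
  · obtain ⟨s, a⟩ := x
    cases s <;> first | rfl | exact hx.elim
  · intro x hx
    simp only [List.mem_reverse, List.mem_append, List.mem_cons] at hx
    rcases hx with hx | rfl | hx
    · exact isDigit_of_mem_binary (i := a) (by rw [← hu]; exact List.mem_map_of_mem hx)
    · trivial
    · exact hw x hx
  · simp
    omega

end

end WordGraph

/-! ### The address in the table, and the comparison of two codes. -/

namespace WordGraph

theorem look_eq {y : List Bool} {l : List Bool} {k : ℕ}
    (h : ∀ j : ℕ, l[j]? = some true ↔ k.testBit j = true) :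
    look y (bits l).reverse = true ↔ y[k]? = some true := by
  have key : ∀ j : ℕ, (bits l).reverse.reverse[j]? = some (.tok (.bit true) false) ↔
      k.testBit j = true := by
    intro j
    rw [List.reverse_reverse, ← h j, List.getElem?_map]
    cases l[j]? <;> simp
  simp only [look, decide_eq_true_eq]
  constructor
  · rintro ⟨i, hi, hy⟩
    have : i = k := Nat.eq_of_testBit_eq fun j => by
      have := (hi j).symm.trans (key j)
      rwa [Bool.eq_iff_iff]
    rwa [← this]
  · exact fun hy => ⟨k, key, hy⟩

theorem getElem?_adjacencyTable {n m : ℕ} (G : LabelledGraph (Fin n) (Fin m)) (a : Fin m)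
    (p q : Fin n) : (adjacencyTable G)[(a * 4 ^ n.size + p * 2 ^ n.size + q : ℕ)]? = some true ↔
      G.edge a p q := by
  have h2 : ∀ p : Fin n, (p : ℕ) < 2 ^ n.size := fun p => p.2.trans (Nat.lt_size_self n)
  have h4 : (4 : ℕ) ^ n.size = 2 ^ n.size * 2 ^ n.size := by
    rw [← mul_pow]; norm_num
  have hlt : (a : ℕ) * 4 ^ n.size + p * 2 ^ n.size + q < m * 4 ^ n.size := by
    have h₁ : ((a : ℕ) + 1) * 4 ^ n.size ≤ m * 4 ^ n.size := Nat.mul_le_mul_right _ a.2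
    have h₂ : ((p : ℕ) + 1) * 2 ^ n.size ≤ 2 ^ n.size * 2 ^ n.size := Nat.mul_le_mul_right _ (h2 p)
    have := h2 q
    rw [add_mul] at h₁ h₂
    omega
  simp only [adjacencyTable, List.getElem?_map, List.getElem?_range hlt, Option.map_some,
    Option.some.injEq, decide_eq_true_eq]
  constructor
  · rintro ⟨a', p', q', h, hG⟩
    rw [h4, ← mul_assoc, ← add_mul, ← mul_assoc, ← add_mul] at h
    have h₁ : ∀ x : ℕ, ∀ r : Fin n, (x * 2 ^ n.size + r) % 2 ^ n.size = r := fun x r => by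
      rw [mul_comm, Nat.mul_add_mod, Nat.mod_eq_of_lt (h2 r)]
    have h₃ : ∀ x : ℕ, ∀ r : Fin n, (x * 2 ^ n.size + r) / 2 ^ n.size = x := fun x r => by
      rw [mul_comm, Nat.mul_add_div (by positivity), Nat.div_eq_of_lt (h2 r), add_zero]
    have hq := congrArg (· % 2 ^ n.size) h
    simp only [h₁] at hq
    have hr := congrArg (· / 2 ^ n.size) h
    simp only [h₃] at hr
    have hp := congrArg (· % 2 ^ n.size) hr
    simp only [h₁] at hp
    have ha := congrArg (· / 2 ^ n.size) hr
    simp only [h₃] at ha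
    obtain rfl := Fin.ext hq
    obtain rfl := Fin.ext hp
    obtain rfl := Fin.ext ha
    exact hG
  · exact fun hG => ⟨a, p, q, rfl, hG⟩

/-- As the digits of `p` and `q` are padded to the width `n.size`, concatenating digit strings
realises the sum with the weights `2 ^ n.size` and `4 ^ n.size`. -/
theorem look_address {n m : ℕ} (G : LabelledGraph (Fin n) (Fin m)) (a : Fin m) (p q : Fin n) :
    look (adjacencyTable G) ((bits (a : ℕ).bits).reverse ++ ((bits (digits n p)).reverse ++
      (bits (digits n q)).reverse)) = true ↔ G.edge a p q := by
  have h2 : ∀ p : Fin n, (p : ℕ) < 2 ^ n.size := fun p => p.2.trans (Nat.lt_size_self n)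
  have hlen : ∀ k, (digits n k).length = n.size := fun k => by
    apply Nat.le_antisymm
    · rw [← List.getElem?_eq_none_iff, getElem?_digits]; simp
    · by_contra h
      have h₁ := getElem?_digits n k (digits n k).length
      rw [List.getElem?_eq_none (le_refl _), if_pos (by omega)] at h₁
      simp at h₁
  rw [← getElem?_adjacencyTable, ← look_eq (l := digits n q ++ (digits n p ++ (a : ℕ).bits))]
  · simp [bits]
  intro j
  have h4 : (a : ℕ) * 4 ^ n.size + p * 2 ^ n.size + q =
      2 ^ n.size * (2 ^ n.size * a + p) + q := by
    rw [show (4 : ℕ) = 2 * 2 by rfl, mul_pow]; ring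
  rw [h4, Nat.testBit_two_pow_mul_add _ (h2 q), List.getElem?_append, hlen]
  split
  · next h => simp [getElem?_digits, h]
  · rw [Nat.testBit_two_pow_mul_add _ (h2 p), List.getElem?_append, hlen]
    split
    · next h => simp [getElem?_digits, h]
    · generalize j - n.size - n.size = i
      rw [Nat.testBit_eq_inth, List.getI_eq_getElem?_getD]
      cases h : (a : ℕ).bits[i]? <;> simp

/-! ### Words -/

/-- The word with the given code, begun with the letter `p`. -/
def decode : List Cd → ℕ → List ℕ
  | [], _ => []
  | .dot :: c, p => p :: decode c p
  | .inc :: c, p => decode c (p + 1)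
  | .reset :: c, _ => decode c 0
  | .halt :: _, _ => []

/-- The code of a word over `0, …, n - 1`. -/
def Valid (n : ℕ) : List Cd → ℕ → Prop
  | [], _ => False
  | .dot :: c, p => Valid n c p
  | .inc :: c, p => p + 1 < n ∧ Valid n c (p + 1)
  | .reset :: c, _ => Valid n c 0
  | .halt :: _, _ => True

theorem Ref.valid {n : ℕ} {s c : List Cd} {p : ℕ} {h : Bool} (r : Ref n s p h c) : Valid n c p := by
  induction r with
  | dot _ ih => exact ih
  | inc hp _ ih => exact ⟨hp, ih⟩
  | halt => trivial
  | reset _ _ ih => exact ih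
  | last => trivial

theorem decode_lt {n : ℕ} : ∀ (c : List Cd) (p : ℕ), p < n → ∀ x ∈ decode c p, x < n ∨ ¬ Valid n c p
  | [], _, _, x, hx => by simp [decode] at hx
  | .dot :: c, p, hp, x, hx => by
    rcases List.mem_cons.1 hx with rfl | hx
    · exact .inl hp
    · exact decode_lt c p hp x hx
  | .inc :: c, p, hp, x, hx => by
    by_cases h : p + 1 < n
    · rcases decode_lt c (p + 1) h x hx with h' | h'
      · exact .inl h'
      · exact .inr fun h'' => h' h''.2
    · exact .inr fun h'' => h h''.1
  | .reset :: c, p, hp, x, hx => decode_lt c 0 (by omega) x hx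
  | .halt :: _, _, _, x, hx => by simp [decode] at hx

/-- The relation `plus` on lists, for a relation on letters. -/
def Changes (E : ℕ → ℕ → Prop) : List ℕ → List ℕ → Prop
  | p :: u, q :: v => (E p q ∧ u = v) ∨ (p = q ∧ Changes E u v)
  | _, _ => False

theorem changes_iff {E : ℕ → ℕ → Prop} {u v : List ℕ} :
    Changes E u v ↔ ∃ x y p q, E p q ∧ u = x ++ p :: y ∧ v = x ++ q :: y := by
  induction u generalizing v with
  | nil => simp [Changes]
  | cons p u ih =>
    cases v with
    | nil => simp [Changes]
    | cons q v =>
      simp only [Changes, ih]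
      constructor
      · rintro (⟨h, rfl⟩ | ⟨rfl, x, y, p', q', h, rfl, rfl⟩)
        · exact ⟨[], u, p, q, h, rfl, rfl⟩
        · exact ⟨p :: x, y, p', q', h, rfl, rfl⟩
      · rintro ⟨_ | ⟨z, x⟩, y, p', q', h, hu, hv⟩
        · simp only [List.nil_append, List.cons.injEq] at hu hv
          obtain ⟨rfl, rfl⟩ := hu
          obtain ⟨rfl, rfl⟩ := hv
          exact .inl ⟨h, rfl⟩
        · simp only [List.cons_append, List.cons.injEq] at hu hv
          obtain ⟨rfl, rfl⟩ := hu
          obtain ⟨rfl, rfl⟩ := hv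
          exact .inr ⟨rfl, x, y, p', q', h, rfl, rfl⟩

/-- The difference of two letters in unary. -/
def diff (p q : ℕ) : List Glyph :=
  if q ≤ p then List.replicate (p - q) (.flag true) else List.replicate (q - p) (.flag false)

def raise : List Glyph → List Glyph
  | .flag false :: D => D
  | D => .flag true :: D

def lower : List Glyph → List Glyph
  | .flag true :: D => D
  | D => .flag false :: D

/-- A signed unary number changes by one at its top flag alone, and equality of letters is emptiness
of the stack. Both updating and testing take constant time. -/
theorem raise_diff (p q : ℕ) : raise (diff p q) = diff (p + 1) q := by
  unfold diff
  by_cases h : q ≤ p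
  · rw [if_pos h, if_pos (by omega), show p + 1 - q = (p - q) + 1 by omega, List.replicate_succ]
    cases p - q <;> rfl
  · rw [if_neg h, show q - p = (q - p - 1) + 1 by omega, List.replicate_succ, raise]
    by_cases h' : q ≤ p + 1
    · rw [if_pos h', show q - p - 1 = 0 by omega, show p + 1 - q = 0 by omega]; rfl
    · rw [if_neg h']; rfl

theorem lower_diff (p q : ℕ) : lower (diff p q) = diff p (q + 1) := by
  unfold diff
  by_cases h : q + 1 ≤ p
  · rw [if_pos (by omega), if_pos h, show p - q = (p - (q + 1)) + 1 by omega, List.replicate_succ]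
    rfl
  · rw [if_neg h, show q + 1 - p = (q - p) + 1 by omega, List.replicate_succ]
    by_cases h' : q ≤ p
    · rw [if_pos h', show q - p = 0 by omega, show p - q = 0 by omega]; rfl
    · rw [if_neg h', show q - p = (q - p - 1) + 1 by omega]; rfl

theorem raise_diff' (p q : ℕ) : raise (diff p (q + 1)) = diff p q := by
  rw [raise_diff]
  unfold diff
  simp only [Nat.add_le_add_iff_right, Nat.add_sub_add_right]

theorem lower_diff' (p q : ℕ) : lower (diff (p + 1) q) = diff p q := by
  rw [lower_diff]
  unfold diff
  simp only [Nat.add_le_add_iff_right, Nat.add_sub_add_right]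

/-- The stacks while two words are compared: `p` and `q` are the current letters. -/
abbrev racing (F Fl S W Wl : List Glyph) (n : ℕ) (c : List Cd) (p : ℕ) (d : List Cd) (q : ℕ) : Mem :=
  ⟨F, [], Fl, unary (n - 1 - p), unary p, unary (n - 1 - q), unary q, diff p q, [], S, [], W, Wl,
    codes c, codes d, [], []⟩

section
variable {y : List Bool} {μ : Bool} {T A : ℕ} {b : Prop}

/-- Only the branch that changes the mode pays an alternation. A long run of such choices thus does
not add up. -/
theorem Run.choose₂' {Ctl : Type} {tr : Transition Ctl} {c c₁ c₂ : Cf Ctl} {b₁ b₂ : Prop} {A' : ℕ}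
    (r₁ : Run tr y c₁ T A b₁) (r₂ : Run tr y c₂ T A' b₂) (h : succs tr y c = [c₁, c₂])
    (h₁ : c.mode = c₁.mode) (h₂ : c.mode ≠ c₂.mode) (hA : A' + 1 ≤ A) :
    Run tr y c (T + 1) A (if c.mode then b₁ ∧ b₂ else b₁ ∨ b₂) := by
  refine .node c T A _ (fun c' => if c.mode = c'.mode then A else A') (Wins tr y) ?_ ?_ ?_
  · simp only [h, List.mem_cons, List.not_mem_nil, or_false, forall_eq_or_imp, forall_eq, if_pos h₁,
      if_neg h₂]
    exact ⟨r₁.mono le_rfl le_rfl r₁.wins_iff, r₂.mono le_rfl le_rfl r₂.wins_iff⟩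
  · simp only [h, List.mem_cons, List.not_mem_nil, or_false, forall_eq_or_imp, forall_eq, if_pos h₁,
      if_neg h₂]
    omega
  · simp [h, r₁.wins_iff, r₂.wins_iff]

theorem run_inc_left (v u : Bool) (m : Mem) (P : List Glyph) (c : List Glyph)
    (h : Run check y ⟨μ, .run v u, { m with
      A := c, P := P, Pl := one :: m.Pl, Df := raise m.Df }⟩ T A b) :
    Run check y ⟨μ, .run v u, { m with A := .code .inc :: c, P := one :: P }⟩ (T + 1) A b := by
  refine h.det ?_ rfl
  obtain ⟨_, _, _, _, _, _, _, D, _, _, _, _, _, _, _, _, _⟩ := m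
  rcases D with _ | ⟨_ | _ | (_ | _), D⟩ <;> rfl

theorem run_reset_left (v u : Bool) (m : Mem) (Pl : List Glyph) (c : List Glyph)
    (h : Run check y ⟨μ, .run v u, { m with
      A := .code .reset :: c, Pl := Pl, P := one :: m.P, Df := lower m.Df }⟩ T A b) :
    Run check y ⟨μ, .run v u, { m with A := .code .reset :: c, Pl := one :: Pl }⟩ (T + 1) A b := by
  refine h.det ?_ rfl
  obtain ⟨_, _, _, _, _, _, _, D, _, _, _, _, _, _, _, _, _⟩ := m
  rcases D with _ | ⟨_ | _ | (_ | _), D⟩ <;> rfl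

theorem run_inc_right (v u : Bool) (m : Mem) (x : Cd) (hx : x = .dot ∨ x = .halt)
    (c : List Glyph) (hc : m.A = .code x :: c) (Q : List Glyph) (d : List Glyph)
    (h : Run check y ⟨μ, .run v u, { m with
      B := d, Q := Q, Ql := one :: m.Ql, Df := lower m.Df }⟩ T A b) :
    Run check y ⟨μ, .run v u, { m with B := .code .inc :: d, Q := one :: Q }⟩ (T + 1) A b := by
  refine h.det ?_ rfl
  obtain ⟨_, _, _, _, _, _, _, D, _, _, _, _, _, _, _, _, _⟩ := m
  subst hc
  rcases hx with rfl | rfl <;> rcases D with _ | ⟨_ | _ | (_ | _), D⟩ <;> rfl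

theorem run_reset_right (v u : Bool) (m : Mem) (x : Cd) (hx : x = .dot ∨ x = .halt)
    (c : List Glyph) (hc : m.A = .code x :: c) (Ql : List Glyph) (d : List Glyph)
    (h : Run check y ⟨μ, .run v u, { m with
      B := .code .reset :: d, Ql := Ql, Q := one :: m.Q, Df := raise m.Df }⟩ T A b) :
    Run check y ⟨μ, .run v u, { m with B := .code .reset :: d, Ql := one :: Ql }⟩ (T + 1) A b := by
  refine h.det ?_ rfl
  obtain ⟨_, _, _, _, _, _, _, D, _, _, _, _, _, _, _, _, _⟩ := m
  subst hc
  rcases hx with rfl | rfl <;> rcases D with _ | ⟨_ | _ | (_ | _), D⟩ <;> rfl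

theorem unary_pred {n p : ℕ} (h : p + 1 < n) : unary (n - 1 - p) = one :: unary (n - 1 - (p + 1)) := by
  rw [show n - 1 - p = (n - 1 - (p + 1)) + 1 by omega]; rfl

/-- The potential `2 * c.length + p + 2 * d.length + q` drops at every step: an increment shortens a
code and raises its letter by one, and a reset lowers the letter step by step before it is removed.
The treatment of two emitted letters is a parameter, so equality and edges share the argument. -/
theorem run_race (v u : Bool) (F Fl S W Wl : List Glyph) (n A K : ℕ) (hA : 1 ≤ A) (hK : 2 ≤ K)
    (R : List ℕ → List ℕ → Prop) (h₀ : R [] [] ↔ u = true) (h₁ : ∀ x l, ¬ R (x :: l) [])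
    (h₂ : ∀ x l, ¬ R [] (x :: l))
    (hdot : ∀ c p d q N, 2 * c.length + p + 2 * d.length + q ≤ N → p < n → q < n → Valid n c p →
      Valid n d q → Run check y ⟨μ, .run v u, racing F Fl S W Wl n c p d q⟩ (N + K) A
        (R (decode c p) (decode d q) ↔ v = true) →
      Run check y ⟨μ, .run v u, racing F Fl S W Wl n (.dot :: c) p (.dot :: d) q⟩ (N + K + 1) A
        (R (p :: decode c p) (q :: decode d q) ↔ v = true)) (N : ℕ) :
    ∀ c p d q, 2 * c.length + p + 2 * d.length + q ≤ N → p < n → q < n → Valid n c p → Valid n d q →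
      Run check y ⟨μ, .run v u, racing F Fl S W Wl n c p d q⟩ (N + K) A
        (R (decode c p) (decode d q) ↔ v = true) := by
  induction N with
  | zero =>
    intro c p d q hN hp hq hc
    obtain rfl : c = [] := List.length_eq_zero_iff.1 (by omega)
    exact hc.elim
  | succ N ih =>
    intro c p d q hN hp hq hc hd
    have halt : ∀ (w : Bool) (b : Prop) (m m' : Mem), (b ↔ w = true) →
        succs check y ⟨μ, .run v u, m⟩ = [⟨w, .halt, m'⟩] →
        Run check y ⟨μ, .run v u, m⟩ (N + 1 + K) A b := fun w b m m' hb hs =>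
      ((run_halt w m').switch hs).mono (by omega) (by omega) hb
    -- The left code advances until it shows `dot` or `halt`; only then does the right code move.
    have hright : ∀ x c', c = x :: c' → (x = .dot ∨ x = .halt) →
        Run check y ⟨μ, .run v u, racing F Fl S W Wl n c p d q⟩ (N + 1 + K) A
        (R (decode c p) (decode d q) ↔ v = true) := by
      rintro x c' rfl hx
      rcases d with _ | ⟨_ | _ | _ | _, d⟩
      · exact hd.elim
      · rcases hx with rfl | rfl
        · simp only [List.length_cons] at hN
          exact (hdot c' p d q N (by omega) hp hq hc hd (ih c' p d q (by omega) hp hq hc hd)).mono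
            (by omega) le_rfl Iff.rfl
        · exact halt (!v) _ _ _ (by simp [decode, h₂]) rfl
      · simp only [List.length_cons] at hN
        have := ih (x :: c') p d (q + 1) (by simp at hN ⊢; omega) hp hd.1 hc hd.2
        have := run_inc_right (μ := μ) (y := y) v u (racing F Fl S W Wl n (x :: c') p d q) x hx _ rfl
          (unary (n - 1 - (q + 1))) (codes d) (this.congr_mem (by simp only [lower_diff]; rfl))
        exact (this.congr_mem (by simp [unary_pred hd.1])).mono (by omega) le_rfl Iff.rfl
      · cases q with
        | zero =>
          simp only [List.length_cons] at hN
          have := ih (x :: c') p d 0 (by simp at hN ⊢; omega) hp hq hc hd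
          refine Run.det' this ?_ rfl (by omega)
          rcases hx with rfl | rfl <;> rfl
        | succ q =>
          have := ih (x :: c') p (.reset :: d) q (by omega) hp (by omega) hc hd
          have := run_reset_right (μ := μ) (y := y) v u
            (racing F Fl S W Wl n (x :: c') p (.reset :: d) (q + 1)) x hx _ rfl
            (unary q) (codes d) (this.congr_mem (by simp [raise_diff', unary_pred hq]))
          exact (this.congr_mem rfl).mono (by omega) le_rfl Iff.rfl
      · rcases hx with rfl | rfl
        · exact halt (!v) _ _ _ (by simp [decode, h₁]) rfl
        · exact halt (u == v) _ _ _ (by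
            simp only [decode, h₀]; cases u <;> cases v <;> simp) rfl
    rcases c with _ | ⟨_ | _ | _ | _, c⟩
    · exact hc.elim
    · exact hright _ _ rfl (.inl rfl)
    · simp only [List.length_cons] at hN
      have := ih c (p + 1) d q (by omega) hc.1 hq hc.2 hd
      have := run_inc_left (μ := μ) (y := y) v u (racing F Fl S W Wl n c p d q)
        (unary (n - 1 - (p + 1))) (codes c) (this.congr_mem (by simp only [raise_diff]; rfl))
      exact (this.congr_mem (by simp [unary_pred hc.1])).mono (by omega) le_rfl Iff.rfl
    · cases p with
      | zero =>
        simp only [List.length_cons] at hN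
        have := ih c 0 d q (by omega) hp hq hc hd
        exact Run.det' this rfl rfl (by omega)
      | succ p =>
        have := ih (.reset :: c) p d q (by omega) (by omega) hq hc hd
        have := run_reset_left (μ := μ) (y := y) v u
          (racing F Fl S W Wl n (.reset :: c) (p + 1) d q)
          (unary p) (codes c) (this.congr_mem (by simp [lower_diff', unary_pred hp]))
        exact (this.congr_mem rfl).mono (by omega) le_rfl Iff.rfl
    · exact hright _ _ rfl (.inr rfl)

end

end WordGraph

/-! ### The game for atoms. -/

namespace WordGraph

theorem diff_self (p : ℕ) : diff p p = [] := by simp [diff]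

theorem diff_ne {p q : ℕ} (h : p ≠ q) : ∃ g D, diff p q = g :: D := by
  unfold diff
  split
  · rw [show p - q = (p - q - 1) + 1 by omega]; exact ⟨_, _, rfl⟩
  · rw [show q - p = (q - p - 1) + 1 by omega]; exact ⟨_, _, rfl⟩

/-- The code of the variable `x` in a list of records. -/
def codeOf : List (ℕ × List Cd) → ℕ → List Cd
  | [], _ => []
  | e :: es, x => if e.1 = x then e.2 else codeOf es x

theorem exists_codeOf {es : List (ℕ × List Cd)} {x : ℕ} (h : x ∈ es.map Prod.fst) :
    ∃ pre post, es = pre ++ (x, codeOf es x) :: post ∧ ∀ z ∈ pre, z.1 ≠ x := by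
  induction es with
  | nil => simp at h
  | cons e es ih =>
    by_cases he : e.1 = x
    · exact ⟨[], es, by simp [codeOf, if_pos he]; rw [← he], by simp⟩
    · obtain ⟨pre, post, hes, hpre⟩ := ih (by
        rcases List.mem_cons.1 h with h | h
        · exact absurd h.symm he
        · exact h)
      refine ⟨e :: pre, post, ?_, ?_⟩
      · simp only [codeOf, if_neg he, List.cons_append, List.cons.injEq, true_and]
        exact hes
      · simpa [he] using hpre

abbrev wordOf (es : List (ℕ × List Cd)) (x : ℕ) : List ℕ := decode (codeOf es x) 0

section
variable {y : List Bool} {μ : Bool} {T A : ℕ} {b : Prop}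

theorem run_equal (v : Bool) (F Fl S W Wl : List Glyph) (n : ℕ) (c d : List Cd) (p q : ℕ)
    (hp : p < n) (hq : q < n) (hc : Valid n c p) (hd : Valid n d q) :
    Run check y ⟨μ, .run v true, racing F Fl S W Wl n c p d q⟩
      (2 * c.length + p + 2 * d.length + q + 2) 1 (decode c p = decode d q ↔ v = true) := by
  refine run_race v true F Fl S W Wl n 1 2 le_rfl le_rfl (· = ·) (by simp) (by simp) (by simp) ?_ _
    c p d q le_rfl hp hq hc hd
  intro c p d q N _ _ _ _ _ h
  by_cases hpq : p = q
  · subst hpq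
    have h₁ : Run check y ⟨μ, .run v true, racing F Fl S W Wl n (.dot :: c) p (.dot :: d) p⟩ _ 1 _ :=
      h.det (by simp only [racing, diff_self]; rfl) rfl
    exact h₁.mono le_rfl le_rfl (by simp)
  · obtain ⟨g, D, hD⟩ := diff_ne hpq
    have h₁ : Run check y ⟨μ, .run v true, racing F Fl S W Wl n (.dot :: c) p (.dot :: d) q⟩ _ _ _ :=
      (run_halt (!v) (racing F Fl S W Wl n (.dot :: c) p (.dot :: d) q)).switch
        (by simp only [racing, hD]; rfl)
    exact h₁.mono (by omega) (by omega) (by simp [hpq])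

/-- In mode `v` the two conjuncts are split: for a positive claim both are verified universally, for
a negative one the existential player selects a conjunct that fails. -/
theorem run_claim (v : Bool) (F Fl S W Wl : List Glyph) (n : ℕ) (E : ℕ → ℕ → Prop) (Tv : ℕ)
    (c d : List Cd) (p q : ℕ)
    (hp : p < n) (hq : q < n) (hc : Valid n c p) (hd : Valid n d q)
    (h : Run check y ⟨v, .zeros v false, racing F Fl S W Wl n (.dot :: c) p (.dot :: d) q⟩ Tv 1
      (E p q ↔ v = true)) :
    Run check y ⟨v, .claim v, racing F Fl S W Wl n (.dot :: c) p (.dot :: d) q⟩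
      (2 * c.length + p + 2 * d.length + q + Tv + 3) 1
      ((E p q ∧ decode c p = decode d q) ↔ v = true) := by
  have h₁ := run_equal (y := y) (μ := v) v F Fl S W Wl n c d p q hp hq hc hd
  have h₂ : Run check y ⟨v, .claim v, racing F Fl S W Wl n (.dot :: c) p (.dot :: d) q⟩ _ _ _ :=
    Run.choose₂ (T := 2 * c.length + p + 2 * d.length + q + Tv + 2)
      (h.mono (by omega) le_rfl Iff.rfl) (h₁.mono (by omega) le_rfl Iff.rfl) rfl rfl rfl
  refine h₂.mono le_rfl le_rfl ?_
  cases v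
  · simp only [Bool.false_eq_true, iff_false, if_false]
    tauto
  · simp

/-- The player of mode `!v` points at the changed position. At unequal letters this is forced; at
equal letters it is optional, as the graph may have loops. The two alternations are the claim and
the final halt. -/
theorem run_changes (v : Bool) (F Fl S W Wl : List Glyph) (n : ℕ) (E : ℕ → ℕ → Prop) (Tv : ℕ)
    (h : ∀ c d p q, p < n → q < n →
      Run check y ⟨v, .zeros v false, racing F Fl S W Wl n c p d q⟩ Tv 1 (E p q ↔ v = true))
    (c d : List Cd) (p q : ℕ)
    (hp : p < n) (hq : q < n) (hc : Valid n c p) (hd : Valid n d q) :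
    Run check y ⟨!v, .run v false, racing F Fl S W Wl n c p d q⟩
      (2 * c.length + p + 2 * d.length + q + (Tv + 3)) 2
      (Changes E (decode c p) (decode d q) ↔ v = true) := by
  refine run_race v false F Fl S W Wl n 2 (Tv + 3) (by omega) (by omega) (Changes E)
    (by simp [Changes]) (by simp [Changes]) (by simp [Changes]) ?_ _ c p d q le_rfl hp hq hc hd
  intro c p d q N hN hp hq hc hd h'
  have h₀ := run_claim v F Fl S W Wl n E Tv c d p q hp hq hc hd (h _ _ p q hp hq)
  by_cases hpq : p = q
  · subst hpq
    have h₁ : Run check y ⟨!v, .run v false, racing F Fl S W Wl n (.dot :: c) p (.dot :: d) p⟩ _ _ _ :=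
      h'.choose₂' (h₀.mono (T' := N + (Tv + 3)) (by omega) le_rfl Iff.rfl)
        (by simp only [racing, diff_self]; rfl) rfl (by cases v <;> simp) le_rfl
    refine h₁.mono le_rfl le_rfl ?_
    simp only [Changes, true_and]
    cases v
    · simp only [Bool.false_eq_true, iff_false, Bool.not_false, if_true]
      tauto
    · simp only [iff_true, Bool.not_true, Bool.false_eq_true, if_false]
      tauto
  · obtain ⟨g, D, hD⟩ := diff_ne hpq
    have h₁ : Run check y ⟨!v, .run v false, racing F Fl S W Wl n (.dot :: c) p (.dot :: d) q⟩ _ _ _ :=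
      h₀.switch (by simp only [racing, hD]; rfl)
    exact h₁.mono (by omega) (by omega) (by simp [Changes, hpq])

theorem run_action (v : Bool) (m : Mem) (u : List (Sym × Bool)) (hu : ∀ x ∈ u, x.1.IsBit)
    (a : Bool) (F Fl : List Glyph)
    (h : Run check y ⟨μ, .lookUp v true false, { m with
      F := F, Fl := .tok .sep a :: (u.reverse.map tk ++ Fl) }⟩ T A b) :
    Run check y ⟨μ, .action v, { m with F := u.map tk ++ .tok .sep a :: F, Fl := Fl }⟩
      (T + 1 + u.length) A b := by
  refine Run.loop (tr := check) (y := y)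
    (fun (d t : List (Sym × Bool)) => ⟨μ, .action v, { m with
      F := t.map tk ++ .tok .sep a :: F, Fl := d.map tk ++ Fl }⟩)
    (fun x => x.1.IsBit) (fun x d t hx => ?_) (fun _ _ _ => rfl) u hu [] (h.det ?_ rfl)
  · obtain ⟨s, a⟩ := x
    cases s <;> first | rfl | exact hx.elim
  · rw [List.append_nil]; rfl

theorem length_le_records {es : List (ℕ × List Cd)} {x : ℕ} (h : x ∈ es.map Prod.fst) :
    (codeOf es x).length ≤ (records es).length := by
  obtain ⟨pre, post, hes, -⟩ := exists_codeOf h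
  generalize codeOf es x = c at *
  subst hes
  simp [records, record]
  omega

theorem valid_codeOf {n : ℕ} {es : List (ℕ × List Cd)} (hes : ∀ e ∈ es, Valid n e.2 0) {x : ℕ}
    (h : x ∈ es.map Prod.fst) : Valid n (codeOf es x) 0 := by
  obtain ⟨pre, post, h', -⟩ := exists_codeOf h
  exact hes (x, codeOf es x) (List.mem_iff_append.2 ⟨pre, post, h'⟩)

/-- The game for the atom `x = z`. -/
theorem run_atom_eq (n : ℕ) (hn : 0 < n) (es : List (ℕ × List Cd)) (hes : ∀ e ∈ es, Valid n e.2 0)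
    (x z : ℕ) (hx : x ∈ es.map Prod.fst) (hz : z ∈ es.map Prod.fst) (a : Bool)
    (u : List (Sym × Bool)) (hu : u.map Prod.fst = binary x ++ Sym.sep :: binary z)
    (F Fl S : List Glyph) (hF : StartsNonBit F) :
    Run check y ⟨μ, .walk, frame n (.tok .eq a :: (u.map tk ++ F)) Fl S (records es)⟩
      (6 * u.length + 14 * (records es).length + 22 * n + 40) 3
      (wordOf es x = wordOf es z ↔ a = true) := by
  obtain ⟨u₁, u', rfl, hu₁, hu'⟩ := List.map_eq_append_iff.1 hu
  obtain ⟨⟨s, a₁⟩, u₂, rfl, rfl, hu₂⟩ := List.map_eq_cons_iff.1 hu'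
  obtain ⟨pre₁, post₁, h₁, hpre₁⟩ := exists_codeOf hx
  obtain ⟨pre₂, post₂, h₂, hpre₂⟩ := exists_codeOf hz
  have hc := valid_codeOf hes hx
  have hd := valid_codeOf hes hz
  have hcl := length_le_records hx
  have hdl := length_le_records hz
  rw [wordOf, wordOf]
  generalize codeOf es x = c at *
  generalize codeOf es z = d at *
  have k₁ := fun W Wl => run_equal (y := y) (μ := !a) a (u₂.map tk ++ F)
    (.tok .sep a₁ :: (u₁.reverse.map tk ++ .tok .eq a :: Fl)) S W Wl n c d 0 0 hn hn hc hd
  have k₂ := run_right (μ := !a) (y := y) a false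
    { frame n (u₂.map tk ++ F) (.tok .sep a₁ :: (u₁.reverse.map tk ++ .tok .eq a :: Fl)) S [] with
      A := codes c } (.tok .sep a₁) trivial F (u₁.reverse.map tk ++ .tok .eq a :: Fl) hF z d pre₂ post₂
      hpre₂ u₂ hu₂ k₁
  rw [← h₂] at k₂
  have k₃ := run_left (μ := !a) (y := y) a false (frame n [] [] S []) (.tok .eq a) trivial a₁
    (u₂.map tk ++ F) Fl x c pre₁ post₁ hpre₁ u₁ hu₁ (by rw [← h₁]; exact k₂)
  rw [← h₁] at k₃
  have k₄ : Run check y ⟨μ, .walk,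
      frame n (.tok .eq a :: (u₁.map tk ++ .tok .sep a₁ :: (u₂.map tk ++ F))) Fl S (records es)⟩ _ _ _ :=
    k₃.switch rfl
  refine (k₄.congr_mem (by simp)).mono ?_ (by omega) Iff.rfl
  simp only [List.length_append, List.length_cons]
  omega

/-- The game for an atom `a(x, z)`. -/
theorem run_atom_edge {n m : ℕ} (G : LabelledGraph (Fin n) (Fin m)) (hn : 0 < n)
    (es : List (ℕ × List Cd)) (hes : ∀ e ∈ es, Valid n e.2 0) (o : Fin m)
    (x z : ℕ) (hx : x ∈ es.map Prod.fst) (hz : z ∈ es.map Prod.fst) (a : Bool)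
    (u : List (Sym × Bool))
    (hu : u.map Prod.fst = binary o ++ Sym.sep :: (binary x ++ Sym.sep :: binary z))
    (F Fl S : List Glyph) (hF : StartsNonBit F) :
    Run check (adjacencyTable G)
      ⟨μ, .walk, frame n (.tok .edge a :: (u.map tk ++ F)) Fl S (records es)⟩
      (6 * u.length + 14 * (records es).length + 22 * n + 40) 3
      (Changes (fun p q => ∃ (p' q' : Fin n), p' = p ∧ q' = q ∧ G.edge o p' q') (wordOf es x)
        (wordOf es z) ↔ a = true) := by
  obtain ⟨u₀, u', rfl, hu₀, hu'⟩ := List.map_eq_append_iff.1 hu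
  obtain ⟨⟨s, a₀⟩, u'', rfl, rfl, hu''⟩ := List.map_eq_cons_iff.1 hu'
  obtain ⟨u₁, u', rfl, hu₁, hu₃⟩ := List.map_eq_append_iff.1 hu''
  obtain ⟨⟨s', a₁⟩, u₂, rfl, rfl, hu₂⟩ := List.map_eq_cons_iff.1 hu₃
  obtain ⟨pre₁, post₁, h₁, hpre₁⟩ := exists_codeOf hx
  obtain ⟨pre₂, post₂, h₂, hpre₂⟩ := exists_codeOf hz
  have hc := valid_codeOf hes hx
  have hd := valid_codeOf hes hz
  have hcl := length_le_records hx
  have hdl := length_le_records hz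
  rw [wordOf, wordOf]
  generalize codeOf es x = c at *
  generalize codeOf es z = d at *
  set Fl' := (u₀ ++ (Sym.sep, a₀) :: (u₁ ++ [(Sym.sep, a₁)])).reverse.map tk ++ .tok .edge a :: Fl with hFl'
  have k₀ : ∀ W Wl c d p q, p < n → q < n → Run check (adjacencyTable G)
      ⟨a, .zeros a false, racing (u₂.map tk ++ F) Fl' S W Wl n c p d q⟩
      (2 * u₀.length + (u₁ ++ [(Sym.sep, a₁)]).length + 5 + 11 * n + 3 + 11 * n + 3) 1
      ((∃ (p' q' : Fin n), p' = p ∧ q' = q ∧ G.edge o p' q') ↔ a = true) := by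
    intro W Wl c d p q hp hq
    have j₁ := run_toEdge (μ := a) (y := adjacencyTable G) a
      { racing (u₂.map tk ++ F) Fl' S W Wl n c p d q with
        Q := [], Ql := [], P := [], Pl := [],
        X := (bits (digits n p)).reverse ++ ((bits (digits n q)).reverse ++ []) }
      u₀ (u₁ ++ [(.sep, a₁)]) o a a₀ hu₀ (by
        intro s hs
        simp only [List.mem_append, List.mem_singleton] at hs
        rcases hs with hs | rfl
        · have := isBit_of_map_fst hu₁ s hs
          obtain ⟨s, _⟩ := s
          cases s <;> trivial
        · trivial) (u₂.map tk ++ F) Fl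
    have j₂ := run_convert_left a { racing (u₂.map tk ++ F) Fl' S W Wl n c p d q with
      Q := [], Ql := [] } n p (n - 1 - p) (by omega) _ j₁
    have j₃ := run_convert_right a (racing (u₂.map tk ++ F) Fl' S W Wl n c p d q) n q (n - 1 - q)
      (by omega) _ j₂
    refine Run.mono j₃ le_rfl le_rfl ?_
    have := look_address G o ⟨p, hp⟩ ⟨q, hq⟩
    simp only at this
    simp only [List.append_nil]
    have e : (∃ (p' q' : Fin n), p' = p ∧ q' = q ∧ G.edge o p' q') ↔ G.edge o ⟨p, hp⟩ ⟨q, hq⟩ :=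
      ⟨by rintro ⟨p', q', rfl, rfl, h⟩; exact h, fun h => ⟨_, _, rfl, rfl, h⟩⟩
    rw [e, ← this]
    cases a <;> simp
  have k₁ := fun W Wl => run_changes (y := adjacencyTable G) a (u₂.map tk ++ F) Fl' S W Wl n _ _
    (k₀ W Wl) c d 0 0 hn hn hc hd
  have k₂ := run_right (μ := !a) (y := adjacencyTable G) a true
    { frame n (u₂.map tk ++ F) Fl' S [] with A := codes c } (.tok .sep a₁) trivial F
      (u₁.reverse.map tk ++ .tok .sep a₀ :: (u₀.reverse.map tk ++ .tok .edge a :: Fl)) hF z d pre₂ post₂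
      hpre₂ u₂ hu₂ (fun W Wl => (k₁ W Wl).congr_mem (by simp [hFl', diff_self]))
  rw [← h₂] at k₂
  have k₃ := run_left (μ := !a) (y := adjacencyTable G) a true (frame n [] [] S []) (.tok .sep a₀)
    trivial a₁ (u₂.map tk ++ F) (u₀.reverse.map tk ++ .tok .edge a :: Fl) x c pre₁ post₁ hpre₁ u₁ hu₁
    (by rw [← h₁]; exact k₂)
  rw [← h₁] at k₃
  have k₄ := run_action (μ := !a) (y := adjacencyTable G) a (frame n [] [] S (records es)) u₀
    (isBit_of_map_fst hu₀) a₀ _ (.tok .edge a :: Fl) k₃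
  have k₅ : Run check (adjacencyTable G) ⟨μ, .walk,
      frame n (.tok .edge a :: (u₀.map tk ++ .tok .sep a₀ :: (u₁.map tk ++ .tok .sep a₁ ::
        (u₂.map tk ++ F)))) Fl S (records es)⟩ _ _ _ :=
    k₄.switch rfl
  refine (k₅.congr_mem (by simp)).mono ?_ (by omega) Iff.rfl
  simp only [List.length_append, List.length_cons, List.length_nil]
  omega

end

end WordGraph

/-! ### Labelled formulas and the claims about them. -/

namespace WordGraph

/-- The truth of a formula in the game of codes: `s` is the last code that has been chosen, and `es`
holds the variables with their codes. -/
def BSat {α : Type} (n : ℕ) (E : α → ℕ → ℕ → Prop) :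
    Formula α → List Cd → List (ℕ × List Cd) → Prop
  | .eq x z, _, es => wordOf es x = wordOf es z
  | .edge a x z, _, es => Changes (E a) (wordOf es x) (wordOf es z)
  | .neg φ, s, es => ¬ BSat n E φ s es
  | .and φ ψ, s, es => BSat n E φ s es ∧ BSat n E ψ s es
  | .or φ ψ, s, es => BSat n E φ s es ∨ BSat n E ψ s es
  | .imp φ ψ, s, es => BSat n E φ s es → BSat n E ψ s es
  | .iff φ ψ, s, es => BSat n E φ s es ↔ BSat n E ψ s es
  | .ex x φ, s, es => ∃ c, Ref n s 0 false c ∧ BSat n E φ c ((x, c) :: es)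
  | .all x φ, s, es => ∀ c, Ref n s 0 false c → BSat n E φ c ((x, c) :: es)

/-- The edge relations of a graph, for numbers. -/
def edges {n m : ℕ} (G : LabelledGraph (Fin n) (Fin m)) (o : Fin m) (p q : ℕ) : Prop :=
  ∃ p' q' : Fin n, p' = p ∧ q' = q ∧ G.edge o p' q'

abbrev unlabelled (l : List Sym) : List (Sym × Bool) := l.map fun s => (s, false)

open Classical in
/-- The labelling of a formula by the truth values of its subformulas outside the quantifiers. -/
noncomputable def canon {m : ℕ} (n : ℕ) (E : Fin m → ℕ → ℕ → Prop) (s : List Cd)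
    (es : List (ℕ × List Cd)) : Formula (Fin m) → List (Sym × Bool)
  | .eq x z => (.eq, decide (BSat n E (.eq x z) s es)) :: unlabelled (binary x ++ .sep :: binary z)
  | .edge a x z => (.edge, decide (BSat n E (.edge a x z) s es)) ::
      unlabelled (binary a ++ .sep :: (binary x ++ .sep :: binary z))
  | .neg φ => (.neg, decide (BSat n E (.neg φ) s es)) :: canon n E s es φ
  | .and φ ψ => (.and, decide (BSat n E (.and φ ψ) s es)) :: (canon n E s es φ ++ canon n E s es ψ)
  | .or φ ψ => (.or, decide (BSat n E (.or φ ψ) s es)) :: (canon n E s es φ ++ canon n E s es ψ)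
  | .imp φ ψ => (.imp, decide (BSat n E (.imp φ ψ) s es)) :: (canon n E s es φ ++ canon n E s es ψ)
  | .iff φ ψ => (.iff, decide (BSat n E (.iff φ ψ) s es)) :: (canon n E s es φ ++ canon n E s es ψ)
  | .ex x φ => (.ex, decide (BSat n E (.ex x φ) s es)) :: unlabelled (binary x ++ φ.encode)
  | .all x φ => (.all, decide (BSat n E (.all x φ) s es)) :: unlabelled (binary x ++ φ.encode)

def root : List (Sym × Bool) → Bool
  | x :: _ => x.2
  | [] => false

def Sym.IsOp : Sym → Prop
  | .bit _ | .sep | .mark => False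
  | _ => True

section
variable {m : ℕ} {n : ℕ} {E : Fin m → ℕ → ℕ → Prop} {s : List Cd} {es : List (ℕ × List Cd)}

theorem exists_isOp (φ : Formula (Fin m)) : ∃ o l, φ.encode = o :: l ∧ o.IsOp := by
  cases φ <;> exact ⟨_, _, rfl, trivial⟩

theorem mark_notMem_binary (x : ℕ) : Sym.mark ∉ binary x := fun h => isBit_of_mem_binary h

theorem mark_notMem_encode (φ : Formula (Fin m)) : Sym.mark ∉ φ.encode := by
  induction φ with
  | eq x z => simp [Formula.encode, mark_notMem_binary]
  | edge a x z => simp [Formula.encode, mark_notMem_binary]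
  | neg φ ih => simpa [Formula.encode] using ih
  | and φ ψ ih₁ ih₂ | or φ ψ ih₁ ih₂ | imp φ ψ ih₁ ih₂ | iff φ ψ ih₁ ih₂ =>
    simpa [Formula.encode] using ⟨ih₁, ih₂⟩
  | ex x φ ih | all x φ ih => simpa [Formula.encode, mark_notMem_binary] using ih

theorem canon_fst (φ : Formula (Fin m)) : (canon n E s es φ).map Prod.fst = φ.encode := by
  induction φ <;> simp_all [canon, Formula.encode, Function.comp_def]

theorem root_canon (φ : Formula (Fin m)) : root (canon n E s es φ) = true ↔ BSat n E φ s es := by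
  cases φ <;> simp [canon, root]

variable {y : List Bool} {μ : Bool} {T A : ℕ} {b : Prop}

/-- A wrong label leads to `halt` in existential mode, which rejects; this makes the label test a
conjunct of the value. -/
theorem run_enter (k : Bool → Bool) (φ : Formula (Fin m)) (u : List (Sym × Bool))
    (hu : u.map Prod.fst = φ.encode) (F Fl S W : List Glyph) (hT : 1 ≤ T) (hA : 1 ≤ A)
    (h : Run check y ⟨true, .walk, frame n (u.map tk ++ F) Fl S W⟩ T A b) :
    Run check y ⟨true, .skip k, frame n (u.map tk ++ F) Fl S W⟩ (T + 1) A (k (root u) = true ∧ b) := by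
  obtain ⟨o, l, he, ho⟩ := exists_isOp φ
  rw [he] at hu
  obtain ⟨⟨o, a⟩, u, rfl, rfl, -⟩ := List.map_eq_cons_iff.1 hu
  simp only [root]
  set c := frame n (((o, a) :: u).map tk ++ F) Fl S W with hc
  have key : succs check y ⟨true, .skip k, c⟩ =
      [if k a then ⟨true, .walk, c⟩ else ⟨false, .halt, c⟩] := by
    have : succs check y ⟨true, .skip k, c⟩ =
      [(if k a then ((true, .walk, nops) : Bool × Ctl × Reg Op) else (false, .halt, nops))].map
        fun z => ⟨z.1, z.2.1, z.2.2.map₂ Op.apply c⟩ := by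
      cases o <;> first | rfl | exact ho.elim
    rw [this, List.map_singleton]
    cases k a <;> rfl
  by_cases hk : k a = true
  · rw [if_pos hk] at key
    exact (h.det key rfl).mono le_rfl le_rfl (by simp [hk])
  · rw [if_neg hk] at key
    exact ((run_halt false c).switch key).mono (by omega) hA (by simp [hk])

/-- Writing the name of the variable onto its code completes a record. The alternation passes the
turn to the existential player, who labels next. -/
theorem run_name (v : Bool) (u : List (Sym × Bool)) (x : ℕ) (hu : u.map Prod.fst = binary x)
    (F Fl S : List Glyph) (hF : StartsNonBit F) (c : List Cd)
    (h : Run check y ⟨false, .toEnd v, frame n F (u.reverse.map tk ++ Fl) S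
      (records ((x, c) :: es))⟩ T A b) :
    Run check y ⟨μ, .name v, frame n (u.map tk ++ F) Fl S
      (.flag false :: (codes c).reverse ++ records es)⟩ (T + 1 + u.length) (A + 1) b := by
  have h₁ : Run check y ⟨μ, .name v, frame n F (u.reverse.map tk ++ Fl) S
      (records ((x, c) :: es))⟩ (T + 1) (A + 1) b := by
    refine h.switch ?_
    rcases F with _ | ⟨⟨_ | _, _⟩ | _ | _, F⟩ <;> first | rfl | exact hF.elim
  refine Run.loop (tr := check) (y := y)
    (fun (d t : List (Sym × Bool)) => ⟨μ, .name v, frame n (t.map tk ++ F) (d.map tk ++ Fl) S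
      (plain (d.map Prod.fst) ++ (.flag false :: (codes c).reverse ++ records es))⟩)
    (fun x => x.1.IsBit) (fun x d t hx => ?_) (fun _ _ _ => rfl) u (isBit_of_map_fst hu) [] (h₁.congr_mem ?_)
  · obtain ⟨s, a⟩ := x
    cases s <;> first | rfl | exact hx.elim
  · simp [records, record, ← hu]

theorem startsNonBit_tokens {r : List Sym} (hr : ∀ s ∈ r.head?, ¬ s.IsBit) {u : List (Sym × Bool)}
    (hu : u.map Prod.fst = r) (a : Bool) (f : List Glyph) :
    StartsNonBit (u.map tk ++ .tok .mark a :: f) := by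
  subst hu
  rcases u with _ | ⟨⟨_ | _, _⟩, u⟩ <;> first | trivial | exact hr _ rfl trivial

theorem startsNonBit_encode {φ : Formula (Fin m)} {u : List (Sym × Bool)}
    (hu : u.map Prod.fst = φ.encode) (f : List Glyph) : StartsNonBit (u.map tk ++ f) := by
  obtain ⟨o, l, he, ho⟩ := exists_isOp φ
  rw [he] at hu
  obtain ⟨⟨o, a⟩, u, rfl, rfl, -⟩ := List.map_eq_cons_iff.1 hu
  cases o <;> trivial

/-- Bounds for the game: `I j s es` describes the positions after `j` quantifiers. -/
structure Budget (n l Φ D K : ℕ) (I : ℕ → List Cd → List (ℕ × List Cd) → Prop) : Prop where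
  pos : 0 < n
  valid : ∀ j s es, I j s es → ∀ e ∈ es, Valid n e.2 0
  next : ∀ j s es x c, I j s es → j + 1 ≤ l → Ref n s 0 false c → (binary x).length ≤ Φ →
    I (j + 1) c ((x, c) :: es)
  atom : ∀ j s es, I j s es → j ≤ l → 6 * Φ + 14 * (records es).length + 22 * n + 40 ≤ K
  quant : ∀ j s es, I j s es → j + 1 ≤ l →
    4 * s.length + 3 * n + 4 * n * seps s + 6 * Φ + 26 ≤ D

/-- The result of a walk through a labelled formula. -/
def Walks (G : LabelledGraph (Fin n) (Fin m)) (l Φ D K : ℕ)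
    (I : ℕ → List Cd → List (ℕ × List Cd) → Prop) (φ : Formula (Fin m)) : Prop :=
  ∀ (j : ℕ) (s : List Cd) (es : List (ℕ × List Cd)) (u u₂ : List (Sym × Bool)) (r : List Sym) (a : Bool)
    (f Fl : List Glyph), I j s es → j + φ.quantifierRank ≤ l → u.map Prod.fst = φ.encode →
    u₂.map Prod.fst = r → .mark ∉ r → (∀ s ∈ r.head?, ¬ s.IsBit) →
    (∀ x ∈ φ.freeVars, x ∈ es.map Prod.fst) → u.length + u₂.length ≤ Φ →
    ∃ b, Run check (adjacencyTable G) ⟨true, .walk,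
      frame n (u.map tk ++ (u₂.map tk ++ .tok .mark a :: f)) Fl (codes s) (records es)⟩
      (φ.quantifierRank * D + 3 * u.length + K) (3 * φ.quantifierRank + 3) b ∧
      (b → (root u = true ↔ BSat n (edges G) φ s es)) ∧ (u = canon n (edges G) s es φ → b)

/-- The game for the claim that `φ` has the truth value `v`. -/
theorem run_claimed {G : LabelledGraph (Fin n) (Fin m)} {l Φ D K : ℕ}
    {I : ℕ → List Cd → List (ℕ × List Cd) → Prop} (hK : 1 ≤ K) {φ : Formula (Fin m)}
    (hφ : Walks G l Φ D K I φ)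
    (v : Bool) (j : ℕ) (s : List Cd) (es : List (ℕ × List Cd)) (u u₂ : List (Sym × Bool)) (r : List Sym)
    (a : Bool) (f Fl : List Glyph) (h : I j s es) (hj : j + φ.quantifierRank ≤ l)
    (hu : u.map Prod.fst = φ.encode) (hu₂ : u₂.map Prod.fst = r) (hr : .mark ∉ r)
    (hr' : ∀ s ∈ r.head?, ¬ s.IsBit) (hv : ∀ x ∈ φ.freeVars, x ∈ es.map Prod.fst)
    (hl : u.length + u₂.length ≤ Φ) :
    Run check (adjacencyTable G) ⟨false, .toEnd v,
      frame n (u.map tk ++ (u₂.map tk ++ .tok .mark a :: f)) Fl (codes s) (records es)⟩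
      (φ.quantifierRank * D + 3 * u.length + K + 2 * Φ + 3) (3 * φ.quantifierRank + 4)
      (BSat n (edges G) φ s es ↔ v = true) := by
  have key : ∀ u' u₂' : List (Sym × Bool), u'.map Prod.fst = φ.encode → u₂'.map Prod.fst = r →
      ∃ b, Run check (adjacencyTable G) ⟨true, .skip (· == v),
        frame n ((u' ++ u₂').map tk ++ .tok .mark a :: f) Fl (codes s) (records es)⟩
        (φ.quantifierRank * D + 3 * u.length + K + 1) (3 * φ.quantifierRank + 3)
        ((root u' == v) = true ∧ b) ∧
      (b → (root u' = true ↔ BSat n (edges G) φ s es)) ∧ (u' = canon n (edges G) s es φ → b) := by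
    intro u' u₂' hu' hu₂'
    have e₁ : u'.length = u.length := by
      have := congrArg List.length (hu'.trans hu.symm)
      simpa using this
    have e₂ : u₂'.length = u₂.length := by
      have := congrArg List.length (hu₂'.trans hu₂.symm)
      simpa using this
    obtain ⟨b, hb, h₁, h₂⟩ := hφ j s es u' u₂' r a f Fl h hj hu' hu₂' hr hr' hv (by omega)
    refine ⟨b, ?_, h₁, h₂⟩
    rw [e₁] at hb
    have := run_enter (fun w => w == v) φ u' hu' _ _ _ _ (by omega) (by omega) hb
    exact this.congr_mem (by simp)
  have h₁ := run_labelling (T := φ.quantifierRank * D + 3 * u.length + K + 1)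
    (A := 3 * φ.quantifierRank + 3) (y := adjacencyTable G) v a n (u ++ u₂) (by
      intro x hx hm
      rcases List.mem_append.1 hx with hx | hx
      · exact mark_notMem_encode φ (by rw [← hu, ← hm]; exact List.mem_map_of_mem hx)
      · exact hr (by rw [← hu₂, ← hm]; exact List.mem_map_of_mem hx)) f Fl (codes s) (records es)
    -- For an arbitrary labelling the value is only known to lie between soundness and completeness,
    -- so it enters through `Wins`.
    (fun w => Wins check (adjacencyTable G) ⟨true, .skip (· == v),
        frame n (w.map tk ++ .tok .mark a :: f) Fl (codes s) (records es)⟩) (by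
      intro w hw
      rw [List.map_append, hu, hu₂] at hw
      obtain ⟨u', u₂', rfl, hu', hu₂'⟩ := List.map_eq_append_iff.1 hw
      obtain ⟨b, hb, -⟩ := key u' u₂' hu' hu₂'
      exact hb.mono le_rfl le_rfl hb.wins_iff)
  refine (h₁.congr_mem (by simp)).mono (by simp; omega) le_rfl ?_
  constructor
  · intro H
    -- The truthful labelling wins. The symbols behind `φ` are relabelled too, but their labels play
    -- no role here and may stay.
    refine ⟨canon n (edges G) s es φ ++ u₂, by simp [canon_fst, hu], ?_⟩
    obtain ⟨b, hb, h₂, h₃⟩ := key (canon n (edges G) s es φ) u₂ (canon_fst φ) hu₂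
    rw [hb.wins_iff]
    refine ⟨?_, h₃ rfl⟩
    rw [beq_iff_eq, Bool.eq_iff_iff, root_canon]
    exact H
  · rintro ⟨w, hw, hW⟩
    rw [List.map_append, hu, hu₂] at hw
    obtain ⟨u', u₂', rfl, hu', hu₂'⟩ := List.map_eq_append_iff.1 hw
    obtain ⟨b, hb, h₂, h₃⟩ := key u' u₂' hu' hu₂'
    rw [hb.wins_iff] at hW
    rw [← h₂ hW.2, beq_iff_eq.1 hW.1]

end

end WordGraph

/-! ### Induction on the formula. -/

namespace WordGraph

section
variable {m n l Φ D K : ℕ} {G : LabelledGraph (Fin n) (Fin m)}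
  {I : ℕ → List Cd → List (ℕ × List Cd) → Prop}

theorem length_eq_of_fst {u v : List (Sym × Bool)} {w : List Sym} (hu : u.map Prod.fst = w)
    (hv : v.map Prod.fst = w) : u.length = v.length := by
  have := congrArg List.length (hu.trans hv.symm)
  simpa using this

theorem isOp_head (φ : Formula (Fin m)) (l : List Sym) :
    ∀ s ∈ (φ.encode ++ l).head?, ¬ s.IsBit := by
  obtain ⟨o, l', h, ho⟩ := exists_isOp φ
  rw [h]
  rintro s ⟨⟩
  cases o <;> first | exact id | exact ho.elim

/-- If both universal branches succeed, the labels of the operands are right by induction, and the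
local test makes the label of the connective right. Both branches stay universal, so connectives
cost no alternation. -/
theorem walks_binary (hK : 1 ≤ K) (χ φ ψ : Formula (Fin m)) (o : Sym) (op : Bool → Bool → Bool)
    (henc : χ.encode = o :: (φ.encode ++ ψ.encode))
    (hrank : χ.quantifierRank = max φ.quantifierRank ψ.quantifierRank)
    (hfree : χ.freeVars = φ.freeVars ∪ ψ.freeVars)
    (hB : ∀ s es (p q : Bool), (p = true ↔ BSat n (edges G) φ s es) →
      (q = true ↔ BSat n (edges G) ψ s es) → (op p q = true ↔ BSat n (edges G) χ s es))
    (hcan : ∀ s es, ∃ a, canon n (edges G) s es χ =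
      (o, a) :: (canon n (edges G) s es φ ++ canon n (edges G) s es ψ))
    (hstep : ∀ y a F Fl S W, succs check y ⟨true, .walk, frame n (.tok o a :: F) Fl S W⟩ =
      [⟨true, .walk, frame n F (.tok o a :: Fl) S W⟩,
        ⟨true, .right fun v w => op v w == a, frame n F (.tok o a :: Fl) S W⟩])
    (hφ : Walks G l Φ D K I φ) (hψ : Walks G l Φ D K I ψ) : Walks G l Φ D K I χ := by
  intro j s es u u₂ r a f Fl h hj hu hu₂ hr hr' hv hl
  rw [henc] at hu
  obtain ⟨⟨o, a'⟩, u', rfl, rfl, hu'⟩ := List.map_eq_cons_iff.1 hu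
  obtain ⟨uφ, uψ, rfl, huφ, huψ⟩ := List.map_eq_append_iff.1 hu'
  simp only [List.length_cons, List.length_append] at hl
  obtain ⟨b₂, h₂, i₂, c₂⟩ := hψ j s es uψ u₂ r a f (uφ.reverse.map tk ++ .tok o a' :: Fl) h (by omega)
    huψ hu₂ hr hr' (fun x hx => hv x (by simp [hfree, hx])) (by omega)
  obtain ⟨b₁, h₁, i₁, c₁⟩ := hφ j s es uφ (uψ ++ u₂) (ψ.encode ++ r) a f (.tok o a' :: Fl) h (by omega)
    huφ (by simp [huψ, hu₂]) (by simp [mark_notMem_encode, hr]) (isOp_head ψ r)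
    (fun x hx => hv x (by simp [hfree, hx])) (by simp; omega)
  have h₃ := run_enter (fun w => op (root uφ) w == a') ψ uψ huψ _ _ _ _ (by omega) (by omega) h₂
  have h₄ := run_skip (fun w => op (root uφ) w == a') φ uφ huφ (uψ.map tk ++ (u₂.map tk ++ .tok .mark a :: f))
    (.tok o a' :: Fl) [] (frame n [] [] (codes s) (records es)) _ (h₃.congr_mem (by simp))
  have h₅ : Run check (adjacencyTable G) ⟨true, .right fun v w => op v w == a',
      frame n (uφ.map tk ++ (uψ.map tk ++ (u₂.map tk ++ .tok .mark a :: f))) (.tok o a' :: Fl)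
      (codes s) (records es)⟩ _ _ _ := h₄.det (by
    obtain ⟨o, l, he, -⟩ := exists_isOp φ
    rw [he] at huφ
    obtain ⟨x, u', rfl, -⟩ := List.map_eq_cons_iff.1 huφ
    rfl) rfl
  set r₀ := χ.quantifierRank with hr₀
  have e₁ : φ.quantifierRank * D ≤ r₀ * D := Nat.mul_le_mul_right _ (by omega)
  have e₂ : ψ.quantifierRank * D ≤ r₀ * D := Nat.mul_le_mul_right _ (by omega)
  set T := r₀ * D + uφ.length + 3 * uφ.length + 3 * uψ.length + K + 2 with hT
  have h₆ := (h₁.congr_mem (m' := frame n (uφ.map tk ++ (uψ.map tk ++ (u₂.map tk ++ .tok .mark a :: f)))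
    (.tok o a' :: Fl) (codes s) (records es)) (by simp)).mono (T' := r₀ * D + 3 * uφ.length + 3 * uψ.length + K + 2)
    (A' := 3 * r₀ + 3) (by omega) (by omega) Iff.rfl
  have h₇ := Run.choose₂ h₆ (h₅.mono (T' := r₀ * D + 3 * uφ.length + 3 * uψ.length + K + 2)
    (A' := 3 * r₀ + 3) (by omega) (by omega) Iff.rfl) (hstep _ a' _ Fl _ _) rfl rfl
  refine ⟨_, (h₇.congr_mem (by simp)).mono (by simp only [List.length_cons, List.length_append]; omega)
    le_rfl Iff.rfl, ?_, ?_⟩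
  · rw [if_pos rfl]
    rintro ⟨k₁, k, k₂⟩
    rw [← hB s es _ _ (i₁ k₁) (i₂ k₂), beq_iff_eq.1 k]
    rfl
  · intro hc
    have hc' := hc
    obtain ⟨a₀, ha₀⟩ := hcan s es
    rw [ha₀, List.cons.injEq] at hc
    -- The truthful labelling of the connective restricts to those of the operands, since the cut is
    -- determined by the length of the code of `φ`.
    obtain ⟨k₁, k₂⟩ := List.append_inj hc.2 (length_eq_of_fst huφ (canon_fst φ))
    rw [if_pos rfl]
    refine ⟨c₁ k₁, ?_, c₂ k₂⟩
    have : root ((o, a') :: (uφ ++ uψ)) = a' := rfl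
    rw [beq_iff_eq, Bool.eq_iff_iff, hB s es _ _ (i₁ (c₁ k₁)) (i₂ (c₂ k₂)), ← this, hc', root_canon]

theorem walks_neg (hK : 1 ≤ K) (φ : Formula (Fin m)) (hφ : Walks G l Φ D K I φ) :
    Walks G l Φ D K I (.neg φ) := by
  intro j s es u u₂ r a f Fl h hj hu hu₂ hr hr' hv hl
  obtain ⟨⟨o, a'⟩, u', rfl, rfl, hu'⟩ := List.map_eq_cons_iff.1 hu
  simp only [List.length_cons] at hl
  obtain ⟨b, h₁, i₁, c₁⟩ := hφ j s es u' u₂ r a f (.tok .neg a' :: Fl) h hj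
    hu' hu₂ hr hr' hv (by omega)
  have h₃ := run_enter (fun w => !(w == a')) φ u' hu' _ _ _ _ (by omega) (by omega) h₁
  have h₅ : Run check (adjacencyTable G) ⟨true, .walk,
      frame n (.tok .neg a' :: (u'.map tk ++ (u₂.map tk ++ .tok .mark a :: f))) Fl
      (codes s) (records es)⟩ _ _ _ := h₃.det rfl rfl
  refine ⟨_, (h₅.congr_mem (by simp)).mono (by
    simp only [List.length_cons, Formula.quantifierRank]; omega) le_rfl Iff.rfl, ?_, ?_⟩
  · rintro ⟨k₁, k₂⟩
    rw [BSat, ← i₁ k₂, root]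
    revert k₁
    cases a' <;> cases root u' <;> simp
  · intro hc
    have hc' := hc
    rw [canon, List.cons.injEq] at hc
    refine ⟨?_, c₁ hc.2⟩
    have : a' = true ↔ ¬ root u' = true := by
      rw [i₁ (c₁ hc.2), ← BSat, ← root_canon, ← hc']
      rfl
    revert this
    cases a' <;> cases root u' <;> simp

/-- The label `a` becomes the claim that the body has the value `a` after a word has been chosen in
mode `ν a`. The three alternations go to the chooser, to the labeller and to the universal checker.
-/
theorem walks_quantifier (hI : Budget n l Φ D K I) (hK : 1 ≤ K) (χ φ : Formula (Fin m)) (o : Sym)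
    (x : ℕ) (ν : Bool → Bool)
    (henc : χ.encode = o :: (binary x ++ φ.encode))
    (hrank : χ.quantifierRank = φ.quantifierRank + 1)
    (hfree : χ.freeVars = φ.freeVars.erase x)
    (hB : ∀ s es (a : Bool), Quant (ν a) (Ref n s 0 false)
      (fun c => BSat n (edges G) φ c ((x, c) :: es) ↔ a = true) ↔
      (BSat n (edges G) χ s es ↔ a = true))
    (hstep : ∀ y a F Fl S W, succs check y ⟨true, .walk, frame n (.tok o a :: F) Fl S W⟩ =
      [⟨ν a, .guess a false, frame n (.tok o a :: F) Fl S W⟩])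
    (hφ : Walks G l Φ D K I φ) : Walks G l Φ D K I χ := by
  intro j s es u u₂ r a f Fl h hj hu hu₂ hr hr' hv hl
  rw [henc] at hu
  obtain ⟨⟨o, a'⟩, u', rfl, rfl, hu'⟩ := List.map_eq_cons_iff.1 hu
  obtain ⟨ux, uφ, rfl, hux, huφ⟩ := List.map_eq_append_iff.1 hu'
  simp only [List.length_cons, List.length_append] at hl
  have hx : (binary x).length = ux.length := by rw [← hux, List.length_map]
  have hn := hI.pos
  have h₁ := run_guess (y := adjacencyTable G) (μ := ν a') a' (.tok o a')
    (ux.map tk ++ (uφ.map tk ++ (u₂.map tk ++ .tok .mark a :: f))) Fl (records es)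
    (T := φ.quantifierRank * D + 3 * uφ.length + K + 2 * Φ + 3 + 1 + ux.length)
    (A := 3 * φ.quantifierRank + 4 + 1)
    (fun c => BSat n (edges G) φ c ((x, c) :: es) ↔ a' = true) n s (n - 1) 0 false [] (by omega) (by
      intro c hc
      have h₂ := run_claimed hK hφ a' (j + 1) c ((x, c) :: es) uφ u₂ r a f
        (ux.reverse.map tk ++ .tok o a' :: Fl) (hI.next j s es x c h (by omega) hc (by omega))
        (by omega) huφ hu₂ hr hr' (by
          intro z hz
          by_cases hzx : z = x
          · simp [hzx]
          · exact List.mem_cons_of_mem _ (hv z (by rw [hfree]; exact Finset.mem_erase.2 ⟨hzx, hz⟩)))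
        (by omega)
      exact run_name a' ux x hux _ (.tok o a' :: Fl) (codes c) (startsNonBit_encode huφ _) c h₂)
  have h₃ := (h₁.congr_mem (m' := frame n (.tok o a' :: (ux.map tk ++ (uφ.map tk ++
    (u₂.map tk ++ .tok .mark a :: f)))) Fl (codes s) (records es)) (by simp)).switch
      (hstep _ a' _ Fl _ _)
  refine ⟨_, (h₃.congr_mem (by simp)).mono ?_ (by omega) Iff.rfl, ?_, ?_⟩
  · have := hI.quant j s es h (by omega)
    rw [hrank, add_mul]
    simp only [List.length_cons, List.length_append, List.length_nil]
    omega
  · intro hq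
    simp only [List.nil_append, hB] at hq
    exact hq.symm
  · intro hc
    simp only [List.nil_append, hB]
    have : root ((o, a') :: (ux ++ uφ)) = a' := rfl
    rw [← this, hc, root_canon]

theorem walks (hI : Budget n l Φ D K I) (hK : 1 ≤ K) (φ : Formula (Fin m)) : Walks G l Φ D K I φ := by
  induction φ with
  | eq x z =>
    intro j s es u u₂ r a f Fl h hj hu hu₂ hr hr' hv hl
    obtain ⟨⟨o, a'⟩, u', rfl, rfl, hu'⟩ := List.map_eq_cons_iff.1 hu
    have h₁ := run_atom_eq (μ := true) (y := adjacencyTable G) n hI.pos es (hI.valid j s es h) x z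
      (hv x (by simp [Formula.freeVars])) (hv z (by simp [Formula.freeVars])) a' u' hu'
      (u₂.map tk ++ .tok .mark a :: f) Fl (codes s) (startsNonBit_tokens hr' hu₂ a f)
    have := hI.atom j s es h (by omega)
    simp only [List.length_cons] at hl
    refine ⟨_, (h₁.congr_mem (by simp)).mono (by omega) (by omega) Iff.rfl, Iff.symm, ?_⟩
    intro hc
    have := root_canon (E := edges G) (n := n) (s := s) (es := es) (.eq x z)
    rw [← hc] at this
    exact this.symm
  | edge o x z =>
    intro j s es u u₂ r a f Fl h hj hu hu₂ hr hr' hv hl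
    obtain ⟨⟨o', a'⟩, u', rfl, rfl, hu'⟩ := List.map_eq_cons_iff.1 hu
    have h₁ := run_atom_edge (μ := true) G hI.pos es (hI.valid j s es h) o x z
      (hv x (by simp [Formula.freeVars])) (hv z (by simp [Formula.freeVars])) a' u' hu'
      (u₂.map tk ++ .tok .mark a :: f) Fl (codes s) (startsNonBit_tokens hr' hu₂ a f)
    have := hI.atom j s es h (by omega)
    simp only [List.length_cons] at hl
    refine ⟨_, (h₁.congr_mem (by simp)).mono (by omega) (by omega) Iff.rfl, Iff.symm, ?_⟩
    intro hc
    have := root_canon (E := edges G) (n := n) (s := s) (es := es) (.edge o x z)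
    rw [← hc] at this
    exact this.symm
  | neg φ ih => exact walks_neg hK φ ih
  | and φ ψ ih₁ ih₂ =>
    refine walks_binary hK _ φ ψ .and (fun v w => v && w) rfl rfl rfl ?_ (fun _ _ => ⟨_, rfl⟩)
      (fun _ _ _ _ _ _ => rfl) ih₁ ih₂
    intro s es p q hp hq
    rw [BSat, ← hp, ← hq]; cases p <;> cases q <;> simp
  | or φ ψ ih₁ ih₂ =>
    refine walks_binary hK _ φ ψ .or (fun v w => v || w) rfl rfl rfl ?_ (fun _ _ => ⟨_, rfl⟩)
      (fun _ _ _ _ _ _ => rfl) ih₁ ih₂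
    intro s es p q hp hq
    rw [BSat, ← hp, ← hq]; cases p <;> cases q <;> simp
  | imp φ ψ ih₁ ih₂ =>
    refine walks_binary hK _ φ ψ .imp (fun v w => !v || w) rfl rfl rfl ?_ (fun _ _ => ⟨_, rfl⟩)
      (fun _ _ _ _ _ _ => rfl) ih₁ ih₂
    intro s es p q hp hq
    rw [BSat, ← hp, ← hq]; cases p <;> cases q <;> simp
  | iff φ ψ ih₁ ih₂ =>
    refine walks_binary hK _ φ ψ .iff (fun v w => v == w) rfl rfl rfl ?_ (fun _ _ => ⟨_, rfl⟩)
      (fun _ _ _ _ _ _ => rfl) ih₁ ih₂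
    intro s es p q hp hq
    rw [BSat, ← hp, ← hq]; cases p <;> cases q <;> simp
  | ex x φ ih =>
    refine walks_quantifier hI hK _ φ .ex x (fun a => !a) rfl rfl rfl ?_ (fun _ _ _ _ _ _ => rfl) ih
    intro s es a
    cases a <;> simp [Quant, BSat]
  | all x φ ih =>
    refine walks_quantifier hI hK _ φ .all x (fun a => a) rfl rfl rfl ?_ (fun _ _ _ _ _ _ => rfl) ih
    intro s es a
    cases a <;> simp [Quant, BSat]

end

end WordGraph

/-! ### The quantifier rank and the first code. -/

namespace WordGraph

/-- The number of dots in the first code for a sentence of quantifier rank `k`. -/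
def room (n : ℕ) : ℕ → ℕ
  | 0 => 2
  | k + 1 => n * room n k + 1

abbrev toks (l : List Sym) : List Glyph := l.map (.tok · false)

section
variable {y : List Bool} {μ : Bool} {T A : ℕ} {b : Prop} {m n : ℕ}

/-- An atom completes all innermost open quantifiers up to the next pending second operand. Closing
one transfers a unit from the depth `V` to the difference `U`, so their sum, the maximal depth, is
kept. -/
theorem run_leave (m : Mem) (k d e : ℕ) (hk : k ≤ d) (C C' : List Glyph)
    (hC : (C = [] ∧ C' = []) ∨ C = .flag false :: C')
    (h : Run check y ⟨μ, .scan, { m with C := C', V := unary (d - k), U := unary (e + k) }⟩ T A b) :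
    Run check y ⟨μ, .leave, { m with C := unary k ++ C, V := unary d, U := unary e }⟩
      (T + k + 1) A b := by
  induction k generalizing d e with
  | zero => rcases hC with ⟨rfl, rfl⟩ | rfl <;> exact h.det rfl rfl
  | succ k ih =>
    obtain ⟨d, rfl⟩ : ∃ d', d = d' + 1 := ⟨d - 1, by omega⟩
    have := ih d (e + 1) (by omega) (h.congr_mem (by
      rw [show d + 1 - (k + 1) = d - k by omega, show e + (k + 1) = e + 1 + k by omega]))
    exact this.det rfl rfl

theorem run_scan_digits (m : Mem) (w : List Sym) (hw : ∀ s ∈ w, s.IsDigit) (F Fl : List Glyph)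
    (h : Run check y ⟨μ, .scan, { m with F := F, Fl := (toks w).reverse ++ Fl }⟩ T A b) :
    Run check y ⟨μ, .scan, { m with F := toks w ++ F, Fl := Fl }⟩ (T + w.length) A b := by
  refine Run.loop (tr := check) (y := y)
    (fun (d t : List Sym) => ⟨μ, .scan, { m with F := toks t ++ F, Fl := toks d ++ Fl }⟩)
    (fun x => x.IsDigit) (fun x d t hx => ?_) (fun _ _ _ => rfl) w hw [] ?_
  · cases x <;> first | rfl | exact hx.elim
  · simpa using h

/-- The quantifier rank is computed. -/
theorem run_scan (φ : Formula (Fin m)) : ∀ (mm : Mem) (k d e : ℕ) (_ : k ≤ d) (C C' : List Glyph)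
    (_ : (C = [] ∧ C' = []) ∨ C = .flag false :: C') (F Fl : List Glyph) (T : ℕ),
    Run check y ⟨μ, .scan, { mm with
      F := F, Fl := (toks φ.encode).reverse ++ Fl,
      C := C', V := unary (d - k), U := unary (max e φ.quantifierRank + k) }⟩ T A b →
    Run check y ⟨μ, .scan, { mm with
      F := toks φ.encode ++ F, Fl := Fl, C := unary k ++ C, V := unary d, U := unary e }⟩
      (T + 2 * φ.encode.length + k + 1) A b := by
  induction φ with
  | eq x z =>
    intro mm k d e hk C C' hC F Fl T h
    have h₁ := run_scan_digits { mm with C := C', V := unary (d - k), U := unary (e + k) }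
      (binary x ++ Sym.sep :: binary z) (by
        intro s hs
        simp only [List.mem_append, List.mem_cons] at hs
        rcases hs with hs | rfl | hs
        · exact isDigit_of_mem_binary hs
        · trivial
        · exact isDigit_of_mem_binary hs) F (.tok .eq false :: Fl) (h.congr_mem (by
          simp [Formula.encode, Formula.quantifierRank]))
    have h₂ := run_leave { mm with
      F := toks (binary x ++ Sym.sep :: binary z) ++ F, Fl := .tok .eq false :: Fl } k d e hk C C' hC h₁
    refine Run.det' h₂ rfl rfl ?_
    simp [Formula.encode]
    omega
  | edge o x z =>
    intro mm k d e hk C C' hC F Fl T h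
    have h₁ := run_scan_digits { mm with C := C', V := unary (d - k), U := unary (e + k) }
      (binary o ++ Sym.sep :: (binary x ++ Sym.sep :: binary z)) (by
        intro s hs
        simp only [List.mem_append, List.mem_cons] at hs
        rcases hs with hs | rfl | hs | rfl | hs
        · exact isDigit_of_mem_binary hs
        · trivial
        · exact isDigit_of_mem_binary hs
        · trivial
        · exact isDigit_of_mem_binary hs) F (.tok .edge false :: Fl) (h.congr_mem (by
          simp [Formula.encode, Formula.quantifierRank]))
    have h₂ := run_leave { mm with
      F := toks (binary o ++ Sym.sep :: (binary x ++ Sym.sep :: binary z)) ++ F,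
      Fl := .tok .edge false :: Fl } k d e hk C C' hC h₁
    refine Run.det' h₂ rfl rfl ?_
    simp [Formula.encode]
    omega
  | neg φ ih =>
    intro mm k d e hk C C' hC F Fl T h
    have h₁ := ih mm k d e hk C C' hC F (.tok .neg false :: Fl) T (h.congr_mem (by
      simp [Formula.encode, Formula.quantifierRank]))
    refine Run.det' h₁ rfl rfl ?_
    simp [Formula.encode]
  | and φ ψ ih₁ ih₂ | or φ ψ ih₁ ih₂ | imp φ ψ ih₁ ih₂ | iff φ ψ ih₁ ih₂ =>
    intro mm k d e hk C C' hC F Fl T h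
    have h₁ := ih₂ mm k d (max e φ.quantifierRank) hk C C' hC F
      ((toks φ.encode).reverse ++ .tok _ false :: Fl) T (h.congr_mem (by
      simp [Formula.encode, Formula.quantifierRank, max_assoc]; rfl))
    have h₂ := ih₁ mm 0 d e (by omega) (.flag false :: (unary k ++ C)) (unary k ++ C) (.inr rfl)
      (toks ψ.encode ++ F) _ _ h₁
    refine Run.det' (h₂.congr_mem (m' := { mm with
      F := toks (φ.encode ++ ψ.encode) ++ F, Fl := .tok _ false :: Fl,
      C := .flag false :: (unary k ++ C), V := unary d, U := unary e }) (by simp)) rfl rfl ?_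
    simp [Formula.encode]
    omega
  | ex x φ ih | all x φ ih =>
    intro mm k d e hk C C' hC F Fl T h
    have h₁ := ih mm (k + 1) (d + 1) (e - 1) (by omega) C C' hC F
      ((toks (binary x)).reverse ++ .tok _ false :: Fl) T (h.congr_mem (by
      simp only [Formula.encode, Formula.quantifierRank]
      -- The truncated `e - 1` is intended: for `e = 0` the new quantifier raises the maximal depth.
      rw [show max e (φ.quantifierRank + 1) + k = max (e - 1) φ.quantifierRank + (k + 1) by omega,
        show d + 1 - (k + 1) = d - k by omega]
      simp; rfl))
    have h₂ := run_scan_digits { mm with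
        C := unary (k + 1) ++ C, V := unary (d + 1), U := unary (e - 1) } (binary x)
      (fun s => isDigit_of_mem_binary) (toks φ.encode ++ F) (.tok _ false :: Fl) h₁
    refine Run.det' (h₂.congr_mem (m' := { mm with
      F := toks (binary x ++ φ.encode) ++ F, Fl := .tok _ false :: Fl,
      C := one :: (unary k ++ C), V := unary (d + 1), U := unary (e - 1) }) (by
        simp [List.replicate_succ]; rfl)) ?_ rfl ?_
    · cases e <;> rfl
    · simp [Formula.encode]
      omega

abbrev dots (k : ℕ) : List Cd := List.replicate k .dot

/-- Every dot is replaced by `r + 1 = n` dots and one more is added at the end, which is the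
recursion of `room`. -/
theorem run_mulNext (F U : List Glyph) (r : ℕ) (L : ℕ) : ∀ (k : ℕ),
    Run check y ⟨μ, .mul, ⟨F, [], [], unary r, [], unary r, [], [], [], codes (dots (k + L * (r + 1) + 1)),
      [], [], [], [], [], U, []⟩⟩ T A b →
    Run check y ⟨μ, .mulNext, ⟨F, [], [], unary r, [], unary r, [], [], [], codes (dots L),
      codes (dots k), [], [], [], [], U, []⟩⟩ (T + L * (3 * r + 4) + k + 3) A b := by
  induction L with
  | zero =>
    intro k h
    have h₁ := Run.loop (tr := check) (y := y) (T := T + 1) (A := A) (b := b)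
      (fun (d t : List Glyph) => ⟨μ, .mulEnd, ⟨F, [], [], unary r, [], unary r, [], [], [], d, t, [],
        [], [], [], U, []⟩⟩)
      (fun _ => True) (fun _ _ _ _ => rfl) (fun _ _ _ => rfl) (codes (dots (k + 1)))
      (fun _ _ => trivial) [] (h.det (by simp; rfl) rfl)
    have h₂ : Run check y ⟨μ, .mulNext, ⟨F, [], [], unary r, [], unary r, [], [], [], codes (dots 0),
      codes (dots k), [], [], [], [], U, []⟩⟩ _ A b := h₁.det rfl rfl
    exact h₂.mono (by simp; omega) le_rfl Iff.rfl
  | succ L ih =>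
    intro k h
    have h₀ := ih (k + (r + 1)) (h.congr_mem (by
      rw [show k + (L + 1) * (r + 1) + 1 = k + (r + 1) + L * (r + 1) + 1 by ring]))
    have h₁ := Run.loop (tr := check) (y := y) (A := A) (b := b)
      (fun (d t : List Glyph) => ⟨μ, .mulBack, ⟨F, [], [], d, t, unary r, [], [], [], codes (dots L),
        codes (dots (k + (r + 1))), [], [], [], [], U, []⟩⟩)
      (fun _ => True) (fun _ _ _ _ => rfl) (fun _ _ _ => rfl) (unary r)
      (fun _ _ => trivial) [] (h₀.det (by simp; rfl) rfl)
    have h₂ := Run.loop (tr := check) (y := y) (A := A) (b := b)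
      (fun (d t : List Glyph) => ⟨μ, .mulRow, ⟨F, [], [], t, d, unary r, [], [], [], codes (dots L),
        d.map (fun _ => .code .dot) ++ codes (dots (k + 1)), [], [], [], [], U, []⟩⟩)
      (fun _ => True) (fun _ _ _ _ => rfl) (fun _ _ _ => rfl) (unary r)
      (fun _ _ => trivial) [] (h₁.det (by
        simp only [List.append_nil, List.reverse_replicate, List.map_replicate,
          List.replicate_append_replicate, show r + (k + 1) = k + (r + 1) by omega]
        rfl) rfl)
    have h₃ : Run check y ⟨μ, .mulNext, ⟨F, [], [], unary r, [], unary r, [], [], [], codes (dots (L + 1)),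
      codes (dots k), [], [], [], [], U, []⟩⟩ _ A b := h₂.det rfl rfl
    refine h₃.mono ?_ le_rfl Iff.rfl
    rw [add_mul]
    simp
    omega

theorem room_le_succ (hn : 0 < n) (k : ℕ) : room n k ≤ room n (k + 1) := by
  rw [room]
  have := Nat.mul_le_mul_right (room n k) hn
  omega

theorem room_mono (hn : 0 < n) {i j : ℕ} (h : i ≤ j) : room n i ≤ room n j :=
  monotone_nat_of_le_succ (room_le_succ hn) h

theorem run_mul (hn : 0 < n) (F : List Glyph) (k : ℕ) : ∀ (i : ℕ),
    Run check y ⟨μ, .toEnd true, frame n F [] (codes (dots (room n (i + k)))) []⟩ T A b →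
    Run check y ⟨μ, .mul, { frame n F [] (codes (dots (room n i))) [] with U := unary k }⟩
      (T + k * (4 * room n (i + k) + 4) + 1) A b := by
  induction k with
  | zero =>
    intro i h
    have h₁ : Run check y ⟨μ, .mul, { frame n F [] (codes (dots (room n i))) [] with U := [] }⟩ _ A b :=
      h.det rfl rfl
    exact h₁.mono (by omega) le_rfl Iff.rfl
  | succ k ih =>
    intro i h
    have h₁ := ih (i + 1) (by rwa [show i + 1 + k = i + (k + 1) by omega])
    have h₂ := run_mulNext F (unary k) (n - 1) (room n i) 0 (h₁.congr_mem (by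
      rw [show n - 1 + 1 = n by omega, room, Nat.zero_add, mul_comm]))
    have h₃ : Run check y ⟨μ, .mul, { frame n F [] (codes (dots (room n i))) [] with
      U := unary (k + 1) }⟩ _ A b := h₂.det rfl rfl
    refine h₃.mono ?_ le_rfl Iff.rfl
    have e₁ : room n (i + 1) ≤ room n (i + (k + 1)) := room_mono hn (by omega)
    have e₂ : room n i * (3 * (n - 1) + 4) ≤ 4 * room n (i + 1) := by
      rw [room]
      have := Nat.mul_le_mul_left (room n i) (show 3 * (n - 1) + 4 ≤ 4 * n by omega)
      refine this.trans ?_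
      rw [show room n i * (4 * n) = 4 * (n * room n i) by ring]
      omega
    rw [show i + 1 + k = i + (k + 1) by omega, add_mul]
    omega

/-- The first phase of the computation. -/
theorem run_setup (hn : 0 < n) (φ : Formula (Fin m))
    (h : Run check y ⟨false, .toEnd true, frame n (toks φ.encode ++ [.tok .mark false]) []
      (codes (dots (room n φ.quantifierRank))) []⟩ T A b) :
    Run check y ⟨false, .scan, inputMem (inputWord n φ)⟩
      (T + φ.quantifierRank * (4 * room n φ.quantifierRank + 4) + 3 * φ.encode.length + n + 8) A b := by
  have h₁ := run_mul hn (toks φ.encode ++ [.tok .mark false]) φ.quantifierRank 0 (by rwa [Nat.zero_add])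
  have h₂ : Run check y ⟨false, .init, { frame n (toks φ.encode ++ [.tok .mark false]) []
      [.code .dot] [] with U := unary φ.quantifierRank }⟩ _ A b := h₁.det rfl rfl
  have h₃ := Run.loop (tr := check) (y := y) (A := A) (b := b)
    (fun (d t : List Glyph) => ⟨false, .unread, { frame n d t [] [] with
      U := unary φ.quantifierRank }⟩)
    (fun _ => True) (fun _ _ _ _ => rfl) (fun _ _ _ => rfl)
    (.tok .mark false :: (toks φ.encode).reverse) (fun _ _ => trivial) [] (h₂.det (by simp; rfl) rfl)
  have h₄ := Run.loop (tr := check) (y := y) (A := A) (b := b)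
    (fun (d t : List Glyph) => ⟨false, .unary, ⟨t, [], .tok .mark false :: (toks φ.encode).reverse,
      d.map fun _ => one, [], d.map fun _ => one, [], [], [], [], [], [], [], [], [],
      unary φ.quantifierRank, []⟩⟩)
    (fun _ => True) (fun _ _ _ _ => rfl) (fun _ _ _ => rfl)
    (toks (List.replicate (n - 1) (.bit true))) (fun _ _ => trivial) [] (h₃.det (by simp; rfl) rfl)
  have h₅ : Run check y ⟨false, .table, ⟨toks (List.replicate n (.bit true)), [],
      .tok .mark false :: (toks φ.encode).reverse, [], [], [], [], [], [], [], [], [], [], [], [],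
      unary φ.quantifierRank, []⟩⟩ _ A b := h₄.det (by
    obtain ⟨k, rfl⟩ : ∃ k, n = k + 1 := ⟨n - 1, by omega⟩
    rfl) rfl
  have h₆ := run_scan φ ⟨[], [], [], [], [], [], [], [], [], [], [], [], [], [], [], [], []⟩ 0 0 0 le_rfl
    [] [] (.inl ⟨rfl, rfl⟩) (.tok .mark false :: toks (List.replicate n (.bit true))) [] _
    (h₅.det (by simp; rfl) rfl)
  refine (h₆.congr_mem (by simp [inputMem, inputWord])).mono ?_ le_rfl Iff.rfl
  simp
  omega

end

end WordGraph

/-! ### Time and alternation bounds. -/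

namespace WordGraph

section
variable {m n : ℕ}

/-- Every atom contains a variable, so a sentence has rank at least one. This absorbs the additive
constant in the number of alternations and gives `n ≤ N ^ l` for the time. -/
theorem Formula.freeVars_nonempty {φ : Formula (Fin m)} (h : φ.quantifierRank = 0) :
    φ.freeVars.Nonempty := by
  induction φ with
  | eq x z => exact ⟨x, by simp [freeVars]⟩
  | edge o x z => exact ⟨x, by simp [freeVars]⟩
  | neg φ ih => exact ih h
  | and φ ψ ih _ | or φ ψ ih _ | imp φ ψ ih _ | iff φ ψ ih _ =>
    rw [quantifierRank] at h
    exact (ih (by omega)).mono Finset.subset_union_left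
  | ex x φ _ | all x φ _ => simp [quantifierRank] at h

theorem Formula.quantifierRank_le_size (φ : Formula (Fin m)) : φ.quantifierRank ≤ φ.encode.length := by
  induction φ with
  | eq x z => simp [quantifierRank]
  | edge o x z => simp [quantifierRank]
  | neg φ ih => simp [quantifierRank, encode]; omega
  | and φ ψ _ _ | or φ ψ _ _ | imp φ ψ _ _ | iff φ ψ _ _ =>
    simp [quantifierRank, encode]
    omega
  | ex x φ _ | all x φ _ =>
    simp [quantifierRank, encode]
    omega

/-- An old separation becomes one reset, a block admits at most `n - 1` increments, and halting adds
one separation. The letter `p` already reached is deducted from the increments of the current block.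
-/
theorem Ref.seps_le {s c : List Cd} {p : ℕ} {h : Bool} (r : Ref n s p h c) (hp : p < n) :
    seps c + p ≤ n * seps s + n := by
  induction r with
  | dot _ ih => exact ih hp
  | inc hp' _ ih =>
    have := ih hp'
    simp only [seps] at *
    omega
  | @halt s p =>
    simp only [seps]
    have := Nat.mul_le_mul_right (seps s) (show 1 ≤ n by omega)
    omega
  | @reset x s c p h hx _ ih =>
    have := ih (by omega)
    have e : seps (x :: s) = seps s + 1 := by cases x <;> first | rfl | exact absurd rfl hx
    rw [e, mul_add]
    simp only [seps]
    omega
  | last => simp only [seps]; omega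

/-- A refinement keeps all dots, even those behind a halt; only the separations change. -/
theorem Ref.length_add {s c : List Cd} {p : ℕ} {h : Bool} (r : Ref n s p h c) :
    c.length + seps s = s.length + seps c := by
  induction r with
  | dot _ ih => simp only [seps, List.length_cons]; omega
  | inc hp' _ ih => simp only [seps, List.length_cons] at *; omega
  | halt => simp only [seps, List.length_cons]; omega
  | @reset x s c p h hx _ ih =>
    have e : seps (x :: s) = seps s + 1 := by cases x <;> first | rfl | exact absurd rfl hx
    rw [e]
    simp only [seps, List.length_cons]
    omega
  | last => rfl

theorem room_le {N : ℕ} (hN : 2 ≤ N) (hn : n ≤ N) (k : ℕ) : room n k + 1 ≤ 3 * N ^ k := by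
  induction k with
  | zero => simp [room]
  | succ k ih =>
    rw [room, pow_succ]
    have e₁ := Nat.mul_le_mul_right (room n k) hn
    have e₂ := Nat.mul_le_mul_left N ih
    have e₃ : N * (3 * N ^ k) = 3 * (N ^ k * N) := by ring
    rw [mul_add, e₃] at e₂
    omega

theorem le_pow_self' {N : ℕ} (hN : 2 ≤ N) (k : ℕ) : k + 1 ≤ N ^ k := by
  calc k + 1 ≤ 2 ^ k := Nat.lt_two_pow_self
    _ ≤ N ^ k := Nat.pow_le_pow_left hN k

/-- The positions of the game for a formula of quantifier rank `l` and length `Φ`. -/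
def Position (n l Φ : ℕ) (j : ℕ) (s : List Cd) (es : List (ℕ × List Cd)) : Prop :=
  s.length = room n l + seps s ∧ seps s + 2 ≤ 2 * max n 2 ^ j ∧ (∀ e ∈ es, Valid n e.2 0) ∧
    (records es).length ≤ j * (5 * max n 2 ^ l + 1 + Φ)

theorem budget (hn : 0 < n) (l Φ : ℕ) :
    Budget n l Φ (31 * max n 2 ^ l + 6 * Φ + 26 + n) (6 * Φ + 14 * (l * (5 * max n 2 ^ l + 1 + Φ)) + 22 * n + 40)
      (Position n l Φ) := by
  set N := max n 2 with hN
  have hN2 : 2 ≤ N := by omega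
  have hnN : n ≤ N := by omega
  have hpow : ∀ j, j ≤ l → N ^ j ≤ N ^ l := fun j hj => Nat.pow_le_pow_right (by omega) hj
  have hroom := room_le hN2 hnN l
  refine ⟨hn, fun j s es h => h.2.2.1, ?_, ?_, ?_⟩
  · rintro j s es x c ⟨h₁, h₂, h₃, h₄⟩ hj r hx
    have e₁ := r.seps_le hn
    have e₂ := r.length_add
    rw [← hN] at h₂ h₄
    -- The summand `2` makes the bound multiplicative: `seps c ≤ n * seps s + n` gives `seps c + 2 ≤
    -- N * (seps s + 2)`, because `n + 2 ≤ 2 * N`.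
    have e₃ : seps c + 2 ≤ 2 * N ^ (j + 1) := by
      have := Nat.mul_le_mul_left N h₂
      have e : N * (2 * N ^ j) = 2 * N ^ (j + 1) := by ring
      have e' : n * seps s ≤ N * seps s := Nat.mul_le_mul_right _ hnN
      rw [e, mul_add] at this
      omega
    refine ⟨by omega, e₃, ?_, ?_⟩
    · intro e he
      rcases List.mem_cons.1 he with rfl | he
      · exact r.valid
      · exact h₃ e he
    · have e₄ := hpow (j + 1) hj
      rw [← hN, add_mul, one_mul]
      simp only [records, List.map_cons, List.flatten_cons, List.length_append, record,
        List.length_cons, List.length_map, List.length_reverse] at h₄ ⊢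
      omega
  · rintro j s es ⟨h₁, h₂, h₃, h₄⟩ hj
    have := Nat.mul_le_mul_right (5 * N ^ l + 1 + Φ) hj
    rw [← hN] at h₄
    omega
  · rintro j s es ⟨h₁, h₂, h₃, h₄⟩ hj
    rw [← hN] at h₂
    have e₁ := hpow j (by omega)
    have e₂ := hpow (j + 1) hj
    -- Winding back costs a factor `n` on the separations of the previous code. There are fewer than
    -- `2 * N ^ j` of them and `j + 1 ≤ l`, so the product stays below `2 * N ^ l`.
    have e₃ : n * seps s ≤ N * (2 * N ^ j - 2) := Nat.mul_le_mul hnN (by omega)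
    have e₄ : N * (2 * N ^ j - 2) ≤ 2 * N ^ (j + 1) - 2 * N := by
      rw [Nat.mul_sub, pow_succ]
      apply le_of_eq
      congr 1
      · ring
      · ring
    have e₅ : 4 * n * seps s = 4 * (n * seps s) := by ring
    have e₆ : 2 * N ≤ 2 * N ^ (j + 1) := by
      have : N ^ 1 ≤ N ^ (j + 1) := Nat.pow_le_pow_right (by omega) (by omega)
      rw [pow_one] at this
      omega
    rw [e₅]
    omega

theorem run_check (G : LabelledGraph (Fin n) (Fin m)) (hn : 1 ≤ n) (φ : Formula (Fin m))
    (hφ : φ.IsSentence) :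
    Run check (adjacencyTable G) ⟨false, .scan, inputMem (inputWord n φ)⟩
      (500 * (max n 2 ^ φ.quantifierRank * φ.size)) (7 * φ.quantifierRank)
      (BSat n (edges G) φ (dots (room n φ.quantifierRank)) []) := by
  set l := φ.quantifierRank with hl
  set Φ := φ.encode.length with hΦ
  set N := max n 2 with hN
  have hl1 : 1 ≤ l := by
    by_contra h
    have := Formula.freeVars_nonempty (φ := φ) (by omega)
    rw [hφ] at this
    simp at this
  have hlΦ : l ≤ Φ := φ.quantifierRank_le_size
  have h₁ := walks (G := G) (budget hn l Φ) (by omega) φ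
  have hI : Position n l Φ 0 (dots (room n l)) [] := by
    have : ∀ k, seps (dots k) = 0 := fun k => by
      induction k with
      | zero => rfl
      | succ k ih => exact ih
    refine ⟨?_, ?_, ?_, ?_⟩ <;> simp [this]
  have h₂ := run_claimed (by omega) h₁ true 0 (dots (room n l)) [] (φ.encode.map (·, false)) [] [] false
    [] [] hI (by omega) (by simp [Function.comp_def]) rfl (by simp) (by simp) (by rw [hφ]; simp)
    (by simp [hΦ])
  have h₃ := run_setup hn φ (h₂.congr_mem (by simp; rfl))
  refine h₃.mono ?_ (by omega) (by simp)
  rw [Formula.size, ← hΦ, ← hl, ← hN, List.length_map, ← hΦ]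
  have hNl := le_pow_self' (show 2 ≤ N by omega) l
  have hroom := room_le (show 2 ≤ N by omega) (show n ≤ N by omega) l
  have hnX : n ≤ N ^ l := by
    have := Nat.pow_le_pow_right (n := N) (by omega) hl1
    rw [pow_one] at this
    omega
  generalize N ^ l = X at *
  generalize room n l = R at *
  -- The sum over the `l` quantifiers is paid for by `l ≤ Φ`, and where `Φ` is already present by `l
  -- ≤ X`; every term becomes a multiple of `X * Φ`.
  have e₁ : l * X ≤ X * Φ := by rw [mul_comm]; exact Nat.mul_le_mul_left _ hlΦ
  have e₂ : l * Φ ≤ X * Φ := Nat.mul_le_mul_right _ (by omega)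
  have e₃ : X ≤ X * Φ := Nat.le_mul_of_pos_right _ (by omega)
  have e₄ : Φ ≤ X * Φ := Nat.le_mul_of_pos_left _ (by omega)
  have e₅ : l * n ≤ X * Φ := (Nat.mul_le_mul_left _ hnX).trans e₁
  have e₆ : l * R ≤ 3 * (X * Φ) := by
    have := Nat.mul_le_mul_left l (show R ≤ 3 * X by omega)
    rw [show l * (3 * X) = 3 * (l * X) by ring] at this
    omega
  have e₇ : l * (31 * X + 6 * Φ + 26 + n) = 31 * (l * X) + 6 * (l * Φ) + 26 * l + l * n := by ring
  have e₈ : l * (5 * X + 1 + Φ) = 5 * (l * X) + l + l * Φ := by ring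
  have e₉ : l * (4 * R + 4) = 4 * (l * R) + 4 * l := by ring
  rw [e₇, e₈, e₉]
  omega

end

end WordGraph

/-! ### Multisets counted up to a threshold. -/

namespace WordGraph

section
open scoped Classical

variable {α β : Type} {t n : ℕ}

/-- Each element occurs equally often in both lists, or at least `t` times in both. -/
def Similar (t : ℕ) (l l' : List α) : Prop :=
  ∀ c, l.count c = l'.count c ∨ (t ≤ l.count c ∧ t ≤ l'.count c)

theorem Similar.symm {l l' : List α} (h : Similar t l l') : Similar t l' l := fun c =>
  (h c).imp Eq.symm And.symm

theorem Similar.mono {s : ℕ} {l l' : List α} (h : Similar t l l') (hs : s ≤ t) : Similar s l l' :=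
  fun c => (h c).imp_right fun h => ⟨hs.trans h.1, hs.trans h.2⟩

theorem Similar.mem_iff {l l' : List α} (h : Similar t l l') (ht : 1 ≤ t) (c : α) :
    c ∈ l ↔ c ∈ l' := by
  rw [← List.count_pos_iff, ← List.count_pos_iff]
  have := h c
  omega

theorem Similar.length {l l' : List α} (h : Similar t l l') :
    l.length = l'.length ∨ (t ≤ l.length ∧ t ≤ l'.length) := by
  by_cases H : ∃ c, t ≤ l.count c ∧ t ≤ l'.count c
  · obtain ⟨c, h₁, h₂⟩ := H
    exact .inr ⟨h₁.trans List.count_le_length, h₂.trans List.count_le_length⟩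
  · left
    apply List.Perm.length_eq
    rw [List.perm_iff_count]
    intro c
    exact (h c).resolve_right fun h => H ⟨c, h⟩

/-- Either some element over `d` is abundant in both lists, and so is `d` in the images, or the
fibres over `d` agree as multisets. -/
theorem Similar.map {l l' : List α} (h : Similar t l l') (f : α → β) :
    Similar t (l.map f) (l'.map f) := by
  intro d
  by_cases H : ∃ c, f c = d ∧ t ≤ l.count c ∧ t ≤ l'.count c
  · obtain ⟨c, rfl, h₁, h₂⟩ := H
    exact .inr ⟨h₁.trans List.count_le_count_map, h₂.trans List.count_le_count_map⟩
  · left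
    have : (l.filter fun c => f c = d).Perm (l'.filter fun c => f c = d) := by
      rw [List.perm_iff_count]
      intro c
      by_cases hc : f c = d
      · rw [List.count_filter (by simpa using hc), List.count_filter (by simpa using hc)]
        exact (h c).resolve_right fun h => H ⟨c, hc, h⟩
      · rw [List.count_eq_zero_of_not_mem (by simp [hc]), List.count_eq_zero_of_not_mem (by simp [hc])]
    have := this.length_eq
    rw [← List.countP_eq_length_filter, ← List.countP_eq_length_filter] at this
    rw [List.count_eq_countP, List.count_eq_countP, List.countP_map, List.countP_map]
    convert this using 2 <;> (ext c; simp only [Function.comp_apply, beq_eq_decide])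

/-- Counts up to two decide whether a copy of `d` remains after one has been removed. This is why
the last threshold is 2. -/
theorem Similar.exists_perm_cons {l l' : List α} (h : Similar 2 l l') {d : α} {r : List α}
    (hr : l.Perm (d :: r)) : ∃ r', l'.Perm (d :: r') ∧ ∀ c, c ∈ r ↔ c ∈ r' := by
  have hd : d ∈ l' := (h.mem_iff (by omega) d).1 (hr.mem_iff.2 List.mem_cons_self)
  refine ⟨l'.erase d, List.perm_cons_erase hd, fun c => ?_⟩
  have h₁ := h c
  rw [hr.count_eq, (List.perm_cons_erase hd).count_eq] at h₁
  rw [← List.count_pos_iff, ← List.count_pos_iff]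
  simp only [List.count_cons] at h₁
  split at h₁ <;> omega

/-- If both totals reach `n * t`, some letter `q` occurs at least `t` times. The other letters get
their counts cut down to `t`, and `q` takes the rest, which is at least `n * t - (n - 1) * t = t`.
-/
theorem exists_target (hn : 1 ≤ n) (ht : 1 ≤ t) (f : ℕ → ℕ) {K : ℕ}
    (h : ∑ p ∈ Finset.range n, f p = K ∨ (n * t ≤ ∑ p ∈ Finset.range n, f p ∧ n * t ≤ K)) :
    ∃ g : ℕ → ℕ, ∑ p ∈ Finset.range n, g p = K ∧ ∀ p, f p = g p ∨ (t ≤ f p ∧ t ≤ g p) := by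
  rcases h with h | ⟨h, hK⟩
  · exact ⟨f, h, fun _ => .inl rfl⟩
  obtain ⟨q, hq, hqt⟩ : ∃ q ∈ Finset.range n, t ≤ f q := by
    by_contra! H
    have : ∑ p ∈ Finset.range n, f p < ∑ p ∈ Finset.range n, t :=
      Finset.sum_lt_sum_of_nonempty (by simpa using by omega) H
    simp at this
    omega
  have hs : ∑ p ∈ (Finset.range n).erase q, min (f p) t ≤ (n - 1) * t := by
    refine (Finset.sum_le_card_nsmul _ _ t fun p _ => min_le_right _ _).trans ?_
    simp [Finset.card_erase_of_mem hq]
  have hnt : n * t = (n - 1) * t + t := by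
    obtain ⟨k, rfl⟩ : ∃ k, n = k + 1 := ⟨n - 1, by omega⟩
    simp [add_mul]
  refine ⟨Function.update (fun p => min (f p) t) q
    (K - ∑ p ∈ (Finset.range n).erase q, min (f p) t), ?_, fun p => ?_⟩
  · rw [← Finset.add_sum_erase _ _ hq, Function.update_self,
      Finset.sum_congr rfl fun p hp => Function.update_of_ne (Finset.ne_of_mem_erase hp) ..]
    omega
  · by_cases hp : p = q
    · subst hp
      rw [Function.update_self]
      omega
    · rw [Function.update_of_ne hp]
      omega

theorem sum_count_zip {l : List α} {w : List ℕ} (hl : w.length = l.length) (hw : ∀ p ∈ w, p < n) (c : α) :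
    ∑ p ∈ Finset.range n, (l.zip w).count (c, p) = l.count c := by
  induction l generalizing w with
  | nil => simp
  | cons a l ih =>
    cases w with
    | nil => simp at hl
    | cons q w =>
      have hq := hw q List.mem_cons_self
      simp only [List.zip_cons_cons, List.count_cons, Finset.sum_add_distrib]
      rw [ih (by simpa using hl) fun p hp => hw p (List.mem_cons_of_mem _ hp)]
      congr 1
      by_cases ha : a = c
      · simp [ha, hq]
      · simp [ha]

/-- A word with given numbers of letters above each column, sorted above equal columns. -/
theorem exists_word (l : List α) : ∀ g : α → ℕ → ℕ,
    (∀ c, ∑ p ∈ Finset.range n, g c p = l.count c) →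
    ∃ w : List ℕ, w.length = l.length ∧ (∀ p ∈ w, p < n) ∧
      (∀ c, ∀ p < n, (l.zip w).count (c, p) = g c p) ∧
      ∀ i c a b, l[i]? = some c → l[i + 1]? = some c → w[i]? = some a → w[i + 1]? = some b → a ≤ b := by
  induction l with
  | nil =>
    intro g hg
    refine ⟨[], rfl, by simp, ?_, by simp⟩
    intro c p hp
    have := hg c
    simp only [List.count_nil, Finset.sum_eq_zero_iff, Finset.mem_range] at this
    simp [this p hp]
  | cons c₀ l ih =>
    intro g hg
    have hex : ∃ p, p < n ∧ 0 < g c₀ p := by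
      by_contra! H
      have := hg c₀
      rw [Finset.sum_eq_zero fun p hp => by have := H p (Finset.mem_range.1 hp); omega] at this
      simp at this
    -- Greedy choice: above a column stands the least letter still owed to it. The next equal column
    -- can only receive a letter that is at least as large.
    set q := Nat.find hex with hq
    obtain ⟨hqn, hgq⟩ := Nat.find_spec hex
    rw [← hq] at hqn hgq
    obtain ⟨w, h₁, h₂, h₃, h₄⟩ := ih (Function.update g c₀ (Function.update (g c₀) q (g c₀ q - 1))) (by
      intro c
      by_cases hc : c = c₀
      · subst hc
        have e := hg c
        rw [← Finset.add_sum_erase _ _ (Finset.mem_range.2 hqn)] at e ⊢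
        rw [Function.update_self, Function.update_self,
          Finset.sum_congr rfl fun p hp => Function.update_of_ne (Finset.ne_of_mem_erase hp) ..]
        simp only [List.count_cons_self] at e
        omega
      · rw [Function.update_of_ne hc, hg, List.count_cons_of_ne (Ne.symm hc)])
    refine ⟨q :: w, by simp [h₁], ?_, ?_, ?_⟩
    · simpa using ⟨hqn, h₂⟩
    · intro c p hp
      rw [List.zip_cons_cons, List.count_cons, h₃ c p hp]
      by_cases hc : c = c₀
      · subst hc
        rw [Function.update_self]
        by_cases hpq : p = q
        · rw [hpq, Function.update_self]
          simp
          omega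
        · rw [Function.update_of_ne hpq]
          simp [Ne.symm hpq]
      · rw [Function.update_of_ne hc]
        simp [Ne.symm hc]
    · rintro (_ | i) c a b hi hi' ha hb
      · simp only [List.getElem?_cons_zero, Option.some.injEq, List.getElem?_cons_succ] at hi hi' ha hb
        subst hi ha
        have hbn : b < n := h₂ b (List.mem_of_getElem? hb)
        have : (c₀, b) ∈ l.zip w := by
          apply List.mem_of_getElem? (i := 0)
          rw [List.getElem?_zip_eq_some]
          exact ⟨hi', hb⟩
        rw [← List.count_pos_iff, h₃ _ _ hbn, Function.update_self] at this
        by_cases hbq : b = q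
        · exact hbq.ge
        · rw [Function.update_of_ne hbq] at this
          exact Nat.find_min' hex ⟨hbn, this⟩
      · exact h₄ i c a b hi hi' ha hb

theorem similar_iff [b : BEq α] [LawfulBEq α] {l l' : List α} :
    Similar t l l' ↔ ∀ c, l.count c = l'.count c ∨ (t ≤ l.count c ∧ t ≤ l'.count c) := by
  have key : ∀ (l : List α) (c : α), @List.count α instBEqOfDecidableEq c l = @List.count α b c l := by
    intro l c
    rw [@List.count_eq_countP α instBEqOfDecidableEq, @List.count_eq_countP α b]
    congr 1
    ext x
    rw [Bool.eq_iff_iff]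
    exact (@beq_iff_eq α instBEqOfDecidableEq _ x c).trans (@beq_iff_eq α b _ x c).symm
  simp only [Similar, key]

/-- A word distributes each column over `n` letters, so one round divides the threshold by `n`. The
answer is free up to the order within equal columns, and sortedness is obtained at no cost. -/
theorem Similar.zip (hn : 1 ≤ n) (ht : 1 ≤ t) {l l' : List α} (h : Similar (n * t) l l') {w : List ℕ}
    (hl : w.length = l.length) (hw : ∀ p ∈ w, p < n) :
    ∃ w' : List ℕ, w'.length = l'.length ∧ (∀ p ∈ w', p < n) ∧ Similar t (l.zip w) (l'.zip w') ∧
      ∀ i c a b, l'[i]? = some c → l'[i + 1]? = some c → w'[i]? = some a → w'[i + 1]? = some b →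
        a ≤ b := by
  have : ∀ c, ∃ g : ℕ → ℕ, ∑ p ∈ Finset.range n, g p = l'.count c ∧
      ∀ p, (l.zip w).count (c, p) = g p ∨ (t ≤ (l.zip w).count (c, p) ∧ t ≤ g p) := fun c =>
    exists_target hn ht _ (by rw [sum_count_zip hl hw]; exact h c)
  choose g hg hg' using this
  obtain ⟨w', h₁, h₂, h₃, h₄⟩ := exists_word (n := n) l' g hg
  refine ⟨w', h₁, h₂, ?_, h₄⟩
  rw [similar_iff]
  rintro ⟨c, p⟩
  by_cases hp : p < n
  · have := hg' c p
    rwa [← h₃ c p hp] at this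
  · left
    rw [List.count_eq_zero_of_not_mem fun h => hp (hw p (List.of_mem_zip h).2),
      List.count_eq_zero_of_not_mem fun h => hp (h₂ p (List.of_mem_zip h).2)]

end

/-! ### Atoms -/

theorem eq_iff_zip {u v : List ℕ} : u = v ↔ u.length = v.length ∧ ∀ d ∈ u.zip v, d.1 = d.2 := by
  induction u generalizing v with
  | nil => cases v <;> simp
  | cons p u ih =>
    cases v with
    | nil => simp
    | cons q v =>
      rw [List.cons.injEq, ih]
      simp only [List.length_cons, List.zip_cons_cons, List.mem_cons, forall_eq_or_imp,
        Nat.add_right_cancel_iff]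
      tauto

/-- The position of the changed letter is irrelevant: an edge is a property of the multiset of
letter pairs. The pair `d` itself may be diagonal. -/
theorem changes_iff_zip {E : ℕ → ℕ → Prop} {u v : List ℕ} : Changes E u v ↔ u.length = v.length ∧
    ∃ d r, (u.zip v).Perm (d :: r) ∧ E d.1 d.2 ∧ ∀ d' ∈ r, d'.1 = d'.2 := by
  induction u generalizing v with
  | nil => simp [Changes]
  | cons p u ih =>
    cases v with
    | nil => simp [Changes]
    | cons q v =>
      simp only [Changes, ih, List.length_cons, List.zip_cons_cons, Nat.add_right_cancel_iff]
      constructor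
      · rintro (⟨h, rfl⟩ | ⟨rfl, hl, d, r, hp, hE, hr⟩)
        · exact ⟨rfl, (p, q), _, .rfl, h, (eq_iff_zip.1 rfl).2⟩
        · refine ⟨hl, d, (p, p) :: r, ?_, hE, ?_⟩
          · exact (hp.cons _).trans (.swap _ _ _)
          · simpa using hr
      · rintro ⟨hl, d, r, hp, hE, hr⟩
        rcases List.mem_cons.1 (hp.mem_iff.1 List.mem_cons_self) with h | h
        · subst h
          have hp' := List.Perm.cons_inv hp
          exact .inl ⟨hE, eq_iff_zip.2 ⟨hl, fun d' hd' => hr d' (hp'.mem_iff.1 hd')⟩⟩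
        · refine .inr ⟨hr _ h, hl, d, r.erase (p, q), ?_, hE, fun d' hd' => hr d' (List.mem_of_mem_erase hd')⟩
          apply List.Perm.cons_inv (a := (p, q))
          exact hp.trans (((List.perm_cons_erase h).cons d).trans (.swap _ _ _))

theorem Similar.eq_iff {u v u' v' : List ℕ} (h : Similar 2 (u.zip v) (u'.zip v'))
    (hl : u.length = v.length) (hl' : u'.length = v'.length) : u = v ↔ u' = v' := by
  rw [eq_iff_zip, eq_iff_zip]
  simp only [hl, hl', true_and, h.mem_iff (by omega)]

theorem Similar.changes {E : ℕ → ℕ → Prop} {u v u' v' : List ℕ} (h : Similar 2 (u.zip v) (u'.zip v'))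
    (hl' : u'.length = v'.length) (hc : Changes E u v) : Changes E u' v' := by
  rw [changes_iff_zip] at hc ⊢
  obtain ⟨-, d, r, hp, hE, hr⟩ := hc
  obtain ⟨r', hp', hm⟩ := h.exists_perm_cons hp
  exact ⟨hl', d, r', hp', hE, fun d' hd' => hr d' ((hm d').2 hd')⟩

end WordGraph

namespace WordGraph

open Function (update)

/-! ### Assignments of words -/

/-- The columns of the words of length `K`. -/
def cols (e : ℕ → List ℕ) (K : ℕ) : List (ℕ → Option ℕ) :=
  (List.range K).map fun i z => if (e z).length = K then (e z)[i]? else none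

theorem length_cols (e : ℕ → List ℕ) (K : ℕ) : (cols e K).length = K := by simp [cols]

theorem cols_erase (e : ℕ → List ℕ) (v K : ℕ) :
    cols (update e v []) K = (cols e K).map fun c => update c v none := by
  simp only [cols, List.map_map]
  apply List.map_congr_left
  intro i _
  funext z
  by_cases hz : z = v
  · subst hz; simp
  · simp [hz]

theorem cols_update (e : ℕ → List ℕ) (v : ℕ) (w : List ℕ) :
    cols (update e v w) w.length =
      ((cols e w.length).zip w).map fun d => update d.1 v (some d.2) := by
  apply List.ext_getElem
  · simp [cols]
  intro i h₁ h₂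
  have hi : i < w.length := by simpa [cols] using h₁
  simp only [cols, List.getElem_map, List.getElem_range, List.getElem_zip]
  funext z
  by_cases hz : z = v
  · subst hz; simp [hi]
  · simp [hz]

theorem cols_update_of_ne (e : ℕ → List ℕ) (v : ℕ) (hv : e v = []) (w : List ℕ) {K : ℕ}
    (hK : K ≠ w.length) : cols (update e v w) K = cols e K := by
  simp only [cols]
  apply List.map_congr_left
  intro i _
  funext z
  by_cases hz : z = v
  · subst hz; simp [hv, hK.symm]
  · simp [hz]

theorem cols_fresh {e : ℕ → List ℕ} {K : ℕ} (h : ∀ z, (e z).length ≠ K) :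
    cols e K = List.replicate K fun _ => none := by
  simp [cols, h]

/-- The words of two assignments agree in lengths and columns, counted up to `t`. -/
structure Sim (t : ℕ) (e e' : ℕ → List ℕ) : Prop where
  pattern : ∀ x z, (e x).length = (e z).length ↔ (e' x).length = (e' z).length
  similar : ∀ x, Similar t (cols e (e x).length) (cols e' (e' x).length)

section
variable {t n : ℕ} {e e' : ℕ → List ℕ}

theorem Sim.symm (h : Sim t e e') : Sim t e' e :=
  ⟨fun x z => (h.pattern x z).symm, fun x => (h.similar x).symm⟩

theorem Sim.length (h : Sim t e e') (x : ℕ) :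
    (e x).length = (e' x).length ∨ (t ≤ (e x).length ∧ t ≤ (e' x).length) := by
  have := (h.similar x).length
  rwa [length_cols, length_cols] at this

/-- The empty word means "unassigned", and a variable that is quantified again is first erased. With
`t ≥ 1` the length `0` is recognised on both sides, so the erased variable causes no discrepancy. -/
theorem Sim.erase (ht : 1 ≤ t) (h : Sim t e e') (v : ℕ) : Sim t (update e v []) (update e' v []) := by
  constructor
  · intro x z
    have h₁ := h.length x
    have h₂ := h.length z
    by_cases hx : x = v <;> by_cases hz : z = v <;> simp only [hx, hz, Function.update_self, ne_eq,
      not_false_eq_true, Function.update_of_ne, List.length_nil, h.pattern]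
    · omega
    · omega
  · intro x
    rw [cols_erase, cols_erase]
    by_cases hx : x = v
    · subst hx
      simp [cols, Similar]
    · rw [Function.update_of_ne hx, Function.update_of_ne hx]
      exact (h.similar x).map _

theorem Sim.zip (h : Sim t e e') {x z : ℕ} (hl : (e x).length = (e z).length) :
    Similar t ((e x).zip (e z)) ((e' x).zip (e' z)) := by
  have key : ∀ e : ℕ → List ℕ, (e x).length = (e z).length → (e x).zip (e z) =
      (cols e (e x).length).map fun c => ((c x).getD 0, (c z).getD 0) := by
    intro e hl
    apply List.ext_getElem
    · simp [cols, hl]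
    intro i h₁ h₂
    have hi' : i < (e z).length := by
      rw [← hl]
      simpa [cols] using h₂
    simp [cols, hl, hi']
  rw [key e hl, key e' ((h.pattern x z).1 hl)]
  exact (h.similar x).map _

theorem Sim.eq_iff (h : Sim 2 e e') (x z : ℕ) : e x = e z ↔ e' x = e' z := by
  by_cases hl : (e x).length = (e z).length
  · exact (h.zip hl).eq_iff hl ((h.pattern x z).1 hl)
  · constructor
    · intro h'; rw [h'] at hl; exact absurd rfl hl
    · intro h'; rw [h.pattern, h'] at hl; exact absurd rfl hl

theorem Sim.changes {E : ℕ → ℕ → Prop} (h : Sim 2 e e') {x z : ℕ} (hc : Changes E (e x) (e z)) :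
    Changes E (e' x) (e' z) := by
  have hl := (changes_iff_zip.1 hc).1
  exact (h.zip hl).changes ((h.pattern x z).1 hl) hc

theorem similar_replicate {α : Type} (c : α) {k k' : ℕ} (h : k = k' ∨ (t ≤ k ∧ t ≤ k')) :
    Similar t (List.replicate k c) (List.replicate k' c) := by
  classical
  rw [similar_iff]
  intro d
  rw [List.count_replicate, List.count_replicate]
  split
  · exact h
  · exact .inl rfl

/-- A length in use is answered by its partner. A fresh length below the threshold is answered by
itself; a larger one by a length among the `F.card + 1` values from `n * t` on that `F` misses. -/
theorem Sim.exists_length (hn : 1 ≤ n) (ht : 1 ≤ t) (h : Sim (n * t) e e')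
    {F : Finset ℕ} (hF : ∀ x, e' x ≠ [] → (e' x).length ∈ F) {K : ℕ} (hK : 0 < K) :
    ∃ K', Similar (n * t) (cols e K) (cols e' K') ∧
      (∀ x, (e x).length = K ↔ (e' x).length = K') ∧ 0 < K' ∧
      ((∃ x, K' = (e' x).length) ∨ K' ≤ n * t + F.card) := by
  have hnt : 1 ≤ n * t := Nat.mul_pos hn ht
  by_cases hx : ∃ x, (e x).length = K
  · obtain ⟨x, rfl⟩ := hx
    have := h.length x
    exact ⟨_, h.similar x, fun z => h.pattern z x, by omega, .inl ⟨x, rfl⟩⟩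
  push Not at hx
  by_cases hKt : K < n * t
  · have hx' : ∀ x, (e' x).length ≠ K := fun x => by
      have h₁ := h.length x
      have h₂ := hx x
      omega
    refine ⟨K, ?_, fun x => by simp [hx x, hx' x], hK, .inr (by omega)⟩
    rw [cols_fresh hx, cols_fresh hx']
    exact similar_replicate _ (.inl rfl)
  · obtain ⟨K', h₁, h₂⟩ := Finset.exists_mem_notMem_of_card_lt_card
      (show F.card < (Finset.Icc (n * t) (n * t + F.card)).card by simp; omega)
    rw [Finset.mem_Icc] at h₁
    have hx' : ∀ x, (e' x).length ≠ K' := by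
      rintro x rfl
      by_cases he : e' x = []
      · rw [he] at h₁; simp at h₁; omega
      · exact h₂ (hF x he)
    refine ⟨K', ?_, fun x => by simp [hx x, hx' x], by omega, .inr h₁.2⟩
    rw [cols_fresh hx, cols_fresh hx']
    exact similar_replicate _ (.inr (by omega))

/-- The answer to a move in the Ehrenfeucht–Fraïssé game on word graphs. -/
theorem Sim.respond (hn : 1 ≤ n) (ht : 1 ≤ t) (h : Sim (n * t) e e') {v : ℕ} (he : e v = [])
    (he' : e' v = []) {F : Finset ℕ} (hF : ∀ x, e' x ≠ [] → (e' x).length ∈ F) {w : List ℕ}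
    (hw : w ≠ []) (hwn : ∀ p ∈ w, p < n) :
    ∃ w' : List ℕ, w' ≠ [] ∧ (∀ p ∈ w', p < n) ∧ Sim t (update e v w) (update e' v w') ∧
      ((∃ x, w'.length = (e' x).length) ∨ w'.length ≤ n * t + F.card) ∧
      ∀ i a b, (∀ x, (e' x).length = w'.length → (e' x)[i]? = (e' x)[i + 1]?) → w'[i]? = some a →
        w'[i + 1]? = some b → a ≤ b := by
  obtain ⟨K', h₁, h₂, h₃, h₄⟩ := h.exists_length hn ht hF (List.length_pos_iff.2 hw)
  obtain ⟨w', k₁, k₂, k₃, k₄⟩ := h₁.zip hn ht (length_cols e _).symm hwn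
  rw [length_cols] at k₁
  subst k₁
  refine ⟨w', List.length_pos_iff.1 h₃, k₂, ⟨?_, ?_⟩, h₄, ?_⟩
  · intro x z
    by_cases hx : x = v <;> by_cases hz : z = v <;> simp only [hx, hz, Function.update_self, ne_eq,
      not_false_eq_true, Function.update_of_ne, h.pattern, h₂]
    rw [eq_comm, h₂, eq_comm]
  · intro x
    have key : Similar t (cols (update e v w) w.length) (cols (update e' v w') w'.length) := by
      rw [cols_update, cols_update]
      exact k₃.map _
    by_cases hx : x = v
    · subst hx
      rwa [Function.update_self, Function.update_self]
    · rw [Function.update_of_ne hx, Function.update_of_ne hx]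
      by_cases hxw : (e x).length = w.length
      · rwa [hxw, (h₂ x).1 hxw]
      · rw [cols_update_of_ne e v he w hxw, cols_update_of_ne e' v he' w' fun h' => hxw ((h₂ x).2 h')]
        exact (h.similar x).mono (Nat.le_mul_of_pos_left _ hn)
  · intro i a b hx ha hb
    have hi : i + 1 < w'.length := by
      by_contra hi
      rw [List.getElem?_eq_none (by omega)] at hb
      simp at hb
    have e₁ : ∀ j, j < w'.length → (cols e' w'.length)[j]? = some fun z =>
        if (e' z).length = w'.length then (e' z)[j]? else none := fun j hj => by
      simp [cols, hj]
    -- Where all words of this length repeat their letter, the two neighbouring columns coincide, so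
    -- the new word is sorted there.
    refine k₄ i _ a b (e₁ i (by omega)) ((e₁ (i + 1) hi).trans ?_) ha hb
    congr 1
    funext z
    split
    · next hz => exact (hx z hz).symm
    · rfl

end

/-! ### Codes -/

def StartsDot : List Cd → Prop
  | .dot :: _ => True
  | _ => False

/-- The positions `i` and `i + 1` belong to the same block. -/
def Adj : List Cd → ℕ → Prop
  | [], _ => False
  | .dot :: s, 0 => StartsDot s
  | .dot :: s, i + 1 => Adj s i
  | .inc :: s, i => Adj s i
  | .reset :: s, i => Adj s i
  | .halt :: s, i => Adj s i

/-- The word is constant on each block. -/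
def Aligned (u : List ℕ) (s : List Cd) : Prop := ∀ i, Adj s i → u[i]? = u[i + 1]?

/-- The word can be chosen as a refinement of the code, begun with the letter `p`. -/
def Fits (n : ℕ) : List Cd → ℕ → List ℕ → Prop
  | _, _, [] => True
  | [], _, _ :: _ => False
  | .dot :: s, p, q :: w => p ≤ q ∧ q < n ∧ Fits n s q w
  | .inc :: s, _, q :: w => Fits n s 0 (q :: w)
  | .reset :: s, _, q :: w => Fits n s 0 (q :: w)
  | .halt :: s, _, q :: w => Fits n s 0 (q :: w)

section
variable {n : ℕ}

theorem adj_sep {x : Cd} (hx : x ≠ .dot) (s : List Cd) (i : ℕ) : Adj (x :: s) i ↔ Adj s i := by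
  cases x
  · exact absurd rfl hx
  all_goals cases i <;> rfl

theorem fits_sep {x : Cd} (hx : x ≠ .dot) (s : List Cd) (p : ℕ) (w : List ℕ) :
    Fits n (x :: s) p w ↔ Fits n s 0 w := by
  cases x
  · exact absurd rfl hx
  all_goals cases w <;> simp [Fits]

theorem Ref.startsDot {s c : List Cd} {p : ℕ} {h : Bool} (r : Ref n s p h c) (hc : StartsDot c) :
    StartsDot s := by
  cases r <;> trivial

theorem Ref.adj {s c : List Cd} {p : ℕ} {h : Bool} (r : Ref n s p h c) :
    ∀ i, Adj c i → Adj s i := by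
  induction r with
  | dot r ih =>
    rintro (_ | i) h
    · exact r.startsDot h
    · exact ih i h
  | inc hp r ih => exact fun i h => ih i ((adj_sep (by simp) _ _).1 h)
  | halt => exact fun i h => (adj_sep (by simp) _ _).1 h
  | reset hx r ih => exact fun i h => (adj_sep hx _ _).2 (ih i ((adj_sep (by simp) _ _).1 h))
  | last => exact fun i h => by cases i <;> exact h.elim

theorem Ref.aligned {s c : List Cd} {p : ℕ} {h : Bool} (r : Ref n s p h c) :
    Aligned (decode c p) c := by
  induction r with
  | @dot s c p h r ih =>
    rintro (_ | i) h
    · rcases c with _ | ⟨_ | _ | _ | _, c⟩ <;> first | exact h.elim | simp [decode]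
    · exact ih i h
  | inc hp r ih => exact fun i h => ih i ((adj_sep (by simp) _ _).1 h)
  | halt => exact fun i h => by simp [decode]
  | reset hx r ih => exact fun i h => ih i ((adj_sep (by simp) _ _).1 h)
  | last => exact fun i h => by simp [decode]

/-- A halt in front of a dot is allowed only after a letter. With `h = false` and at least one dot
available, a letter is therefore emitted. -/
theorem Ref.decode_ne_nil {s c : List Cd} {p : ℕ} {h : Bool} (r : Ref n s p h c) :
    h = false → seps s < s.length → decode c p ≠ [] := by
  induction r with
  | dot _ _ => exact fun _ _ => by simp [decode]
  | inc _ _ ih => exact ih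
  | halt => simp
  | @reset x s c p h hx r ih =>
    intro h hs
    have e : seps (x :: s) = seps s + 1 := by cases x <;> first | rfl | exact absurd rfl hx
    rw [e, List.length_cons] at hs
    exact ih h (by omega)
  | last => simp

theorem Ref.length_decode {s c : List Cd} {p : ℕ} {h : Bool} (r : Ref n s p h c) :
    (decode c p).length + seps s ≤ s.length := by
  have seps_le : ∀ s, seps s ≤ s.length := fun s => by
    induction s with
    | nil => rfl
    | cons x s ih => cases x <;> simp [seps] <;> omega
  induction r with
  | dot _ ih => simp only [decode, seps, List.length_cons]; omega
  | inc _ _ ih => exact ih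
  | halt =>
    rw [decode, List.length_nil, Nat.zero_add]
    exact seps_le _
  | @reset x s c p h hx r ih =>
    have e : seps (x :: s) = seps s + 1 := by cases x <;> first | rfl | exact absurd rfl hx
    rw [e, List.length_cons]
    simp only [decode]
    omega
  | last => simp [decode, seps]

/-- The code is read off from the word: `q - p` increments before each letter, a reset at each old
separation, and a halt when the word ends. -/
theorem exists_ref (s : List Cd) : ∀ (p : ℕ) (h : Bool) (w : List ℕ), p < n → Fits n s p w →
    (h = true ∨ w ≠ []) → ∃ c, Ref n s p h c ∧ decode c p = w := by
  induction s with
  | nil =>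
    rintro p h (_ | ⟨q, w⟩) hp hw hne
    · exact ⟨_, .last, rfl⟩
    · exact hw.elim
  | cons x s ih =>
    intro p h w hp hw hne
    by_cases hx : x = .dot
    · subst hx
      cases w with
      | nil =>
        obtain rfl : h = true := by simpa using hne
        exact ⟨_, .halt, rfl⟩
      | cons q w =>
        obtain ⟨hpq, hq, hw⟩ := hw
        obtain ⟨k, rfl⟩ : ∃ k, q = p + k := ⟨q - p, by omega⟩
        induction k generalizing p with
        | zero =>
          obtain ⟨c, hc, hd⟩ := ih p true w hp hw (.inl rfl)
          exact ⟨_, .dot hc, by simp [decode, hd]⟩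
        | succ k ihk =>
          have e : p + 1 + k = p + (k + 1) := by omega
          obtain ⟨c, hc, hd⟩ := ihk (p + 1) (by omega) (by simp) (by omega) (by omega) (by rwa [e])
          exact ⟨_, .inc (by omega) hc, by rw [decode, hd, e]⟩
    · rw [fits_sep hx] at hw
      obtain ⟨c, hc, hd⟩ := ih 0 h w (by omega) hw hne
      exact ⟨_, .reset hx hc, by rw [decode, hd]⟩

/-- Within a block letters may only increase, and at a separation they start afresh; so sortedness
within the blocks and enough dots are all that is needed. -/
theorem fits_of_sorted (s : List Cd) : ∀ (p : ℕ) (w : List ℕ), (∀ q ∈ w, q < n) →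
    w.length + seps s ≤ s.length →
    (∀ i a b, Adj s i → w[i]? = some a → w[i + 1]? = some b → a ≤ b) →
    (StartsDot s → ∀ q, w[0]? = some q → p ≤ q) → Fits n s p w := by
  induction s with
  | nil =>
    intro p w _ hl _ _
    obtain rfl : w = [] := by simpa [seps] using hl
    trivial
  | cons x s ih =>
    intro p w hw hl hs h₀
    by_cases hx : x = .dot
    · subst hx
      cases w with
      | nil => trivial
      | cons q w =>
        refine ⟨h₀ trivial q rfl, hw q List.mem_cons_self, ih q w
          (fun z hz => hw z (List.mem_cons_of_mem _ hz)) ?_ (fun i a b hi => hs (i + 1) a b hi)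
          fun hd z hz => hs 0 q z hd rfl hz⟩
        simp only [seps, List.length_cons] at hl
        omega
    · have e : seps (x :: s) = seps s + 1 := by cases x <;> first | rfl | exact absurd rfl hx
      rw [fits_sep hx]
      rw [e, List.length_cons] at hl
      exact ih 0 w hw (by omega) (fun i a b hi => hs i a b ((adj_sep hx s i).2 hi)) (by simp)

end

end WordGraph

/-! ### Words and codes give the same game. -/

namespace WordGraph

open Function (update)

/-- The truth of a formula in the word graph over `0, …, n - 1`; only the quantifiers are restricted
to nonempty words. -/
def WSat {α : Type} (n : ℕ) (E : α → ℕ → ℕ → Prop) : Formula α → (ℕ → List ℕ) → Prop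
  | .eq x z, e => e x = e z
  | .edge a x z, e => Changes (E a) (e x) (e z)
  | .neg φ, e => ¬ WSat n E φ e
  | .and φ ψ, e => WSat n E φ e ∧ WSat n E ψ e
  | .or φ ψ, e => WSat n E φ e ∨ WSat n E ψ e
  | .imp φ ψ, e => WSat n E φ e → WSat n E ψ e
  | .iff φ ψ, e => WSat n E φ e ↔ WSat n E ψ e
  | .ex x φ, e => ∃ w : List ℕ, w ≠ [] ∧ (∀ p ∈ w, p < n) ∧ WSat n E φ (update e x w)
  | .all x φ, e => ∀ w : List ℕ, w ≠ [] → (∀ p ∈ w, p < n) → WSat n E φ (update e x w)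

theorem WSat.congr {α : Type} {n : ℕ} {E : α → ℕ → ℕ → Prop} (φ : Formula α) :
    ∀ e e' : ℕ → List ℕ, (∀ x ∈ φ.freeVars, e x = e' x) → (WSat n E φ e ↔ WSat n E φ e') := by
  induction φ with
  | eq x z | edge a x z =>
    intro e e' h
    rw [WSat, WSat, h x (by simp [Formula.freeVars]), h z (by simp [Formula.freeVars])]
  | neg φ ih => exact fun e e' h => not_congr (ih e e' h)
  | and φ ψ ih₁ ih₂ | or φ ψ ih₁ ih₂ | imp φ ψ ih₁ ih₂ | iff φ ψ ih₁ ih₂ =>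
    intro e e' h
    rw [WSat, WSat, ih₁ e e' fun x hx => h x (Finset.mem_union_left _ hx),
      ih₂ e e' fun x hx => h x (Finset.mem_union_right _ hx)]
  | ex x φ ih | all x φ ih =>
    intro e e' h
    have key : ∀ w, WSat n E φ (update e x w) ↔ WSat n E φ (update e' x w) := fun w =>
      ih _ _ fun z hz => by
        by_cases hzx : z = x
        · subst hzx; simp
        · simp only [ne_eq, hzx, not_false_eq_true, Function.update_of_ne]
          exact h z (Finset.mem_erase.2 ⟨hzx, hz⟩)
    simp only [WSat, key]

section
variable {n m : ℕ} {G : LabelledGraph (Fin n) (Fin m)}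

abbrev letters (w : List (Fin n)) : List ℕ := w.map Fin.val

theorem letters_injective : Function.Injective (letters (n := n)) :=
  List.map_injective_iff.2 Fin.val_injective

theorem exists_letters {w : List ℕ} (hw : ∀ p ∈ w, p < n) : ∃ u : List (Fin n), letters u = w := by
  refine ⟨w.pmap (fun p hp => ⟨p, hp⟩) hw, ?_⟩
  simp [letters, List.map_pmap]

theorem plus_edge_iff (o : Fin m) (u v : Word (Fin n)) :
    G.plus.edge o u v ↔ Changes (edges G o) (letters u.1) (letters v.1) := by
  rw [changes_iff]
  constructor
  · rintro ⟨x, y, p, q, h, hu, hv⟩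
    exact ⟨letters x, letters y, p, q, ⟨p, q, rfl, rfl, h⟩, by simp [hu], by simp [hv]⟩
  · rintro ⟨x, y, _, _, ⟨p, q, rfl, rfl, h⟩, hu, hv⟩
    obtain ⟨x', u', hu', rfl, h'⟩ := List.map_eq_append_iff.1 hu
    obtain ⟨p', y', rfl, hp, rfl⟩ := List.map_eq_cons_iff.1 h'
    obtain rfl := Fin.ext hp
    refine ⟨x', y', p', q, h, hu', letters_injective ?_⟩
    exact hv.trans (by simp [letters])

theorem sat_iff (φ : Formula (Fin m)) : ∀ e : ℕ → Word (Fin n),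
    φ.Sat G.plus e ↔ WSat n (edges G) φ fun x => letters (e x).1 := by
  have upd : ∀ (e : ℕ → Word (Fin n)) (x : ℕ) (w : Word (Fin n)),
      (fun z => letters (update e x w z).1) = update (fun z => letters (e z).1) x (letters w.1) := by
    intro e x w
    funext z
    by_cases hz : z = x
    · subst hz; simp
    · simp [hz]
  have lt : ∀ (w : Word (Fin n)), ∀ p ∈ letters w.1, p < n := by
    intro w p hp
    obtain ⟨q, -, rfl⟩ := List.mem_map.1 hp
    exact q.2
  induction φ with
  | eq x z =>
    intro e
    rw [Formula.Sat, WSat, letters_injective.eq_iff, Subtype.ext_iff]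
  | edge a x z => exact fun e => plus_edge_iff a _ _
  | neg φ ih => exact fun e => not_congr (ih e)
  | and φ ψ ih₁ ih₂ | or φ ψ ih₁ ih₂ | imp φ ψ ih₁ ih₂ | iff φ ψ ih₁ ih₂ =>
    intro e
    rw [Formula.Sat, WSat, ih₁ e, ih₂ e]
  | ex x φ ih =>
    intro e
    rw [Formula.Sat, WSat]
    constructor
    · rintro ⟨w, hw⟩
      rw [ih, upd] at hw
      exact ⟨letters w.1, by simpa using w.2, lt w, hw⟩
    · rintro ⟨w, h₁, h₂, hw⟩
      obtain ⟨u, rfl⟩ := exists_letters h₂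
      refine ⟨⟨u, by simpa using h₁⟩, ?_⟩
      rw [ih, upd]
      exact hw
  | all x φ ih =>
    intro e
    rw [Formula.Sat, WSat]
    constructor
    · intro H w h₁ h₂
      obtain ⟨u, rfl⟩ := exists_letters h₂
      have hw := H ⟨u, by simpa using h₁⟩
      rwa [ih, upd] at hw
    · intro H w
      rw [ih, upd]
      exact H _ (by simpa using w.2) (lt w)

theorem models_iff (hn : 1 ≤ n) {φ : Formula (Fin m)} (hφ : φ.IsSentence) :
    G.plus.Models φ ↔ WSat n (edges G) φ fun _ => [] := by
  have key : ∀ e : ℕ → Word (Fin n), φ.Sat G.plus e ↔ WSat n (edges G) φ fun _ => [] := fun e => by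
    rw [sat_iff]
    refine WSat.congr φ _ _ fun x hx => ?_
    rw [hφ] at hx
    simp at hx
  exact ⟨fun h => (key fun _ => ⟨[⟨0, hn⟩], by simp⟩).1 (h _), fun h e => (key e).2 h⟩

end

/-- The words of the assignment have at most `j` lengths. -/
def FewLengths (j : ℕ) (e : ℕ → List ℕ) : Prop :=
  ∃ F : Finset ℕ, F.card ≤ j ∧ ∀ x, e x ≠ [] → (e x).length ∈ F

theorem FewLengths.update {j : ℕ} {e : ℕ → List ℕ} (h : FewLengths j e) (v : ℕ) (w : List ℕ) :
    FewLengths (j + 1) (update e v w) := by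
  obtain ⟨F, hF, h⟩ := h
  refine ⟨insert w.length F, (Finset.card_insert_le _ _).trans (by omega), fun x hx => ?_⟩
  by_cases hxv : x = v
  · subst hxv; simp
  · rw [Function.update_of_ne hxv] at hx ⊢
    exact Finset.mem_insert_of_mem (h x hx)

theorem FewLengths.erase {j : ℕ} {e : ℕ → List ℕ} (h : FewLengths j e) (v : ℕ) :
    FewLengths j (Function.update e v []) := by
  obtain ⟨F, hF, h⟩ := h
  refine ⟨F, hF, fun x hx => ?_⟩
  by_cases hxv : x = v
  · subst hxv; simp at hx
  · rw [Function.update_of_ne hxv] at hx ⊢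
    exact h x hx

/-- The words of the assignment have codes that are refined by `s`. -/
structure Coded (L : ℕ) (s : List Cd) (e : ℕ → List ℕ) : Prop where
  room : s.length = L + seps s
  length : ∀ x, (e x).length ≤ L
  aligned : ∀ x, Aligned (e x) s

theorem wordOf_cons (x : ℕ) (c : List Cd) (es : List (ℕ × List Cd)) :
    wordOf ((x, c) :: es) = update (wordOf es) x (decode c 0) := by
  funext z
  by_cases hz : z = x
  · subst hz; simp [wordOf, codeOf]
  · simp [wordOf, codeOf, hz, Ne.symm hz]

theorem Coded.update {n L : ℕ} {s c : List Cd} {e : ℕ → List ℕ} (h : Coded L s e)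
    (r : Ref n s 0 false c) (x : ℕ) : Coded L c (update e x (decode c 0)) := by
  have h₁ := r.length_add
  have h₂ := r.length_decode
  have h₃ := h.room
  refine ⟨by omega, fun z => ?_, fun z => ?_⟩
  · by_cases hz : z = x
    · subst hz; rw [Function.update_self]; omega
    · rw [Function.update_of_ne hz]; exact h.length z
  · by_cases hz : z = x
    · subst hz; rw [Function.update_self]; exact r.aligned
    · rw [Function.update_of_ne hz]; exact fun i hi => h.aligned z i (r.adj i hi)

/-- The first code leaves room for a word as long as the largest threshold, plus one spare length
per quantifier. -/
theorem two_mul_pow_add_le_room {n : ℕ} (hn : 1 ≤ n) (k : ℕ) : 2 * n ^ k + k ≤ room n k := by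
  induction k with
  | zero => simp [room]
  | succ k ih =>
    rw [room, pow_succ]
    have h₁ := Nat.mul_le_mul_left n ih
    have h₂ := Nat.mul_le_mul_right k hn
    rw [mul_add, show n * (2 * n ^ k) = 2 * (n ^ k * n) by ring] at h₁
    omega

section
variable {α : Type} {n l : ℕ} {E : α → ℕ → ℕ → Prop} {s : List Cd} {e : ℕ → List ℕ}
  {es : List (ℕ × List Cd)} {j k : ℕ}

/-- A word is answered by a code. -/
theorem exists_code (hn : 1 ≤ n) (hjk : j + (k + 1) ≤ l) (h : Sim (2 * n ^ (k + 1)) e (wordOf es))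
    (h' : FewLengths j (wordOf es)) (hs : Coded (room n l) s (wordOf es)) (x : ℕ) (w : List ℕ)
    (hw : w ≠ []) (hwn : ∀ p ∈ w, p < n) :
    ∃ c, Ref n s 0 false c ∧ Sim (2 * n ^ k) (update e x w) (wordOf ((x, c) :: es)) := by
  have hk : 1 ≤ n ^ k := Nat.one_le_pow _ _ hn
  have hk' : 1 ≤ n ^ (k + 1) := Nat.one_le_pow _ _ hn
  obtain ⟨F, hF, hF'⟩ := h'.erase x
  have h₁ := h.erase (by omega) x
  -- One quantifier uses up one factor `n` of the threshold.
  rw [show 2 * n ^ (k + 1) = n * (2 * n ^ k) by ring] at h₁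
  obtain ⟨w', k₁, k₂, k₃, k₄, k₅⟩ := h₁.respond hn (by omega) (v := x) (by simp) (by simp) hF' hw hwn
  rw [Function.update_idem, Function.update_idem] at k₃
  have hlen : w'.length ≤ room n l := by
    rcases k₄ with ⟨z, hz⟩ | hz
    · by_cases hzx : z = x
      · subst hzx; simp at hz; exact absurd hz k₁
      · rw [Function.update_of_ne hzx] at hz
        rw [hz]
        exact hs.length z
    · have h₂ := two_mul_pow_add_le_room hn l
      have h₃ : n * (2 * n ^ k) ≤ 2 * n ^ l := by
        rw [show n * (2 * n ^ k) = 2 * n ^ (k + 1) by ring]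
        exact Nat.mul_le_mul_left _ (Nat.pow_le_pow_right hn (by omega))
      omega
  obtain ⟨c, hc, hd⟩ := exists_ref s 0 false w' hn (fits_of_sorted s 0 w' k₂
    (by have := hs.room; omega) (fun i a b hi => k₅ i a b fun z _ => by
      by_cases hzx : z = x
      · subst hzx; simp
      · rw [Function.update_of_ne hzx]
        exact hs.aligned z i hi) (fun _ q _ => Nat.zero_le q)) (.inr k₁)
  refine ⟨c, hc, ?_⟩
  rwa [wordOf_cons, hd]

/-- A code is answered by a word. -/
theorem exists_word_of_code (hn : 1 ≤ n) (h : Sim (2 * n ^ (k + 1)) e (wordOf es))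
    (h' : FewLengths j e) (hl : 0 < l) (hs : s.length = l + seps s) (x : ℕ) {c : List Cd}
    (hc : Ref n s 0 false c) :
    ∃ w, w ≠ [] ∧ (∀ p ∈ w, p < n) ∧ Sim (2 * n ^ k) (update e x w) (wordOf ((x, c) :: es)) := by
  have hk : 1 ≤ n ^ k := Nat.one_le_pow _ _ hn
  have hk' : 1 ≤ n ^ (k + 1) := Nat.one_le_pow _ _ hn
  obtain ⟨F, hF, hF'⟩ := h'.erase x
  have h₁ := (h.symm.erase (by omega) x)
  rw [show 2 * n ^ (k + 1) = n * (2 * n ^ k) by ring] at h₁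
  obtain ⟨w, k₁, k₂, k₃, -, -⟩ := h₁.respond hn (by omega) (v := x) (by simp) (by simp) hF'
    (hc.decode_ne_nil rfl (by omega))
    (fun p hp => (decode_lt c 0 hn p hp).resolve_right (not_not.2 hc.valid))
  rw [Function.update_idem, Function.update_idem, ← wordOf_cons] at k₃
  exact ⟨w, k₁, k₂, k₃.symm⟩

/-- Back and forth between unrestricted words on the left and codes on the right. After `j`
quantifiers, with `k` to go, the assignments agree up to `2 * n ^ k`; at an atom the threshold is
still at least 2. -/
theorem wSat_iff_bSat (hn : 1 ≤ n) (φ : Formula α) : ∀ (k j : ℕ) (s : List Cd) (e : ℕ → List ℕ)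
    (es : List (ℕ × List Cd)), φ.quantifierRank ≤ k → j + k ≤ l → Sim (2 * n ^ k) e (wordOf es) →
    FewLengths j e → FewLengths j (wordOf es) → Coded (room n l) s (wordOf es) →
    (WSat n E φ e ↔ BSat n E φ s es) := by
  have sim : ∀ {k : ℕ} {e e' : ℕ → List ℕ}, Sim (2 * n ^ k) e e' → Sim 2 e e' := fun {k} _ _ h =>
    ⟨h.pattern, fun x => (h.similar x).mono (by have := Nat.one_le_pow k n hn; omega)⟩
  have hroom : 0 < room n l := by have := two_mul_pow_add_le_room hn l; have := Nat.one_le_pow l n hn; omega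
  induction φ with
  | eq x z => exact fun k j s e es _ _ h _ _ _ => (sim h).eq_iff x z
  | edge a x z =>
    exact fun k j s e es _ _ h _ _ _ => ⟨fun hc => (sim h).changes hc, fun hc => (sim h).symm.changes hc⟩
  | neg φ ih => exact fun k j s e es hk hj h h₁ h₂ h₃ => not_congr (ih k j s e es hk hj h h₁ h₂ h₃)
  | and φ ψ ih₁ ih₂ | or φ ψ ih₁ ih₂ | imp φ ψ ih₁ ih₂ | iff φ ψ ih₁ ih₂ =>
    intro k j s e es hk hj h h₁ h₂ h₃
    rw [Formula.quantifierRank] at hk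
    rw [WSat, BSat, ih₁ k j s e es (by omega) hj h h₁ h₂ h₃, ih₂ k j s e es (by omega) hj h h₁ h₂ h₃]
  | ex x φ ih =>
    intro k j s e es hk hj h h₁ h₂ h₃
    rw [Formula.quantifierRank] at hk
    obtain ⟨k, rfl⟩ : ∃ k', k = k' + 1 := ⟨k - 1, by omega⟩
    have step : ∀ w c, Ref n s 0 false c → Sim (2 * n ^ k) (update e x w) (wordOf ((x, c) :: es)) →
        (WSat n E φ (update e x w) ↔ BSat n E φ c ((x, c) :: es)) := fun w c hc hsim => by
      refine ih k (j + 1) c _ _ (by omega) (by omega) hsim (h₁.update x w) ?_ ?_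
      · rw [wordOf_cons]; exact h₂.update x _
      · rw [wordOf_cons]; exact h₃.update hc x
    rw [WSat, BSat]
    constructor
    · rintro ⟨w, hw, hwn, hφ⟩
      obtain ⟨c, hc, hsim⟩ := exists_code hn hj h h₂ h₃ x w hw hwn
      exact ⟨c, hc, (step w c hc hsim).1 hφ⟩
    · rintro ⟨c, hc, hφ⟩
      obtain ⟨w, hw, hwn, hsim⟩ := exists_word_of_code hn h h₁ hroom h₃.room x hc
      exact ⟨w, hw, hwn, (step w c hc hsim).2 hφ⟩
  | all x φ ih =>
    intro k j s e es hk hj h h₁ h₂ h₃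
    rw [Formula.quantifierRank] at hk
    obtain ⟨k, rfl⟩ : ∃ k', k = k' + 1 := ⟨k - 1, by omega⟩
    have step : ∀ w c, Ref n s 0 false c → Sim (2 * n ^ k) (update e x w) (wordOf ((x, c) :: es)) →
        (WSat n E φ (update e x w) ↔ BSat n E φ c ((x, c) :: es)) := fun w c hc hsim => by
      refine ih k (j + 1) c _ _ (by omega) (by omega) hsim (h₁.update x w) ?_ ?_
      · rw [wordOf_cons]; exact h₂.update x _
      · rw [wordOf_cons]; exact h₃.update hc x
    rw [WSat, BSat]
    constructor
    · intro H c hc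
      obtain ⟨w, hw, hwn, hsim⟩ := exists_word_of_code hn h h₁ hroom h₃.room x hc
      exact (step w c hc hsim).1 (H w hw hwn)
    · intro H w hw hwn
      obtain ⟨c, hc, hsim⟩ := exists_code hn hj h h₂ h₃ x w hw hwn
      exact (step w c hc hsim).2 (H c hc)

theorem aligned_nil (s : List Cd) : Aligned [] s := fun i _ => by simp

theorem wSat_iff (hn : 1 ≤ n) (φ : Formula α) : (WSat n E φ fun _ => []) ↔
    BSat n E φ (dots (room n φ.quantifierRank)) [] := by
  have hw : wordOf [] = fun _ => [] := rfl
  have hf : FewLengths 0 fun _ => [] := ⟨∅, by simp, by simp⟩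
  have hs : ∀ k, seps (dots k) = 0 := fun k => by
    induction k with
    | zero => rfl
    | succ k ih => exact ih
  refine wSat_iff_bSat hn φ φ.quantifierRank 0 _ _ _ le_rfl (Nat.zero_add _).le ?_ hf (hw ▸ hf) ?_
  · exact ⟨fun _ _ => Iff.rfl, fun _ c => .inl rfl⟩
  · exact ⟨by simp [hs], fun _ => Nat.zero_le _, fun _ => aligned_nil _⟩

end

end WordGraph

theorem mainTheorem2 :
    ∃ (M : WordGraph.ATM) (C : ℕ),
      ∀ (n m : ℕ) (_ : 1 ≤ n) (G : WordGraph.LabelledGraph (Fin n) (Fin m))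
        (φ : WordGraph.Formula (Fin m)) (_ : φ.IsSentence),
        (M.Accepts (WordGraph.inputWord n φ) (WordGraph.adjacencyTable G) ↔ G.plus.Models φ) ∧
        ∀ (t : ℕ) (f : ℕ → M.Cfg),
          M.IsComputation (WordGraph.inputWord n φ) (WordGraph.adjacencyTable G) t f →
            t ≤ C * (max n 2 ^ φ.quantifierRank * φ.size) ∧
            M.alternations t f ≤ C * φ.quantifierRank := by
  -- The constant `1001 = 2 * 500 + 1` stems from two Turing steps per stack step and the initial
  -- step.
  refine ⟨WordGraph.toATM WordGraph.check .scan, 1001, fun n m hn G φ hφ => ?_⟩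
  have h := (WordGraph.run_check G hn φ hφ).evaluates_initial
  refine ⟨h.1.trans ((WordGraph.wSat_iff hn φ).symm.trans (WordGraph.models_iff hn hφ).symm),
    fun t f hf => ?_⟩
  obtain ⟨ht, ha⟩ := h.2 t f hf.1 hf.2
  refine ⟨ht.trans ?_, ha.trans (Nat.mul_le_mul_right _ (by norm_num))⟩
  obtain ⟨o, l, he, -⟩ := WordGraph.exists_isOp φ
  have h₁ : 0 < max n 2 ^ φ.quantifierRank * φ.size :=
    Nat.mul_pos (by positivity) (by simp [WordGraph.Formula.size, he])
  lia
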